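/- **Theorem (Exponential Barycentre Formula).** Let $N$ be a smooth manifold with a smooth torsion-free connection $\nabla$ on its tangent bundle, and let $\|\cdot\|$ be the norm on tangent spaces and their tensor products given by some continuous Riemannian reference metric, which need not be related to $\nabla$. Write $R(X,Y)Z=\nabla_Y\nabla_XZ-\nabla_X\nabla_YZ+\nabla_{[X,Y]}Z$ for the curvature, and $R_{ijk}=R(\partial_i,\partial_j)\partial_k$. Let $U\subset N$ be an open set that is geodesically convex: any two points $y,p\in U$ are joined by exactly one geodesic $[0,1]\to U$, whose initial velocity, denoted $\exp_y^{-1}(p)\in T_yN$, depends smoothly on $(y,p)$. Fix $x\in U$. For each $\gamma>0$ let $Z=Z_\gamma$ be a random point of $N$ with $Z_\gamma\in U$ almost surely, put $\eta=\exp_x^{-1}(Z)$, and suppose $\eta$ has finite fourth moment. All $O(\cdot)$ statements are for $\gamma\to0^+$. Let $\mu=E[\eta]\in T_xN$ and $\Sigma=E[(\eta-\mu)\otimes(\eta-\mu)]\in T_xN\otimes T_xN$, and suppose $$\|\mu\|=O(\gamma),\qquad \|\Sigma\|=O(\gamma^2),\qquad E\|\eta-\mu\|^4=O(\gamma^4).$$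 Define $$z=\exp_x\Bigl\{\mu-\tfrac13\sum_{i,j,k}R_{ijk}(x)\,\mu^i\Sigma^{jk}\Bigr\},$$ and suppose that there is a constant $C$ such that, for all small $\gamma$, $\|\exp_z^{-1}(Z)\|\le C\,(1+\|\exp_x^{-1}(Z)\|)$ almost surely (this is automatic if, for example, $Z_\gamma$ takes its values in a fixed compact subset of $U$). Then for all small $\gamma$ the point $z$ is well defined and lies in $U$, $\exp_z^{-1}(Z)$ is integrable, and $$\bigl\|E[\exp_z^{-1}(Z)]\bigr\|=O(\gamma^4),$$ that is, $z$ is an approximate exponential barycentre of $Z$. Moreover, if $T$ is a smooth tensor field of type $(1,3)$ on $N$ and $\|E[T(\eta-\mu,\eta-\mu,\eta-\mu)]\|=O(\gamma^4)$, then for all small $\gamma$ the vector $T(\exp_z^{-1}(Z),\exp_z^{-1}(Z),\exp_z^{-1}(Z))$ is integrable, and $$\bigl\|E[T(\exp_z^{-1}(Z),\exp_z^{-1}(Z),\exp_z^{-1}(Z))]\bigr\|=O(\gamma^4).$$ -/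

import Mathlib

open MeasureTheory Filter Set Asymptotics Bundle
open scoped Manifold ContDiff Topology TensorProduct Bundle

noncomputable section

namespace ExpBary

section Geometry

variable {n : ℕ} {N : Type*} [TopologicalSpace N] [ChartedSpace (EuclideanSpace ℝ (Fin n)) N]
  [IsManifold (𝓡 n) ∞ N]

/-- The vector field which, in the chart at `x₀`, has the constant coordinates `w`
(a linear combination of the coordinate fields `∂/∂xᵢ`). -/
def coordField (x₀ : N) (w : EuclideanSpace ℝ (Fin n)) (y : N) : TangentSpace (𝓡 n) y :=
  (trivializationAt (EuclideanSpace ℝ (Fin n)) (TangentSpace (𝓡 n) : N → Type _) x₀).symm y w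

/-- The local connector `Γ(y)(v ⊗ w)` of a connection `D` in the chart at `x₀`:
the coordinates of `∇_V W` at `y`, for the fields `V`, `W` with constant coordinates `v`, `w`. -/
def connector
    (D : CovariantDerivative (𝓡 n) (EuclideanSpace ℝ (Fin n)) (TangentSpace (𝓡 n) : N → Type _))
    (x₀ y : N) (v w : EuclideanSpace ℝ (Fin n)) : EuclideanSpace ℝ (Fin n) :=
  (trivializationAt (EuclideanSpace ℝ (Fin n)) (TangentSpace (𝓡 n) : N → Type _) x₀
    ⟨y, D (coordField x₀ w) y (coordField x₀ v y)⟩).2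

/-- `c` is a geodesic over the set of times `s`: it is `C²` near `s` and at times of `s` it solves
`u'' + Γ(u)(u' ⊗ u') = 0` in charts. -/
structure IsGeodesicOn
    (D : CovariantDerivative (𝓡 n) (EuclideanSpace ℝ (Fin n)) (TangentSpace (𝓡 n) : N → Type _))
    (c : ℝ → N) (s : Set ℝ) : Prop where
  contMDiffAt : ∀ t ∈ s, ContMDiffAt 𝓘(ℝ, ℝ) (𝓡 n) 2 c t
  equation : ∀ t ∈ s, ∀ x₀ : N, c t ∈ (chartAt (EuclideanSpace ℝ (Fin n)) x₀).source →
    deriv (deriv fun r => extChartAt (𝓡 n) x₀ (c r)) t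
      + connector D x₀ (c t) (deriv (fun r => extChartAt (𝓡 n) x₀ (c r)) t)
          (deriv (fun r => extChartAt (𝓡 n) x₀ (c r)) t) = 0

/-- There is a geodesic `[0,1] → U` which starts at `y` with velocity `v` and ends at `p`. -/
def GeodesicArc
    (D : CovariantDerivative (𝓡 n) (EuclideanSpace ℝ (Fin n)) (TangentSpace (𝓡 n) : N → Type _))
    (U : Set N) (y : N) (v : TangentSpace (𝓡 n) y) (p : N) : Prop :=
  ∃ c : ℝ → N, IsGeodesicOn D c (Icc 0 1) ∧ MapsTo c (Icc 0 1) U ∧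
    (⟨c 0, mfderiv 𝓘(ℝ, ℝ) (𝓡 n) c 0 (1 : ℝ)⟩ : TangentBundle (𝓡 n) N) = ⟨y, v⟩ ∧ c 1 = p

open Classical in
/-- The exponential map `exp_y v`: the value at time `1` of the geodesic with initial velocity `v`
(and `y`, a value without meaning, if that geodesic does not exist up to time `1`). -/
def expMap
    (D : CovariantDerivative (𝓡 n) (EuclideanSpace ℝ (Fin n)) (TangentSpace (𝓡 n) : N → Type _))
    (y : N) (v : TangentSpace (𝓡 n) y) : N :=
  if h : ∃ p, GeodesicArc D univ y v p then h.choose else y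

open Classical in
/-- The inverse exponential map `exp_y⁻¹ p` in `U`: the initial velocity of the geodesic
`[0,1] → U` from `y` to `p` (and `0`, a value without meaning, if there is none). -/
def expInv
    (D : CovariantDerivative (𝓡 n) (EuclideanSpace ℝ (Fin n)) (TangentSpace (𝓡 n) : N → Type _))
    (U : Set N) (y p : N) : TangentSpace (𝓡 n) y :=
  if h : ∃ v, GeodesicArc D U y v p then h.choose else 0

/-- An open set `U` is geodesically convex if any two of its points are joined by one and only one
geodesic `[0,1] → U`, which depends smoothly on the endpoints. -/
structure IsGeodesicallyConvex
    (D : CovariantDerivative (𝓡 n) (EuclideanSpace ℝ (Fin n)) (TangentSpace (𝓡 n) : N → Type _))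
    (U : Set N) : Prop where
  isOpen : IsOpen U
  existsUnique : ∀ y ∈ U, ∀ p ∈ U, ∃! v : TangentSpace (𝓡 n) y, GeodesicArc D U y v p
  smooth : ContMDiffOn ((𝓡 n).prod (𝓡 n)) (𝓡 n).tangent ∞
    (fun q : N × N => (⟨q.1, expInv D U q.1 q.2⟩ : TangentBundle (𝓡 n) N)) (U ×ˢ U)

/-- The curvature `R(X, Y)Z = ∇_Y ∇_X Z - ∇_X ∇_Y Z + ∇_{[X, Y]} Z` on vector fields, in do Carmo's
sign convention. -/
def curvatureField
    (D : CovariantDerivative (𝓡 n) (EuclideanSpace ℝ (Fin n)) (TangentSpace (𝓡 n) : N → Type _))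
    (X Y Z : (y : N) → TangentSpace (𝓡 n) y) (x : N) : TangentSpace (𝓡 n) x :=
  D (fun y => D Z y (X y)) x (Y x) - D (fun y => D Z y (Y y)) x (X x)
    + D Z x (VectorField.mlieBracket (𝓡 n) X Y x)

/-- The curvature tensor `R(u, v)w` at `x`, computed by extending the vectors to smooth fields
near `x`. -/
def curvature
    (D : CovariantDerivative (𝓡 n) (EuclideanSpace ℝ (Fin n)) (TangentSpace (𝓡 n) : N → Type _))
    (x : N) (u v w : TangentSpace (𝓡 n) x) : TangentSpace (𝓡 n) x :=
  curvatureField D (FiberBundle.extend (EuclideanSpace ℝ (Fin n)) u)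
    (FiberBundle.extend (EuclideanSpace ℝ (Fin n)) v)
    (FiberBundle.extend (EuclideanSpace ℝ (Fin n)) w) x

/-- The vector `∑ R_{ijk} μⁱ Σʲᵏ`, where `R_{ijk} = R(bᵢ, bⱼ)bₖ` for the basis `b` of `T_x N`. -/
def curvatureSum
    (D : CovariantDerivative (𝓡 n) (EuclideanSpace ℝ (Fin n)) (TangentSpace (𝓡 n) : N → Type _))
    (x : N) (b : Module.Basis (Fin n) ℝ (TangentSpace (𝓡 n) x)) (m : TangentSpace (𝓡 n) x)
    (S : TangentSpace (𝓡 n) x ⊗[ℝ] TangentSpace (𝓡 n) x) : TangentSpace (𝓡 n) x :=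
  ∑ i, ∑ j, ∑ k, (b.repr m i * (b.tensorProduct b).repr S (j, k)) • curvature D x (b i) (b j) (b k)

/-- A smooth tensor field of type `(1, 3)`. -/
structure TensorField13 (n : ℕ) (N : Type*) [TopologicalSpace N]
    [ChartedSpace (EuclideanSpace ℝ (Fin n)) N] [IsManifold (𝓡 n) ∞ N] where
  toFun : (y : N) → TangentSpace (𝓡 n) y →L[ℝ] TangentSpace (𝓡 n) y →L[ℝ]
    TangentSpace (𝓡 n) y →L[ℝ] TangentSpace (𝓡 n) y
  smooth : ∀ X Y Z : (y : N) → TangentSpace (𝓡 n) y,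
    ContMDiff (𝓡 n) (𝓡 n).tangent ∞ (fun y => (⟨y, X y⟩ : TangentBundle (𝓡 n) N)) →
    ContMDiff (𝓡 n) (𝓡 n).tangent ∞ (fun y => (⟨y, Y y⟩ : TangentBundle (𝓡 n) N)) →
    ContMDiff (𝓡 n) (𝓡 n).tangent ∞ (fun y => (⟨y, Z y⟩ : TangentBundle (𝓡 n) N)) →
    ContMDiff (𝓡 n) (𝓡 n).tangent ∞
      (fun y => (⟨y, toFun y (X y) (Y y) (Z y)⟩ : TangentBundle (𝓡 n) N))

end Geometry

section Probability

variable {Ω V : Type*} [MeasurableSpace Ω] [NormedAddCommGroup V] [InnerProductSpace ℝ V]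

/-- The covariance tensor `Var(η) = E[(η - E η) ⊗ (η - E η)]` of a random vector. The norm on
`V ⊗ V` is the one induced by the inner product of `V`. -/
def covTensor (P : Measure Ω) (η : Ω → V) : V ⊗[ℝ] V :=
  ∫ a, (η a - ∫ a', η a' ∂P) ⊗ₜ[ℝ] (η a - ∫ a', η a' ∂P) ∂P

end Probability

end ExpBary

end

/-!
The inverse exponential map has, in normal coordinates at `x`, the Taylor expansion
`exp_z⁻¹ p = (w - v) + L(v)(w - v) - (1/3) R(v, w - v)(w - v) + remainder`, where `z` and `p` have
the normal coordinates `v` and `w`, the linear maps `L(v)` are of size `O(‖v‖)`, and the remainder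
is `O(‖v‖ ‖w - v‖³ + ‖v‖² ‖w - v‖²)`. Put `w = η = exp_x⁻¹ Z` and
`v = μ - (1/3) E[R(μ, η - μ)(η - μ)]` and take expectations: `E[η - v]` is cancelled by the
curvature term, `L(v) E[η - v]` is the product of `L(v) = O(γ)` with `E[η - v] = O(γ³)`, and the
rest is `O(γ⁴)` by the bound on the fourth moment of `η - μ`. The sum
`∑ R_{ijk} μⁱ Σʲᵏ` is `E[R(μ, η - μ)(η - μ)]`, since it is linear in the covariance tensor. So `E[exp_z⁻¹ Z] = O(γ⁴)`. Similarly
`T(exp_z⁻¹ Z, exp_z⁻¹ Z, exp_z⁻¹ Z)` differs from `T(η - μ, η - μ, η - μ)` at `x` by terms with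
expectation `O(γ⁴)`.

*The expansion* (`IsLocalExpInv.exists_expansion`). The geodesic equation gives the first two
derivatives of `p ↦ exp_q⁻¹ p` at `p = q` in a chart: they are the identity
(`IsLocalExpInv.fderiv_self`) and the connector `Γ(q)` (`IsLocalExpInv.fderiv_fderiv_self`). That
the first one is invertible is not assumed: it comes from the injectivity of `exp_q⁻¹`
(`fderiv_eq_id_of_injOn`), that is, from the uniqueness of geodesics
(`IsGeodesicOn.eq_of_velocity_eq`). Hence normal coordinates exist. In normal coordinates, with
`v` fixed, the second order Taylor polynomial of `exp_z⁻¹ p` in `w - v` has as quadratic part half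
of the connector at `v`. This connector vanishes on the radial direction, which determines its
derivative at the origin in terms of the curvature (`eq_smul_antisymmetrisation`,
`IsLocalExpInv.fderiv_normalConnector`). All remainders vanish for `v = 0`, where `exp_x⁻¹ p = w`
exactly, whence the factor `‖v‖`. Only the points `z` and `p` are put into normal coordinates: the
vector `exp_z⁻¹ p` is measured in the coordinates of the given chart, and the term `L(v)` accounts
for this.

*Points far from `x`.* The expansion holds for `Z` near `x` only. Where `‖η‖ ≥ ε`, both sides of it
are at most a constant times `‖η‖⁴`, by the assumed linear growth of `exp_z⁻¹ Z`; so it holds on all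
of `U` with the additional remainder `‖η‖⁴`
(`IsGeodesicallyConvex.exists_norm_sub_expansion_le`,
`IsGeodesicallyConvex.exists_norm_sub_cubic_le`).

*Moments* (`norm_integral_le_of_expansion`, `norm_integral_le_of_cubic`). In a normed space, the
expectation of the expansion is estimated by integrating the pointwise bounds.
-/

noncomputable section

namespace ExpBary

set_option maxSynthPendingDepth 3

/-! ### Derivatives of compositions, and maps with linear values along curves -/

section Calculus

variable {V E G : Type*} [NormedAddCommGroup V] [NormedSpace ℝ V] [NormedAddCommGroup E]
  [NormedSpace ℝ E] [NormedAddCommGroup G] [NormedSpace ℝ G]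

/-- A `C²` curve which is linear to the right of `0` has at `0` the derivatives of that linear
curve. -/
theorem deriv_deriv_of_eventually_eq_smul {r : ℝ → G} {w : G} (hr : ContDiffAt ℝ 2 r 0)
    (h : ∀ᶠ s in 𝓝[≥] (0 : ℝ), r s = s • w) : deriv r 0 = w ∧ deriv (deriv r) 0 = 0 := by
  have hd : ∀ᶠ s in 𝓝 (0 : ℝ), ContDiffAt ℝ 2 r s := hr.eventually (by simp)
  have h1 : ContDiffAt ℝ 1 (deriv r) 0 := by
    have := (hr.fderiv_right (m := 1) (by norm_num)).clm_apply
      (contDiffAt_const (c := (1 : ℝ)))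
    exact this
  have hpos : ∀ᶠ s in 𝓝[>] (0 : ℝ), deriv r s = w := by
    have h' : ∀ᶠ s in 𝓝[>] (0 : ℝ), r s = s • w :=
      h.filter_mono (nhdsWithin_mono _ Ioi_subset_Ici_self)
    rw [← eventually_eventually_nhdsWithin] at h'
    filter_upwards [h', self_mem_nhdsWithin] with s hs hs0
    rw [IsOpen.nhdsWithin_eq isOpen_Ioi hs0] at hs
    have e : r =ᶠ[𝓝 s] fun s => s • w := hs
    rw [e.deriv_eq]
    simpa using ((hasDerivAt_id s).smul_const w).deriv
  have hlim : deriv r 0 = w := by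
    refine tendsto_nhds_unique (l := 𝓝[>] (0 : ℝ)) (f := deriv r)
      (h1.continuousAt.tendsto.mono_left nhdsWithin_le_nhds) ?_
    exact tendsto_const_nhds.congr' (hpos.mono fun s hs => hs.symm)
  refine ⟨hlim, ?_⟩
  have hder : HasDerivWithinAt (deriv r) (deriv (deriv r) 0) (Ioi 0) 0 :=
    (h1.differentiableAt one_ne_zero).hasDerivAt.hasDerivWithinAt
  have hc : HasDerivWithinAt (deriv r) 0 (Ioi 0) 0 :=
    (hasDerivWithinAt_const (0 : ℝ) (Ioi 0) w).congr_of_eventuallyEq hpos hlim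
  exact (uniqueDiffWithinAt_Ioi (0 : ℝ)).eq_deriv _ hder hc

theorem fderiv_fderiv_comp {g : E → G} {k : V → E} {v : V} (hg : ContDiffAt ℝ 2 g (k v))
    (hk : ContDiffAt ℝ 2 k v) (a b : V) :
    fderiv ℝ (fderiv ℝ (fun w => g (k w))) v a b
      = fderiv ℝ (fderiv ℝ g) (k v) (fderiv ℝ k v a) (fderiv ℝ k v b)
        + fderiv ℝ g (k v) (fderiv ℝ (fderiv ℝ k) v a b) := by
  have e : fderiv ℝ (fun w => g (k w)) =ᶠ[𝓝 v]
      fun w => (fderiv ℝ g (k w)).comp (fderiv ℝ k w) := by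
    filter_upwards [hk.eventually (by simp), hk.continuousAt.eventually (hg.eventually (by simp))]
      with w h1 h2
    exact fderiv_comp w (h2.differentiableAt two_ne_zero) (h1.differentiableAt two_ne_zero)
  rw [e.fderiv_eq]
  have hg' : HasFDerivAt (fderiv ℝ g) (fderiv ℝ (fderiv ℝ g) (k v)) (k v) :=
    ((hg.fderiv_right (m := 1) (by norm_num)).differentiableAt one_ne_zero).hasFDerivAt
  have hk' : HasFDerivAt (fderiv ℝ k) (fderiv ℝ (fderiv ℝ k) v) v :=
    ((hk.fderiv_right (m := 1) (by norm_num)).differentiableAt one_ne_zero).hasFDerivAt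
  have := (hg'.comp v (hk.differentiableAt two_ne_zero).hasFDerivAt).clm_comp hk'
  rw [show (fun w => (fderiv ℝ g (k w)).comp (fderiv ℝ k w)) =
    (fun w => ((fderiv ℝ g ∘ k) w).comp (fderiv ℝ k w)) from rfl, this.fderiv]
  simp [add_comm]

theorem deriv_deriv_eq_fderiv_fderiv {f : ℝ → G} {t : ℝ} (hf : ContDiffAt ℝ 2 f t) :
    deriv (deriv f) t = fderiv ℝ (fderiv ℝ f) t 1 1 := by
  have hf' : HasFDerivAt (fderiv ℝ f) (fderiv ℝ (fderiv ℝ f) t) t :=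
    ((hf.fderiv_right (m := 1) (by norm_num)).differentiableAt one_ne_zero).hasFDerivAt
  have := (hf'.clm_apply (hasFDerivAt_const (1 : ℝ) t)).hasDerivAt
  simpa using this.deriv

theorem deriv_deriv_comp {g : E → G} {u : ℝ → E} {t : ℝ} (hg : ContDiffAt ℝ 2 g (u t))
    (hu : ContDiffAt ℝ 2 u t) :
    deriv (deriv (fun s => g (u s))) t
      = fderiv ℝ (fderiv ℝ g) (u t) (deriv u t) (deriv u t)
        + fderiv ℝ g (u t) (deriv (deriv u) t) := by
  have h2 : ContDiffAt ℝ 2 (fun s => g (u s)) t := hg.comp t hu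
  rw [deriv_deriv_eq_fderiv_fderiv h2, fderiv_fderiv_comp hg hu,
    deriv_deriv_eq_fderiv_fderiv hu]
  simp

/-- If `f` is injective near `q` and its derivative at `q` is a projection onto a subspace which
contains the values of `f`, then that derivative is the identity. A nontrivial kernel would give
a nontrivial curve in a fibre of `f`, by the implicit function theorem. -/
theorem fderiv_eq_id_of_injOn [FiniteDimensional ℝ E] {f : E → E} {q : E} {s : Set E}
    {M : E →L[ℝ] E} (hf : ContDiffAt ℝ 1 f q) (hM : fderiv ℝ f q = M) (hs : s ∈ 𝓝 q)
    (hinj : InjOn f s) (hMf : ∀ p ∈ s, M (f p) = f p) : M = ContinuousLinearMap.id ℝ E := by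
  have : CompleteSpace E := FiniteDimensional.complete ℝ E
  have hstrict : HasStrictFDerivAt f M q := hM ▸ hf.hasStrictFDerivAt one_ne_zero
  -- `M` is a projection: differentiate `M (f p) = f p`
  have hMM : ∀ w, M (M w) = M w := by
    have e : (fun p => M (f p)) =ᶠ[𝓝 q] f := by
      filter_upwards [hs] with p hp using hMf p hp
    have h1 : HasFDerivAt (fun p => M (f p)) (M.comp M) q :=
      M.hasFDerivAt.comp q hstrict.hasFDerivAt
    have h2 := h1.unique (hstrict.hasFDerivAt.congr_of_eventuallyEq e)
    intro w
    exact congrArg (fun L : E →L[ℝ] E => L w) h2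
  let N : E →L[ℝ] (LinearMap.range (M : E →ₗ[ℝ] E)) :=
    M.codRestrict _ (fun w => LinearMap.mem_range_self _ w)
  have hNv : ∀ w, ((N w : LinearMap.range (M : E →ₗ[ℝ] E)) : E) = M w := fun w => rfl
  have hg : HasStrictFDerivAt (fun p => N (f p)) (N.comp M) q :=
    N.hasStrictFDerivAt.comp q hstrict
  have hrange : (N.comp M).range = ⊤ := by
    rw [LinearMap.range_eq_top]
    rintro ⟨y, w, rfl⟩
    exact ⟨w, Subtype.ext (hMM w)⟩
  -- `f` maps a neighbourhood into the range of `M`, and onto that range it is a submersion. As `f`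
  -- is injective, its local fibres are points, so that the kernel of `M` is trivial.
  have hker : ∀ w, M w = 0 → w = 0 := by
    intro w hw
    have hmap := hg.map_implicitFunction_eq hrange
    have hder := hg.to_implicitFunction hrange
    set imp := hg.implicitFunction (fun p => N (f p)) (N.comp M) hrange (N (f q)) with himp
    have h0 : imp 0 = q := by
      exact hg.implicitFunction_apply_image hrange
    have hcont : Tendsto imp (𝓝 0) (𝓝 q) := by
      have := hder.hasFDerivAt.continuousAt.tendsto
      rwa [h0] at this
    have hmap' : ∀ᶠ k in 𝓝 (0 : (N.comp M).ker), N (f (imp k)) = N (f q) := by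
      have hc : Tendsto (fun k : (N.comp M).ker => (N (f q), k)) (𝓝 0) (𝓝 (N (f q), 0)) :=
        (Continuous.prodMk_right _).tendsto _
      exact hc.eventually hmap
    have hconst : imp =ᶠ[𝓝 0] fun _ => q := by
      filter_upwards [hmap', hcont.eventually hs] with k hk hks
      refine hinj hks (mem_of_mem_nhds hs) ?_
      have := congrArg Subtype.val hk
      rw [hNv, hNv, hMf _ hks, hMf _ (mem_of_mem_nhds hs)] at this
      exact this
    have hz : HasFDerivAt imp (0 : (N.comp M).ker →L[ℝ] E) 0 :=
      (hasFDerivAt_const q _).congr_of_eventuallyEq hconst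
    have := hder.hasFDerivAt.unique hz
    have hwk : w ∈ (N.comp M).ker := by
      rw [LinearMap.mem_ker]
      exact Subtype.ext (by change M (M w) = 0; rw [hw, map_zero])
    exact congrArg (fun L : (N.comp M).ker →L[ℝ] E => L ⟨w, hwk⟩) this
  ext w
  have := hker (M w - w) (by rw [map_sub, hMM, sub_self])
  simpa [sub_eq_zero] using this

end Calculus

/-! ### Taylor formulas with a parameter -/

section Taylor

variable {V E G : Type*} [NormedAddCommGroup V] [NormedSpace ℝ V] [NormedAddCommGroup E]
  [NormedSpace ℝ E] [NormedAddCommGroup G] [NormedSpace ℝ G]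

/-- The mean value inequality on a ball, for a derivative which is small to order `k` at the
centre. -/
theorem norm_sub_le_of_norm_fderiv_le_pow {g : E → G} {g' : E → E →L[ℝ] G} {r M : ℝ} {k : ℕ}
    (hM : 0 ≤ M) (hg : ∀ e ∈ Metric.ball (0 : E) r, HasFDerivAt g (g' e) e)
    (hb : ∀ e ∈ Metric.ball (0 : E) r, ‖g' e‖ ≤ M * ‖e‖ ^ k) {e : E}
    (he : e ∈ Metric.ball (0 : E) r) : ‖g e - g 0‖ ≤ M * ‖e‖ ^ (k + 1) := by
  have hsub : Metric.closedBall (0 : E) ‖e‖ ⊆ Metric.ball 0 r := by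
    refine Metric.closedBall_subset_ball ?_
    simpa using he
  have := (convex_closedBall (0 : E) ‖e‖).norm_image_sub_le_of_norm_hasFDerivWithin_le
    (f := g) (f' := g') (C := M * ‖e‖ ^ k) (x := 0) (y := e)
    (fun y hy => (hg y (hsub hy)).hasFDerivWithinAt)
    (fun y hy => (hb y (hsub hy)).trans (by
      have : ‖y‖ ≤ ‖e‖ := by simpa using hy
      gcongr)) (by simp) (by simp)
  calc ‖g e - g 0‖ ≤ M * ‖e‖ ^ k * ‖e - 0‖ := this
    _ = M * ‖e‖ ^ (k + 1) := by rw [sub_zero]; ring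

/-- Second order Taylor formula at the origin, with a bound on the third derivative. -/
theorem norm_sub_taylor_two_le {f : E → G} {r M : ℝ} (hM : 0 ≤ M)
    (hf : ∀ e ∈ Metric.ball (0 : E) r, ContDiffAt ℝ 3 f e)
    (hb : ∀ e ∈ Metric.ball (0 : E) r, ‖fderiv ℝ (fderiv ℝ (fderiv ℝ f)) e‖ ≤ M) {e : E}
    (he : e ∈ Metric.ball (0 : E) r) :
    ‖f e - f 0 - fderiv ℝ f 0 e - (1 / 2 : ℝ) • fderiv ℝ (fderiv ℝ f) 0 e e‖ ≤ M * ‖e‖ ^ 3 := by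
  have hr : 0 < r := by
    have := norm_nonneg e
    have h2 : ‖e‖ < r := by simpa using he
    linarith
  have h1 : ∀ e ∈ Metric.ball (0 : E) r, ContDiffAt ℝ 2 (fderiv ℝ f) e := fun e he =>
    (hf e he).fderiv_right (by norm_num)
  have h2 : ∀ e ∈ Metric.ball (0 : E) r, ContDiffAt ℝ 1 (fderiv ℝ (fderiv ℝ f)) e := fun e he =>
    (h1 e he).fderiv_right (by norm_num)
  have hsymm : ∀ a b, fderiv ℝ (fderiv ℝ f) 0 a b = fderiv ℝ (fderiv ℝ f) 0 b a := by
    intro a b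
    have := (hf 0 (Metric.mem_ball_self hr)).isSymmSndFDerivAt (by simp; norm_num)
    exact this a b
  have s2 : ∀ e ∈ Metric.ball (0 : E) r,
      ‖fderiv ℝ (fderiv ℝ f) e - fderiv ℝ (fderiv ℝ f) 0‖ ≤ M * ‖e‖ ^ 1 := fun e he =>
    norm_sub_le_of_norm_fderiv_le_pow (k := 0) hM
      (fun y hy => ((h2 y hy).differentiableAt one_ne_zero).hasFDerivAt)
      (fun y hy => by simpa using hb y hy) he
  have s1 : ∀ e ∈ Metric.ball (0 : E) r,
      ‖fderiv ℝ f e - fderiv ℝ f 0 - fderiv ℝ (fderiv ℝ f) 0 e‖ ≤ M * ‖e‖ ^ 2 := by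
    intro e he
    have := norm_sub_le_of_norm_fderiv_le_pow (k := 1) hM
      (g := fun y => fderiv ℝ f y - fderiv ℝ (fderiv ℝ f) 0 y)
      (fun y hy => ((h1 y hy).differentiableAt two_ne_zero).hasFDerivAt.sub
        (fderiv ℝ (fderiv ℝ f) 0).hasFDerivAt) s2 he
    rw [show fderiv ℝ f e - fderiv ℝ f 0 - fderiv ℝ (fderiv ℝ f) 0 e
      = fderiv ℝ f e - fderiv ℝ (fderiv ℝ f) 0 e
        - (fderiv ℝ f 0 - fderiv ℝ (fderiv ℝ f) 0 0) by rw [map_zero]; abel]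
    exact this
  have := norm_sub_le_of_norm_fderiv_le_pow (k := 2) hM
      (g := fun y => f y - fderiv ℝ f 0 y - (1 / 2 : ℝ) • fderiv ℝ (fderiv ℝ f) 0 y y)
      (g' := fun y => fderiv ℝ f y - fderiv ℝ f 0 - fderiv ℝ (fderiv ℝ f) 0 y)
      (fun y hy => ?_) s1 he
  · rw [show f e - f 0 - fderiv ℝ f 0 e - (1 / 2 : ℝ) • fderiv ℝ (fderiv ℝ f) 0 e e
      = f e - fderiv ℝ f 0 e - (1 / 2 : ℝ) • fderiv ℝ (fderiv ℝ f) 0 e e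
        - (f 0 - fderiv ℝ f 0 0 - (1 / 2 : ℝ) • fderiv ℝ (fderiv ℝ f) 0 0 0) by
      simp only [map_zero, sub_zero, smul_zero]; abel]
    exact this
  · have q : HasFDerivAt (fun y => (1 / 2 : ℝ) • fderiv ℝ (fderiv ℝ f) 0 y y)
        (fderiv ℝ (fderiv ℝ f) 0 y) y := by
      have := ((fderiv ℝ (fderiv ℝ f) 0).hasFDerivAt.clm_apply (hasFDerivAt_id y)).const_smul
        (1 / 2 : ℝ)
      refine this.congr_fderiv ?_
      ext a
      change (1 / 2 : ℝ) • (fderiv ℝ (fderiv ℝ f) 0 y a + fderiv ℝ (fderiv ℝ f) 0 a y) = _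
      rw [hsymm a y, ← two_smul ℝ, smul_smul]
      norm_num
    exact (((hf y hy).differentiableAt (by norm_num)).hasFDerivAt.sub
      (fderiv ℝ f 0).hasFDerivAt).sub q

/-- First order Taylor formula at the origin, with a quadratic remainder. -/
theorem exists_norm_sub_fderiv_le {f : E → G} (hf : ContDiffAt ℝ 2 f 0) :
    ∃ C, 0 ≤ C ∧ ∀ᶠ v in 𝓝 (0 : E), ‖f v - f 0 - fderiv ℝ f 0 v‖ ≤ C * ‖v‖ ^ 2 := by
  have h1 : ContDiffAt ℝ 1 (fderiv ℝ f) 0 := hf.fderiv_right (by norm_num)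
  obtain ⟨K, t, ht, hK⟩ := h1.exists_lipschitzOnWith
  have hd : ∀ᶠ e in 𝓝 (0 : E), ContDiffAt ℝ 2 f e := hf.eventually (by simp)
  obtain ⟨r, hr, hball⟩ := Metric.eventually_nhds_iff_ball.1 (hd.and ht)
  refine ⟨K, K.2, ?_⟩
  filter_upwards [Metric.ball_mem_nhds (0 : E) hr] with e he
  have := norm_sub_le_of_norm_fderiv_le_pow (k := 1) K.2
    (g := fun y => f y - fderiv ℝ f 0 y) (g' := fun y => fderiv ℝ f y - fderiv ℝ f 0)
    (fun y hy => ((hball y hy).1.differentiableAt two_ne_zero).hasFDerivAt.sub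
      (fderiv ℝ f 0).hasFDerivAt)
    (fun y hy => by
      simpa using hK.norm_sub_le (hball y hy).2 (hball 0 (Metric.mem_ball_self hr)).2) he
  rw [show f e - f 0 - fderiv ℝ f 0 e = f e - fderiv ℝ f 0 e - (f 0 - fderiv ℝ f 0 0) by
    rw [map_zero]; abel]
  exact this

theorem exists_norm_sub_le {f : E → G} (hf : ContDiffAt ℝ 1 f 0) :
    ∃ C, 0 ≤ C ∧ ∀ᶠ v in 𝓝 (0 : E), ‖f v - f 0‖ ≤ C * ‖v‖ := by
  obtain ⟨K, t, ht, hK⟩ := hf.exists_lipschitzOnWith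
  refine ⟨K, K.2, ?_⟩
  filter_upwards [ht] with v hv
  simpa using hK.norm_sub_le hv (mem_of_mem_nhds ht)

theorem contDiffAt_partial_fderiv {K : V → E → G} {p : V × E}
    (hK : ContDiffAt ℝ ∞ (fun q : V × E => K q.1 q.2) p) :
    ContDiffAt ℝ ∞ (fun q : V × E => fderiv ℝ (K q.1) q.2) p := by
  refine ContDiffAt.fderiv (n := ∞) (f := fun q : V × E => K q.1) (g := fun q : V × E => q.2) ?_
    contDiffAt_snd (by simp)
  exact hK.comp (p, p.2) ((contDiffAt_fst.fst).prodMk contDiffAt_snd)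

theorem eventuallyEq_zero_fderiv {f : E → G} (h : f =ᶠ[𝓝 0] fun _ => (0 : G)) :
    fderiv ℝ f =ᶠ[𝓝 0] fun _ => (0 : E →L[ℝ] G) := by
  filter_upwards [eventually_eventually_nhds.2 h] with e he
  rw [Filter.EventuallyEq.fderiv_eq he]
  simp

/-- If `K` vanishes for the value `0` of the parameter, then the remainder of the second order
Taylor formula in the second variable is small with the parameter. -/
theorem exists_norm_sub_taylor_two_param_le {K : V → E → G}
    (hK : ContDiffAt ℝ ∞ (fun q : V × E => K q.1 q.2) (0, 0))
    (h0 : ∀ᶠ e in 𝓝 (0 : E), K 0 e = 0) :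
    ∃ C, 0 ≤ C ∧ ∀ᶠ q in 𝓝 ((0, 0) : V × E),
      ‖K q.1 q.2 - K q.1 0 - fderiv ℝ (K q.1) 0 q.2
        - (1 / 2 : ℝ) • fderiv ℝ (fderiv ℝ (K q.1)) 0 q.2 q.2‖ ≤ C * ‖q.1‖ * ‖q.2‖ ^ 3 := by
  have hK1 := contDiffAt_partial_fderiv hK
  have hK2 := contDiffAt_partial_fderiv (K := fun v e => fderiv ℝ (K v) e) hK1
  have hK3 := contDiffAt_partial_fderiv (K := fun v e => fderiv ℝ (fderiv ℝ (K v)) e) hK2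
  obtain ⟨C, t, ht, hC⟩ := (hK3.of_le (show (1 : ℕ∞ω) ≤ ∞ by simp)).exists_lipschitzOnWith
  -- the third derivative in `e` is Lipschitz and vanishes for the parameter `0`
  have z3 : ∀ᶠ e in 𝓝 (0 : E), fderiv ℝ (fderiv ℝ (fderiv ℝ (K 0))) e = 0 :=
    eventuallyEq_zero_fderiv (eventuallyEq_zero_fderiv (eventuallyEq_zero_fderiv h0))
  have hd : ∀ᶠ q in 𝓝 ((0, 0) : V × E), ContDiffAt ℝ 3 (fun q : V × E => K q.1 q.2) q :=
    (hK.of_le (show (3 : ℕ∞ω) ≤ ∞ from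
      WithTop.coe_le_coe.2 (le_top : (3 : ℕ∞) ≤ ⊤))).eventually (by simp)
  have hall := (hd.and ht).and (z3.prod_inr_nhds (0 : V))
  obtain ⟨r, hr, hball⟩ := Metric.eventually_nhds_iff_ball.1 hall
  refine ⟨C, C.2, ?_⟩
  filter_upwards [Metric.ball_mem_nhds ((0, 0) : V × E) hr] with q hq
  rw [← ball_prod_same] at hq hball
  have hq1 : q.1 ∈ Metric.ball (0 : V) r := hq.1
  refine norm_sub_taylor_two_le (f := K q.1) (r := r) (by positivity) (fun e he => ?_)
    (fun e he => ?_) hq.2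
  · have := (hball (q.1, e) ⟨hq1, he⟩).1.1
    exact this.comp e (contDiffAt_const.prodMk contDiffAt_id)
  · have h1 := (hball (q.1, e) ⟨hq1, he⟩).1.2
    have h2 := (hball (0, e) ⟨Metric.mem_ball_self hr, he⟩).1.2
    have h3 := (hball (0, e) ⟨Metric.mem_ball_self hr, he⟩).2
    have := hC.norm_sub_le h1 h2
    rw [h3, sub_zero, Prod.mk_sub_mk, sub_zero, sub_self, Prod.norm_mk, norm_zero,
      max_eq_left (norm_nonneg _)] at this
    exact this

end Taylor

/-! ### The inverse exponential map in a chart: first and second derivatives -/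

section LocalExp

variable {E : Type*} [NormedAddCommGroup E] [NormedSpace ℝ E]

/-- The curvature `R(u, a)b` at `q`, in do Carmo's sign convention, of the connection with local
connector `Γ`. -/
def localCurvature (Γ : E → E →L[ℝ] E →L[ℝ] E) (q u a b : E) : E :=
  fderiv ℝ Γ q a u b + Γ q a (Γ q u b) - fderiv ℝ Γ q u a b - Γ q u (Γ q a b)

/-- The properties of the coordinate expression `F q p` of the inverse exponential map
`exp_q⁻¹ p` of a geodesically convex set, in a chart with image `Ω`, for a torsion-free connection
with local connector `Γ`. -/
structure IsLocalExpInv (Ω : Set E) (x₀ : E) (F : E → E → E) (Γ : E → E →L[ℝ] E →L[ℝ] E) :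
    Prop where
  isOpen : IsOpen Ω
  mem : x₀ ∈ Ω
  smooth : ContDiffOn ℝ ∞ (fun q : E × E => F q.1 q.2) (Ω ×ˢ Ω)
  differentiableAt : DifferentiableAt ℝ Γ x₀
  symm : ∀ q ∈ Ω, ∀ a b, Γ q a b = Γ q b a
  /-- The geodesic from `q` to `p`, near its starting point. -/
  geodesic : ∀ q ∈ Ω, ∀ p ∈ Ω, ∃ u : ℝ → E, ContDiffAt ℝ 2 u 0 ∧ u 0 = q ∧ deriv u 0 = F q p ∧
    deriv (deriv u) 0 = -Γ q (F q p) (F q p) ∧ ∀ᶠ s in 𝓝[≥] (0 : ℝ), F q (u s) = s • F q p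
  injOn : ∀ q ∈ Ω, InjOn (F q) Ω
  /-- The final part of a geodesic which starts at `x₀` is a geodesic. -/
  radial : ∀ p₁ ∈ Ω, ∀ p₀ ∈ Ω, ∀ s₀ ∈ Icc (0 : ℝ) 1, F x₀ p₀ = s₀ • F x₀ p₁ →
    ∃ w, ∀ s ∈ Icc s₀ 1, ∀ q ∈ Ω, F x₀ q = s • F x₀ p₁ → F p₀ q = (s - s₀) • w

theorem two_le_infty : (2 : ℕ∞ω) ≤ ∞ := WithTop.coe_le_coe.2 (le_top : (2 : ℕ∞) ≤ ⊤)

/-- Polarisation: symmetric bilinear maps with the same quadratic form are equal. -/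
theorem eq_of_diag_eq {A B : E →L[ℝ] E →L[ℝ] E} (hA : ∀ a b, A a b = A b a)
    (hB : ∀ a b, B a b = B b a) (h : ∀ a, A a a = B a a) (a b : E) : A a b = B a b := by
  have h1 := h (a + b)
  simp only [map_add, add_apply, h a, h b, hA b a, hB b a] at h1
  have h2 : (2 : ℝ) • A a b = (2 : ℝ) • B a b := by
    rw [two_smul, two_smul]
    have := congrArg (fun z => z - B a a - B b b) h1
    convert this using 1 <;> abel
  exact smul_right_injective E two_ne_zero h2

namespace IsLocalExpInv

variable {Ω : Set E} {x₀ : E} {F : E → E → E} {Γ : E → E →L[ℝ] E →L[ℝ] E}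

theorem contDiffAt_uncurry (h : IsLocalExpInv Ω x₀ F Γ) {q p : E} (hq : q ∈ Ω) (hp : p ∈ Ω) :
    ContDiffAt ℝ ∞ (fun q : E × E => F q.1 q.2) (q, p) :=
  h.smooth.contDiffAt ((h.isOpen.prod h.isOpen).mem_nhds ⟨hq, hp⟩)

theorem contDiffAt (h : IsLocalExpInv Ω x₀ F Γ) {q p : E} (hq : q ∈ Ω) (hp : p ∈ Ω) :
    ContDiffAt ℝ ∞ (F q) p :=
  (h.contDiffAt_uncurry hq hp).comp p (contDiffAt_const.prodMk contDiffAt_id)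

theorem apply_self (h : IsLocalExpInv Ω x₀ F Γ) {q : E} (hq : q ∈ Ω) : F q q = 0 := by
  obtain ⟨u, -, hu0, -, -, hs⟩ := h.geodesic q hq q hq
  have := hs.self_of_nhdsWithin (by simp)
  simpa [hu0] using this

/-- The derivative of `exp_q⁻¹` at `q` is the identity. Along geodesics from `q`, `exp_q⁻¹` is
linear, so that the derivative fixes all values of `exp_q⁻¹`. -/
theorem fderiv_self [FiniteDimensional ℝ E] (h : IsLocalExpInv Ω x₀ F Γ) {q : E} (hq : q ∈ Ω) :
    fderiv ℝ (F q) q = ContinuousLinearMap.id ℝ E := by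
  refine fderiv_eq_id_of_injOn ((h.contDiffAt hq hq).of_le (by simp)) rfl (h.isOpen.mem_nhds hq)
    (h.injOn q hq) fun p hp => ?_
  obtain ⟨u, hu, hu0, hu1, -, hs⟩ := h.geodesic q hq p hp
  have hF : ContDiffAt ℝ 2 (F q) (u 0) := by
    rw [hu0]; exact (h.contDiffAt hq hq).of_le two_le_infty
  have hc : ContDiffAt ℝ 2 (fun s => F q (u s)) 0 := hF.comp 0 hu
  have h1 := (deriv_deriv_of_eventually_eq_smul hc hs).1
  have h2 : HasDerivAt (fun s => F q (u s)) (fderiv ℝ (F q) (u 0) (deriv u 0)) 0 :=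
    (hF.differentiableAt two_ne_zero).hasFDerivAt.comp_hasDerivAt 0
      (hu.differentiableAt two_ne_zero).hasDerivAt
  rw [h2.deriv, hu0, hu1] at h1
  exact h1

/-- The second derivative of `exp_q⁻¹` at `q` is the connector: this is the geodesic equation. -/
theorem fderiv_fderiv_self [FiniteDimensional ℝ E] (h : IsLocalExpInv Ω x₀ F Γ) {q : E}
    (hq : q ∈ Ω) (a b : E) : fderiv ℝ (fderiv ℝ (F q)) q a b = Γ q a b := by
  have : CompleteSpace E := FiniteDimensional.complete ℝ E
  have hsymm : ∀ a b, fderiv ℝ (fderiv ℝ (F q)) q a b = fderiv ℝ (fderiv ℝ (F q)) q b a := by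
    intro a b
    exact ((h.contDiffAt hq hq).isSymmSndFDerivAt (by simpa using two_le_infty)) a b
  refine eq_of_diag_eq hsymm (h.symm q hq) (fun a => ?_) a b
  have himage : ∀ p ∈ Ω, fderiv ℝ (fderiv ℝ (F q)) q (F q p) (F q p) = Γ q (F q p) (F q p) := by
    intro p hp
    obtain ⟨u, hu, hu0, hu1, hu2, hs⟩ := h.geodesic q hq p hp
    have hF : ContDiffAt ℝ 2 (F q) (u 0) := by
      rw [hu0]; exact (h.contDiffAt hq hq).of_le two_le_infty
    have hc : ContDiffAt ℝ 2 (fun s => F q (u s)) 0 := hF.comp 0 hu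
    have h1 := (deriv_deriv_of_eventually_eq_smul hc hs).2
    rw [deriv_deriv_comp hF hu, hu0, hu1, hu2, h.fderiv_self hq] at h1
    simpa [add_neg_eq_zero] using h1
  have hmap : map (F q) (𝓝 q) = 𝓝 0 := by
    have hst := (h.contDiffAt hq hq).hasStrictFDerivAt (by simp)
    have := hst.map_nhds_eq_of_surj (by
      rw [h.fderiv_self hq]
      exact LinearMap.range_eq_top.2 fun w => ⟨w, rfl⟩)
    rwa [h.apply_self hq] at this
  -- the velocities `F q p` fill a neighbourhood of the origin, so that every vector is a multiple
  -- of one of them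
  have hmem : F q '' Ω ∈ 𝓝 (0 : E) := by
    rw [← hmap]
    exact image_mem_map (h.isOpen.mem_nhds hq)
  have htend : Tendsto (fun t : ℝ => t • a) (𝓝[≠] 0) (𝓝 0) := by
    have : Tendsto (fun t : ℝ => t • a) (𝓝 0) (𝓝 ((0 : ℝ) • a)) :=
      (continuous_id.smul continuous_const).tendsto 0
    rw [zero_smul] at this
    exact this.mono_left nhdsWithin_le_nhds
  obtain ⟨t, ⟨p, hp, hpt⟩, ht⟩ :=
    ((htend.eventually hmem).and (self_mem_nhdsWithin (s := {(0 : ℝ)}ᶜ))).exists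
  have := himage p hp
  rw [hpt] at this
  simp only [map_smul, smul_apply, smul_smul] at this
  have ht' : t * t ≠ 0 := mul_ne_zero ht ht
  exact smul_right_injective E ht' this

/-- Normal coordinates at the base point: the exponential map, as a local inverse of `exp⁻¹`. -/
theorem exists_localInverse [FiniteDimensional ℝ E] (h : IsLocalExpInv Ω x₀ F Γ) :
    ∃ k : E → E, ContDiffAt ℝ ∞ k 0 ∧ k 0 = x₀ ∧ fderiv ℝ k 0 = ContinuousLinearMap.id ℝ E ∧
      ∀ᶠ v in 𝓝 (0 : E), k v ∈ Ω ∧ F x₀ (k v) = v := by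
  have : CompleteSpace E := FiniteDimensional.complete ℝ E
  have hF := h.contDiffAt h.mem h.mem
  have hd : HasFDerivAt (F x₀) ((ContinuousLinearEquiv.refl ℝ E : E ≃L[ℝ] E) : E →L[ℝ] E) x₀ := by
    have := (hF.differentiableAt (by simp)).hasFDerivAt
    rwa [h.fderiv_self h.mem] at this
  have hn : (∞ : ℕ∞ω) ≠ 0 := by simp
  have hst := hF.hasStrictFDerivAt' hd hn
  have h0 : F x₀ x₀ = 0 := h.apply_self h.mem
  have hk : ContDiffAt ℝ ∞ (hF.localInverse hd hn) (F x₀ x₀) := hF.to_localInverse hd hn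
  have hk0 : hF.localInverse hd hn (F x₀ x₀) = x₀ := hF.localInverse_apply_image hd hn
  have hr : ∀ᶠ y in 𝓝 (F x₀ x₀), F x₀ (hF.localInverse hd hn y) = y :=
    hst.eventually_right_inverse
  rw [h0] at hk hk0 hr
  refine ⟨hF.localInverse hd hn, hk, hk0, ?_, ?_⟩
  · have h1 := hst.to_localInverse.hasFDerivAt
    rw [h0] at h1
    have := h1.fderiv
    exact this
  · have hc : ∀ᶠ v in 𝓝 (0 : E), hF.localInverse hd hn v ∈ Ω :=
      hk.continuousAt.eventually (by rw [hk0]; exact h.isOpen.mem_nhds h.mem)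
    exact hc.and hr

end IsLocalExpInv

end LocalExp

/-! ### The inverse exponential map in a chart: expansion in normal coordinates -/

section Expansion

variable {E : Type*} [NormedAddCommGroup E] [NormedSpace ℝ E]

/-- A trilinear map which is symmetric in its last two variables and vanishes on the diagonal is
determined by its antisymmetrisation in the first two variables. -/
theorem eq_smul_antisymmetrisation {T : E →L[ℝ] E →L[ℝ] E →L[ℝ] E}
    (hT : ∀ u a b, T u a b = T u b a) (h0 : ∀ v, T v v v = 0) (u a : E) :
    T u a a = (2 / 3 : ℝ) • (T u a a - T a u a) := by
  have h1 := h0 (a + u)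
  have h2 := h0 (a - u)
  simp only [map_add, map_sub, add_apply, sub_apply, h0, hT _ a u] at h1 h2
  have h3 : T u a a + (2 : ℝ) • T a u a = 0 := by
    have h5 : (2 : ℝ) • (T u a a + (2 : ℝ) • T a u a) = 0 := by
      linear_combination (norm := module) h1 - h2
    exact (smul_eq_zero.1 h5).resolve_left two_ne_zero
  have h4 : T a u a = -(1 / 2 : ℝ) • T u a a := by
    have := eq_neg_of_add_eq_zero_left h3
    rw [this]; module
  rw [h4]; module

namespace IsLocalExpInv

variable {Ω : Set E} {x₀ : E} {F : E → E → E} {Γ : E → E →L[ℝ] E →L[ℝ] E}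

/-- In normal coordinates the lines through the origin are geodesics, so that the connector
vanishes on their velocities. -/
theorem normalConnector_radial (h : IsLocalExpInv Ω x₀ F Γ) {k : E → E}
    (hk : ContDiffAt ℝ ∞ k 0) (hinv : ∀ᶠ v in 𝓝 (0 : E), k v ∈ Ω ∧ F x₀ (k v) = v) :
    ∀ᶠ v in 𝓝 (0 : E), fderiv ℝ (fderiv ℝ (fun e => F (k v) (k (v + e)) - (v + e))) 0 v v = 0 := by
  have hkd : ∀ᶠ v in 𝓝 (0 : E), ContDiffAt ℝ 2 k v :=
    (hk.of_le two_le_infty).eventually (by simp)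
  obtain ⟨r, hr, hball⟩ := Metric.eventually_nhds_iff_ball.1 (hkd.and hinv)
  filter_upwards [Metric.ball_mem_nhds (0 : E) (half_pos hr)] with v hv
  rw [mem_ball_zero_iff] at hv
  have hmem : ∀ t ∈ Icc (0 : ℝ) 2, t • v ∈ Metric.ball (0 : E) r := by
    intro t ht
    rw [mem_ball_zero_iff, norm_smul, Real.norm_of_nonneg ht.1]
    nlinarith [norm_nonneg v, ht.2]
  have hv1 : v ∈ Metric.ball (0 : E) r := by simpa using hmem 1 (by norm_num)
  obtain ⟨hkv, hkΩ, hFv⟩ := hball v hv1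
  -- the geodesic from `x₀` to `k (2 v)` passes through `k v` at half time
  obtain ⟨-, hk2Ω, hF2v⟩ := hball ((2 : ℝ) • v) (hmem 2 (by norm_num))
  obtain ⟨w, hw⟩ := h.radial _ hk2Ω _ hkΩ (1 / 2) (by norm_num) (by
    rw [hFv, hF2v, smul_smul]; norm_num)
  -- the constant `v` makes `f` vanish at the origin, so that it is linear on the ray through `v`
  set f : E → E := fun e => F (k v) (k (v + e)) - (v + e) + v with hf
  have hfc : ContDiffAt ℝ 2 f ((0 : ℝ) • v) := by
    rw [zero_smul]
    have h1 : ContDiffAt ℝ 2 (fun e => k (v + e)) 0 := by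
      refine ContDiffAt.comp (0 : E) (g := k) (f := fun e => v + e) (by rwa [add_zero]) ?_
      exact contDiffAt_const.add contDiffAt_id
    have h2 : ContDiffAt ℝ 2 (F (k v)) (k (v + 0)) := by
      rw [add_zero]; exact (h.contDiffAt hkΩ hkΩ).of_le two_le_infty
    exact (((ContDiffAt.comp (0 : E) (g := F (k v)) (f := fun e => k (v + e)) h2 h1).sub
      (contDiffAt_const.add contDiffAt_id)).add contDiffAt_const)
  have hu : ContDiffAt ℝ 2 (fun t : ℝ => t • v) 0 := contDiffAt_id.smul contDiffAt_const
  have hlin : ∀ᶠ t in 𝓝[≥] (0 : ℝ), f (t • v) = t • ((1 / 2 : ℝ) • w - v) := by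
    have : Icc (0 : ℝ) 1 ∈ 𝓝[≥] (0 : ℝ) := Icc_mem_nhdsGE one_pos
    filter_upwards [this] with t ht
    have e1 : v + t • v = (1 + t) • v := by module
    obtain ⟨-, hqΩ, hFq⟩ := hball ((1 + t) • v) (hmem (1 + t) ⟨by linarith [ht.1], by
      linarith [ht.2]⟩)
    have := hw ((1 + t) / 2) ⟨by linarith [ht.1], by linarith [ht.2]⟩ _ hqΩ (by
      rw [hFq, hF2v, smul_smul]; congr 1; ring)
    simp only [hf, e1, this]
    module
  have h1 := (deriv_deriv_of_eventually_eq_smul (r := fun t : ℝ => f (t • v))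
    (ContDiffAt.comp (0 : ℝ) (g := f) (f := fun t : ℝ => t • v) hfc hu) hlin).2
  have hd : deriv (fun t : ℝ => t • v) = fun _ => v := by
    ext1 t
    simpa using ((hasDerivAt_id t).smul_const v).deriv
  have h2 := deriv_deriv_comp (g := f) (u := fun t : ℝ => t • v) hfc hu
  rw [hd] at h2
  simp only [zero_smul, deriv_const, map_zero, add_zero] at h2
  have h3 : fderiv ℝ f = fderiv ℝ (fun e => F (k v) (k (v + e)) - (v + e)) := by
    ext1 e
    exact fderiv_add_const v
  rw [← h3, ← h2]
  exact h1

variable [FiniteDimensional ℝ E]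

/-- The second derivative, at `p = z`, of `exp_z⁻¹ p` as a function of the normal coordinates of
`p`, for the point `z` with normal coordinates `v`. It is the connector in normal coordinates, with
its values expressed in the coordinates of the chart; the term `-(v + e)` does not contribute. -/
theorem fderiv_fderiv_normal (h : IsLocalExpInv Ω x₀ F Γ) {k : E → E} {v : E}
    (hk : ContDiffAt ℝ 2 k v) (hkv : k v ∈ Ω) (a b : E) :
    fderiv ℝ (fderiv ℝ (fun e => F (k v) (k (v + e)) - (v + e))) 0 a b
      = Γ (k v) (fderiv ℝ k v a) (fderiv ℝ k v b) + fderiv ℝ (fderiv ℝ k) v a b := by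
  have hF : ContDiffAt ℝ ∞ (F (k v)) (k v) := h.contDiffAt hkv hkv
  have hg : ContDiffAt ℝ 2 (fun w => F (k v) (k w)) v := (hF.of_le two_le_infty).comp v hk
  have e1 : fderiv ℝ (fun e => F (k v) (k (v + e)) - (v + e))
      = fun e => fderiv ℝ (fun w => F (k v) (k w) - w) (v + e) := by
    ext1 e
    exact fderiv_comp_add_left (f := fun w => F (k v) (k w) - w) v
  rw [e1, fderiv_comp_add_left (f := fderiv ℝ (fun w => F (k v) (k w) - w)) v, add_zero]
  have e2 : fderiv ℝ (fun w => F (k v) (k w) - w) =ᶠ[𝓝 v]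
      fun w => fderiv ℝ (fun w => F (k v) (k w)) w - ContinuousLinearMap.id ℝ E := by
    filter_upwards [hg.eventually (by simp)] with w hw
    rw [fderiv_fun_sub (hw.differentiableAt two_ne_zero) differentiableAt_fun_id, fderiv_fun_id]
  rw [e2.fderiv_eq, fderiv_sub_const, fderiv_fderiv_comp (hF.of_le two_le_infty)
    hk, h.fderiv_fderiv_self hkv, h.fderiv_self hkv]
  rfl

/-- The derivative at the base point of the connector in normal coordinates. -/
theorem fderiv_normalConnector (h : IsLocalExpInv Ω x₀ F Γ) {k : E → E}
    (hk : ContDiffAt ℝ ∞ k 0) (hk0 : k 0 = x₀)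
    (hk1 : fderiv ℝ k 0 = ContinuousLinearMap.id ℝ E)
    (hinv : ∀ᶠ v in 𝓝 (0 : E), k v ∈ Ω ∧ F x₀ (k v) = v) {B : E → E →L[ℝ] E →L[ℝ] E}
    (hB : DifferentiableAt ℝ B 0) (hB0 : B 0 = 0)
    (hBdef : ∀ v, B v = fderiv ℝ (fderiv ℝ (fun e => F (k v) (k (v + e)) - (v + e))) 0)
    (u a : E) :
    fderiv ℝ B 0 u a a = -(2 / 3 : ℝ) • localCurvature Γ x₀ u a a := by
  have hkd : ∀ᶠ v in 𝓝 (0 : E), ContDiffAt ℝ 3 k v :=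
    (hk.of_le (WithTop.coe_le_coe.2 (le_top : (3 : ℕ∞) ≤ ⊤))).eventually (by simp)
  have hform : ∀ᶠ v in 𝓝 (0 : E), ∀ a b,
      B v a b = Γ (k v) (fderiv ℝ k v a) (fderiv ℝ k v b) + fderiv ℝ (fderiv ℝ k) v a b := by
    filter_upwards [hkd, hinv] with v h1 h2 a b
    rw [hBdef, h.fderiv_fderiv_normal (h1.of_le (by norm_num)) h2.1]
  have hrad : ∀ᶠ v in 𝓝 (0 : E), B v v v = 0 := by
    filter_upwards [h.normalConnector_radial hk hinv] with v hv
    rw [hBdef, hv]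
  have hBd : HasFDerivAt B (fderiv ℝ B 0) 0 := hB.hasFDerivAt
  have happ : ∀ a b, HasFDerivAt (fun v => B v a b) (((fderiv ℝ B 0).flip a).flip b) 0 := by
    intro a b
    have := (hBd.clm_apply (hasFDerivAt_const a 0)).clm_apply (hasFDerivAt_const b 0)
    refine this.congr_fderiv ?_
    ext u
    simp
  -- `B (s v)(v, v) = 0` for small `s`, by homogeneity from `B (s v)(s v, s v) = 0`
  have hdiag : ∀ v, fderiv ℝ B 0 v v v = 0 := by
    intro v
    have hl : HasDerivAt (fun s : ℝ => s • v) v 0 := by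
      simpa using (hasDerivAt_id (0 : ℝ)).smul_const v
    have h1 : HasDerivAt (fun s : ℝ => B (s • v) v v) (fderiv ℝ B 0 v v v) 0 := by
      have h2 : HasFDerivAt (fun v' => B v' v v) (((fderiv ℝ B 0).flip v).flip v)
        ((fun s : ℝ => s • v) 0) := by simpa using happ v v
      exact h2.comp_hasDerivAt (0 : ℝ) hl
    have ht : Tendsto (fun s : ℝ => s • v) (𝓝 0) (𝓝 0) := by
      have := hl.continuousAt.tendsto
      simpa using this
    have h3 : (fun s : ℝ => B (s • v) v v) =ᶠ[𝓝 0] fun _ => 0 := by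
      filter_upwards [ht.eventually hrad] with s hs
      by_cases hs0 : s = 0
      · simp [hs0, hB0]
      · simp only [map_smul, smul_apply, smul_smul] at hs
        exact (smul_eq_zero.1 hs).resolve_left (mul_ne_zero hs0 hs0)
    exact h1.unique ((hasDerivAt_const (0 : ℝ) (0 : E)).congr_of_eventuallyEq h3)
  have hk2 : HasFDerivAt (fderiv ℝ k) (fderiv ℝ (fderiv ℝ k) 0) 0 :=
    ((hkd.self_of_nhds.fderiv_right (m := 2) (by norm_num)).differentiableAt
      two_ne_zero).hasFDerivAt
  have hk3 : HasFDerivAt (fderiv ℝ (fderiv ℝ k)) (fderiv ℝ (fderiv ℝ (fderiv ℝ k)) 0) 0 :=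
    (((hkd.self_of_nhds.fderiv_right (m := 2) (by norm_num)).fderiv_right (m := 1)
      (by norm_num)).differentiableAt one_ne_zero).hasFDerivAt
  have hk2Γ : ∀ a b, fderiv ℝ (fderiv ℝ k) 0 a b = -Γ x₀ a b := by
    intro a b
    have := hform.self_of_nhds a b
    rw [hB0, hk0, hk1] at this
    exact eq_neg_of_add_eq_zero_right this.symm
  -- differentiate `hform`; the third derivative of `k` is symmetric and drops out of the
  -- antisymmetrisation, which leaves the curvature
  have hT : ∀ u a b, fderiv ℝ B 0 u a b = fderiv ℝ Γ x₀ u a b - Γ x₀ (Γ x₀ u a) b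
      - Γ x₀ a (Γ x₀ u b) + fderiv ℝ (fderiv ℝ (fderiv ℝ k)) 0 u a b := by
    intro u a b
    have hΓ : HasFDerivAt (fun v => Γ (k v)) ((fderiv ℝ Γ x₀).comp (fderiv ℝ k 0)) 0 := by
      have := h.differentiableAt.hasFDerivAt
      rw [← hk0] at this ⊢
      exact this.comp (0 : E) ((hk.differentiableAt (by simp)).hasFDerivAt)
    have h1 := ((hΓ.clm_apply (hk2.clm_apply (hasFDerivAt_const a 0))).clm_apply
      (hk2.clm_apply (hasFDerivAt_const b 0))).add
      ((hk3.clm_apply (hasFDerivAt_const a 0)).clm_apply (hasFDerivAt_const b 0))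
    have h2 := h1.unique ((happ a b).congr_of_eventuallyEq
      (hform.mono fun v hv => by simpa using (hv a b).symm))
    have h3 := congrArg (fun L : E →L[ℝ] E => L u) h2
    simp [hk0, hk1, hk2Γ] at h3
    rw [← h3]
    abel
  have hk3symm : ∀ u a b, fderiv ℝ (fderiv ℝ (fderiv ℝ k)) 0 u a b
      = fderiv ℝ (fderiv ℝ (fderiv ℝ k)) 0 a u b := by
    intro u a b
    have := (hkd.self_of_nhds.fderiv_right (m := 2) (by norm_num)).isSymmSndFDerivAt
      (by simp) u a
    exact congrArg (fun L : E →L[ℝ] E => L b) this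
  have hk2symm : ∀ᶠ v in 𝓝 (0 : E), ∀ a b, fderiv ℝ (fderiv ℝ k) v a b
      = fderiv ℝ (fderiv ℝ k) v b a := by
    filter_upwards [hkd] with v hv a b
    exact hv.isSymmSndFDerivAt (by simp; norm_num) a b
  have hTsymm : ∀ u a b, fderiv ℝ B 0 u a b = fderiv ℝ B 0 u b a := by
    intro u a b
    have h2 := (happ a b).unique ((happ b a).congr_of_eventuallyEq (by
      filter_upwards [hform, hk2symm, hinv] with v h1 h2 h3
      rw [h1, h1, h2 a b, h.symm _ h3.1]))
    exact congrArg (fun L : E →L[ℝ] E => L u) h2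
  rw [eq_smul_antisymmetrisation hTsymm hdiag u a, hT, hT, hk3symm a u, neg_smul, ← smul_neg]
  congr 1
  rw [localCurvature, h.symm _ h.mem a u, h.symm _ h.mem (Γ x₀ u a) a]
  abel

/-- The Taylor expansion of the inverse exponential map in normal coordinates `k` at `x₀`. -/
theorem exists_expansion (h : IsLocalExpInv Ω x₀ F Γ) :
    ∃ k : E → E, ContDiffAt ℝ ∞ k 0 ∧ k 0 = x₀ ∧ (∀ᶠ v in 𝓝 (0 : E), k v ∈ Ω ∧ F x₀ (k v) = v) ∧
    ∃ (L : E → E →L[ℝ] E) (C : ℝ), 0 ≤ C ∧ (∀ᶠ v in 𝓝 (0 : E), ‖L v‖ ≤ C * ‖v‖) ∧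
    ∀ᶠ q in 𝓝 ((0, 0) : E × E),
      ‖F (k q.1) (k q.2) - (q.2 - q.1) - L q.1 (q.2 - q.1)
        + (1 / 3 : ℝ) • localCurvature Γ x₀ q.1 (q.2 - q.1) (q.2 - q.1)‖
      ≤ C * (‖q.1‖ * ‖q.2 - q.1‖ ^ 3 + ‖q.1‖ ^ 2 * ‖q.2 - q.1‖ ^ 2) := by
  obtain ⟨k, hk, hk0, hk1, hinv⟩ := h.exists_localInverse
  refine ⟨k, hk, hk0, hinv, ?_⟩
  -- the subtraction of `v + e` makes `K` vanish for `v = 0`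
  set K : E → E → E := fun v e => F (k v) (k (v + e)) - (v + e) with hKdef
  have hK : ContDiffAt ℝ ∞ (fun q : E × E => K q.1 q.2) (0, 0) := by
    have h1 : ContDiffAt ℝ ∞ (fun q : E × E => k q.1) (0, 0) :=
      ContDiffAt.comp ((0, 0) : E × E) (g := k) (f := Prod.fst) hk contDiffAt_fst
    have h2 : ContDiffAt ℝ ∞ (fun q : E × E => k (q.1 + q.2)) (0, 0) :=
      ContDiffAt.comp ((0, 0) : E × E) (g := k) (f := fun q : E × E => q.1 + q.2)
        (by simpa using hk) (contDiffAt_fst.add contDiffAt_snd)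
    have h3 : ContDiffAt ℝ ∞ (fun q : E × E => F q.1 q.2)
        ((fun q : E × E => (k q.1, k (q.1 + q.2))) (0, 0)) := by
      simpa [hk0] using h.contDiffAt_uncurry h.mem h.mem
    exact (ContDiffAt.comp ((0, 0) : E × E) h3 (h1.prodMk h2)).sub
      (contDiffAt_fst.add contDiffAt_snd)
  have hK0 : ∀ᶠ e in 𝓝 (0 : E), K 0 e = 0 := by
    filter_upwards [hinv] with e he
    simp [hKdef, hk0, he.2]
  have hι : ContDiffAt ℝ ∞ (fun v : E => (v, (0 : E))) 0 := contDiffAt_id.prodMk contDiffAt_const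
  have hK1 := contDiffAt_partial_fderiv hK
  have hK2 := contDiffAt_partial_fderiv (K := fun v e => fderiv ℝ (K v) e) hK1
  have hL : ContDiffAt ℝ ∞ (fun v => fderiv ℝ (K v) 0) 0 :=
    ContDiffAt.comp (0 : E) (g := fun q : E × E => fderiv ℝ (K q.1) q.2)
      (f := fun v : E => (v, (0 : E))) hK1 hι
  have hB : ContDiffAt ℝ ∞ (fun v => fderiv ℝ (fderiv ℝ (K v)) 0) 0 :=
    ContDiffAt.comp (0 : E) (g := fun q : E × E => fderiv ℝ (fderiv ℝ (K q.1)) q.2)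
      (f := fun v : E => (v, (0 : E))) hK2 hι
  have hL0 : fderiv ℝ (K 0) 0 = 0 := (eventuallyEq_zero_fderiv hK0).self_of_nhds
  have hB0 : fderiv ℝ (fderiv ℝ (K 0)) 0 = 0 :=
    (eventuallyEq_zero_fderiv (eventuallyEq_zero_fderiv hK0)).self_of_nhds
  have hcurv := h.fderiv_normalConnector hk hk0 hk1 hinv
    (B := fun v => fderiv ℝ (fderiv ℝ (K v)) 0) (hB.differentiableAt (by simp)) hB0 (fun v => rfl)
  obtain ⟨C₁, hC₁, b₁⟩ := exists_norm_sub_taylor_two_param_le hK hK0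
  obtain ⟨C₂, hC₂, b₂⟩ := exists_norm_sub_le (hL.of_le (by simp))
  obtain ⟨C₃, hC₃, b₃⟩ := exists_norm_sub_fderiv_le (hB.of_le two_le_infty)
  simp only [hL0, hB0, sub_zero] at b₂ b₃
  refine ⟨fun v => fderiv ℝ (K v) 0, C₁ + C₂ + C₃, by positivity, ?_, ?_⟩
  · filter_upwards [b₂] with v hv
    exact hv.trans (by gcongr; linarith)
  have hsub : Tendsto (fun q : E × E => (q.1, q.2 - q.1)) (𝓝 (0, 0)) (𝓝 (0, 0)) := by
    have : Continuous (fun q : E × E => (q.1, q.2 - q.1)) := by fun_prop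
    simpa using this.tendsto (0, 0)
  have hfst : Tendsto (Prod.fst : E × E → E) (𝓝 (0, 0)) (𝓝 0) := continuous_fst.tendsto _
  filter_upwards [hsub.eventually b₁, hfst.eventually b₃, hfst.eventually hinv] with q h1 h3 h4
  obtain ⟨v, w⟩ := q
  simp only at h1 h3 h4 ⊢
  set e := w - v with he
  have hw : v + e = w := by rw [he]; abel
  have e0 : K v 0 = -v := by
    simp only [hKdef, add_zero, h.apply_self h4.1, zero_sub]
  have e1 : K v e = F (k v) (k w) - w := by simp only [hKdef, hw]
  set D := fderiv ℝ (fun v => fderiv ℝ (fderiv ℝ (K v)) 0) 0 with hD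
  have e2 : (1 / 3 : ℝ) • localCurvature Γ x₀ v e e = -(1 / 2 : ℝ) • D v e e := by
    rw [hcurv v e, smul_smul]; congr 1; norm_num
  have h3' : ‖(fderiv ℝ (fderiv ℝ (K v)) 0 - D v) e e‖ ≤ C₃ * ‖v‖ ^ 2 * ‖e‖ ^ 2 := by
    calc _ ≤ ‖fderiv ℝ (fderiv ℝ (K v)) 0 - D v‖ * ‖e‖ * ‖e‖ := ContinuousLinearMap.le_opNorm₂ _ _ _
      _ ≤ C₃ * ‖v‖ ^ 2 * ‖e‖ * ‖e‖ := by gcongr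
      _ = _ := by ring
  have split : F (k v) (k w) - e - fderiv ℝ (K v) 0 e + (1 / 3 : ℝ) • localCurvature Γ x₀ v e e
      = (K v e - K v 0 - fderiv ℝ (K v) 0 e - (1 / 2 : ℝ) • fderiv ℝ (fderiv ℝ (K v)) 0 e e)
        + (1 / 2 : ℝ) • (fderiv ℝ (fderiv ℝ (K v)) 0 - D v) e e := by
    rw [e0, e1, e2, ← hw]
    simp only [sub_apply]
    module
  rw [split]
  refine (norm_add_le _ _).trans ?_
  rw [norm_smul]
  have : ‖(1 / 2 : ℝ)‖ = 1 / 2 := by norm_num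
  rw [this]
  have p1 : 0 ≤ ‖v‖ * ‖e‖ ^ 3 := by positivity
  have p2 : 0 ≤ ‖v‖ ^ 2 * ‖e‖ ^ 2 := by positivity
  have := mul_nonneg hC₁ p2
  have := mul_nonneg hC₂ p1
  have := mul_nonneg hC₂ p2
  have := mul_nonneg hC₃ p1
  have := mul_nonneg hC₃ p2
  nlinarith

end IsLocalExpInv

end Expansion

/-! ### Expectations of the expansion -/

section Moments

variable {E : Type*} [NormedAddCommGroup E] [NormedSpace ℝ E]

theorem norm_apply₃_le (R : E →L[ℝ] E →L[ℝ] E →L[ℝ] E) (u a b : E) :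
    ‖R u a b‖ ≤ ‖R‖ * ‖u‖ * ‖a‖ * ‖b‖ :=
  (R u).le_of_opNorm₂_le_of_le (R.le_opNorm u) le_rfl le_rfl

theorem max_pow_four_le (a b : ℝ) : max a b ^ 4 ≤ a ^ 4 + b ^ 4 := by
  rcases max_cases a b with ⟨h, -⟩ | ⟨h, -⟩ <;> rw [h] <;>
    nlinarith [sq_nonneg (a ^ 2), sq_nonneg (b ^ 2)]

/-- The expansion in `e = η - v` rewritten in terms of `X = η - m`, where `v = m - r / 3` with
`r = O(γ³)`: replacing `L e` by `L X` and `R(v, e)e` by `R(m, X)X` costs `O(γ⁴ + ‖X‖⁴)`. -/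
theorem norm_sub_centred_expansion_le {A C : ℝ} (hA : 1 ≤ A) (hC : 0 ≤ C)
    (R : E →L[ℝ] E →L[ℝ] E →L[ℝ] E) {γ : ℝ} (hγ : 0 < γ) (hγ1 : γ ≤ 1) {X m r ζ v e : E}
    {L : E →L[ℝ] E} (hm : ‖m‖ ≤ A * γ) (hr : ‖r‖ ≤ A * γ ^ 3)
    (hv : v = m - (1 / 3 : ℝ) • r) (he : e = X + (1 / 3 : ℝ) • r) (hL : ‖L‖ ≤ C * ‖v‖)
    (hζ : ‖ζ - (e + L e - (1 / 3 : ℝ) • R v e e)‖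
      ≤ C * (‖v‖ * ‖e‖ ^ 3 + ‖v‖ ^ 2 * ‖e‖ ^ 2 + ‖m + X‖ ^ 4)) :
    ‖ζ - (X + L X + (1 / 3 : ℝ) • r - (1 / 3 : ℝ) • R m X X)‖
      ≤ (48 * C * A ^ 4 + C * A ^ 2 + 7 * ‖R‖ * A ^ 3) * (γ ^ 4 + ‖X‖ ^ 4) := by
  -- `‖v‖`, `‖e‖` and `‖m + X‖` are at most `2 A s`, which gives `48 = 3 * 2 ^ 4`; the three terms
  -- of `R v e e - R m X X` give `7 = 4 + 2 + 1`
  set s := max γ ‖X‖ with hs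
  have hγs : γ ≤ s := le_max_left _ _
  have hXs : ‖X‖ ≤ s := le_max_right _ _
  have hs0 : 0 < s := hγ.trans_le hγs
  have hr3 : ‖r‖ ≤ A * s ^ 3 := hr.trans (by gcongr)
  have hr2 : ‖r‖ ≤ A * s ^ 2 := by
    refine hr.trans ?_
    have : γ ^ 3 ≤ γ ^ 2 := pow_le_pow_of_le_one hγ.le hγ1 (by norm_num)
    have : γ ^ 3 ≤ s ^ 2 := this.trans (by gcongr)
    gcongr
  have hr1 : ‖r‖ ≤ A * s := by
    refine hr.trans ?_
    have : γ ^ 3 ≤ γ ^ 1 := pow_le_pow_of_le_one hγ.le hγ1 (by norm_num)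
    have : γ ^ 3 ≤ s := by rw [pow_one] at this; exact this.trans hγs
    gcongr
  have hthird : ∀ x : E, ‖(1 / 3 : ℝ) • x‖ = ‖x‖ / 3 := fun x => by
    rw [norm_smul]; norm_num; ring
  have hms : ‖m‖ ≤ A * s := hm.trans (by gcongr)
  have hsA : s ≤ A * s := le_mul_of_one_le_left hs0.le hA
  have hvs : ‖v‖ ≤ 2 * A * s := by
    rw [hv]
    refine (norm_sub_le _ _).trans ?_
    rw [hthird]; linarith [norm_nonneg r]
  have hes : ‖e‖ ≤ 2 * A * s := by
    rw [he]
    refine (norm_add_le _ _).trans ?_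
    rw [hthird]; linarith [norm_nonneg r]
  have hηs : ‖m + X‖ ≤ 2 * A * s := (norm_add_le _ _).trans (by linarith)
  have hvm : ‖v - m‖ ≤ A * s ^ 2 := by
    rw [hv, sub_sub_cancel_left, norm_neg, hthird]; linarith [norm_nonneg r]
  have heX : ‖e - X‖ ≤ A * s ^ 2 := by
    rw [he, add_sub_cancel_left, hthird]; linarith [norm_nonneg r]
  have b1 : C * (‖v‖ * ‖e‖ ^ 3 + ‖v‖ ^ 2 * ‖e‖ ^ 2 + ‖m + X‖ ^ 4) ≤ 48 * C * A ^ 4 * s ^ 4 := by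
    calc _ ≤ C * ((2 * A * s) * (2 * A * s) ^ 3 + (2 * A * s) ^ 2 * (2 * A * s) ^ 2
          + (2 * A * s) ^ 4) := by gcongr
      _ = _ := by ring
  have b2 : ‖L ((1 / 3 : ℝ) • r)‖ ≤ C * A ^ 2 * s ^ 4 := by
    calc _ ≤ ‖L‖ * ‖(1 / 3 : ℝ) • r‖ := L.le_opNorm _
      _ ≤ (C * (2 * A * s)) * (A * s ^ 3 / 3) := by
        rw [hthird]
        have : ‖L‖ ≤ C * (2 * A * s) := hL.trans (by gcongr)
        gcongr
      _ = 2 / 3 * (C * A ^ 2 * s ^ 4) := by ring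
      _ ≤ C * A ^ 2 * s ^ 4 := by
        have : 0 ≤ C * A ^ 2 * s ^ 4 := by positivity
        linarith
  have b3 : ‖R v e e - R m X X‖ ≤ 7 * ‖R‖ * A ^ 3 * s ^ 4 := by
    have : R v e e - R m X X = R (v - m) e e + R m (e - X) e + R m X (e - X) := by
      simp only [map_sub, sub_apply]; abel
    rw [this]
    calc _ ≤ ‖R (v - m) e e‖ + ‖R m (e - X) e‖ + ‖R m X (e - X)‖ := norm_add₃_le
      _ ≤ ‖R‖ * ‖v - m‖ * ‖e‖ * ‖e‖ + ‖R‖ * ‖m‖ * ‖e - X‖ * ‖e‖ + ‖R‖ * ‖m‖ * ‖X‖ * ‖e - X‖ := by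
        gcongr <;> exact norm_apply₃_le _ _ _ _
      _ ≤ ‖R‖ * (A * s ^ 2) * (2 * A * s) * (2 * A * s) + ‖R‖ * (A * s) * (A * s ^ 2) * (2 * A * s)
          + ‖R‖ * (A * s) * (A * s) * (A * s ^ 2) := by
        have : ‖X‖ ≤ A * s := hXs.trans hsA
        gcongr
      _ = _ := by ring
  have split : ζ - (X + L X + (1 / 3 : ℝ) • r - (1 / 3 : ℝ) • R m X X)
      = (ζ - (e + L e - (1 / 3 : ℝ) • R v e e)) + L ((1 / 3 : ℝ) • r)
        - (1 / 3 : ℝ) • (R v e e - R m X X) := by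
    have : L e = L X + L ((1 / 3 : ℝ) • r) := by rw [he, map_add]
    rw [this]
    linear_combination (norm := module) he
  rw [split]
  have hs4 : s ^ 4 ≤ γ ^ 4 + ‖X‖ ^ 4 := max_pow_four_le _ _
  calc _ ≤ ‖ζ - (e + L e - (1 / 3 : ℝ) • R v e e)‖ + ‖L ((1 / 3 : ℝ) • r)‖
        + ‖(1 / 3 : ℝ) • (R v e e - R m X X)‖ :=
        (norm_sub_le _ _).trans (add_le_add_left (norm_add_le _ _) _)
    _ ≤ 48 * C * A ^ 4 * s ^ 4 + C * A ^ 2 * s ^ 4 + 7 * ‖R‖ * A ^ 3 * s ^ 4 := by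
        rw [hthird]
        have := norm_nonneg (R v e e - R m X X)
        have := hζ.trans b1
        linarith
    _ = (48 * C * A ^ 4 + C * A ^ 2 + 7 * ‖R‖ * A ^ 3) * s ^ 4 := by ring
    _ ≤ _ := by gcongr

/-- The cubic form `T(e, e, e)` in `e = η - v` rewritten in terms of `X = η - m`, where
`v = m - r / 3` with `r = O(γ³)`. -/
theorem norm_sub_cubic_le {A C : ℝ} (hA : 1 ≤ A) (hC : 0 ≤ C)
    (T : E →L[ℝ] E →L[ℝ] E →L[ℝ] E) {γ : ℝ} (hγ : 0 < γ) (hγ1 : γ ≤ 1) {X m r ξ v e : E}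
    (hm : ‖m‖ ≤ A * γ) (hr : ‖r‖ ≤ A * γ ^ 3)
    (hv : v = m - (1 / 3 : ℝ) • r) (he : e = X + (1 / 3 : ℝ) • r)
    (hξ : ‖ξ - T e e e‖ ≤ C * (‖v‖ * ‖e‖ ^ 3 + ‖m + X‖ ^ 4)) :
    ‖ξ - T X X X‖ ≤ (32 * C * A ^ 4 + 7 * ‖T‖ * A ^ 3) * (γ ^ 4 + ‖X‖ ^ 4) := by
  set s := max γ ‖X‖ with hs
  have hγs : γ ≤ s := le_max_left _ _
  have hXs : ‖X‖ ≤ s := le_max_right _ _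
  have hs0 : 0 < s := hγ.trans_le hγs
  have hr2 : ‖r‖ ≤ A * s ^ 2 := by
    refine hr.trans ?_
    have : γ ^ 3 ≤ γ ^ 2 := pow_le_pow_of_le_one hγ.le hγ1 (by norm_num)
    have : γ ^ 3 ≤ s ^ 2 := this.trans (by gcongr)
    gcongr
  have hr1 : ‖r‖ ≤ A * s := by
    refine hr.trans ?_
    have : γ ^ 3 ≤ γ ^ 1 := pow_le_pow_of_le_one hγ.le hγ1 (by norm_num)
    have : γ ^ 3 ≤ s := by rw [pow_one] at this; exact this.trans hγs
    gcongr
  have hthird : ∀ x : E, ‖(1 / 3 : ℝ) • x‖ = ‖x‖ / 3 := fun x => by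
    rw [norm_smul]; norm_num; ring
  have hms : ‖m‖ ≤ A * s := hm.trans (by gcongr)
  have hsA : s ≤ A * s := le_mul_of_one_le_left hs0.le hA
  have hvs : ‖v‖ ≤ 2 * A * s := by
    rw [hv]
    refine (norm_sub_le _ _).trans ?_
    rw [hthird]; linarith [norm_nonneg r]
  have hes : ‖e‖ ≤ 2 * A * s := by
    rw [he]
    refine (norm_add_le _ _).trans ?_
    rw [hthird]; linarith [norm_nonneg r]
  have hηs : ‖m + X‖ ≤ 2 * A * s := (norm_add_le _ _).trans (by linarith)
  have heX : ‖e - X‖ ≤ A * s ^ 2 := by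
    rw [he, add_sub_cancel_left, hthird]; linarith [norm_nonneg r]
  have b1 : C * (‖v‖ * ‖e‖ ^ 3 + ‖m + X‖ ^ 4) ≤ 32 * C * A ^ 4 * s ^ 4 := by
    calc _ ≤ C * ((2 * A * s) * (2 * A * s) ^ 3 + (2 * A * s) ^ 4) := by gcongr
      _ = _ := by ring
  have b3 : ‖T e e e - T X X X‖ ≤ 7 * ‖T‖ * A ^ 3 * s ^ 4 := by
    have : T e e e - T X X X = T (e - X) e e + T X (e - X) e + T X X (e - X) := by
      simp only [map_sub, sub_apply]; abel
    rw [this]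
    calc _ ≤ ‖T (e - X) e e‖ + ‖T X (e - X) e‖ + ‖T X X (e - X)‖ := norm_add₃_le
      _ ≤ ‖T‖ * ‖e - X‖ * ‖e‖ * ‖e‖ + ‖T‖ * ‖X‖ * ‖e - X‖ * ‖e‖ + ‖T‖ * ‖X‖ * ‖X‖ * ‖e - X‖ := by
        gcongr <;> exact norm_apply₃_le _ _ _ _
      _ ≤ ‖T‖ * (A * s ^ 2) * (2 * A * s) * (2 * A * s) + ‖T‖ * (A * s) * (A * s ^ 2) * (2 * A * s)
          + ‖T‖ * (A * s) * (A * s) * (A * s ^ 2) := by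
        have : ‖X‖ ≤ A * s := hXs.trans hsA
        gcongr
      _ = _ := by ring
  have hs4 : s ^ 4 ≤ γ ^ 4 + ‖X‖ ^ 4 := max_pow_four_le _ _
  calc _ = ‖(ξ - T e e e) + (T e e e - T X X X)‖ := by congr 1; abel
    _ ≤ ‖ξ - T e e e‖ + ‖T e e e - T X X X‖ := norm_add_le _ _
    _ ≤ 32 * C * A ^ 4 * s ^ 4 + 7 * ‖T‖ * A ^ 3 * s ^ 4 := add_le_add (hξ.trans b1) b3
    _ = (32 * C * A ^ 4 + 7 * ‖T‖ * A ^ 3) * s ^ 4 := by ring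
    _ ≤ _ := by gcongr

section Integrals

variable {Ω : Type*} [MeasurableSpace Ω] {P : Measure Ω} [IsProbabilityMeasure P] {X : Ω → E}

theorem integrable_norm_pow_of_memLp_four {E : Type*} [NormedAddCommGroup E] {X : Ω → E}
    (hX : MemLp X 4 P) {j : ℕ} (hj : j ≤ 4) :
    Integrable (fun a => ‖X a‖ ^ j) P := by
  rcases Nat.eq_zero_or_pos j with rfl | hj0
  · simp
  · have : MemLp X j P := hX.mono_exponent (by exact_mod_cast hj)
    exact this.integrable_norm_pow hj0.ne'

/-- A fourth moment of order `γ⁴` gives a second moment of order `γ²`. -/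
theorem integral_norm_sq_le {E : Type*} [NormedAddCommGroup E] {X : Ω → E} {A γ : ℝ}
    (hX : MemLp X 4 P) (hγ : 0 < γ) (h4 : ∫ a, ‖X a‖ ^ 4 ∂P ≤ A * γ ^ 4) :
    ∫ a, ‖X a‖ ^ 2 ∂P ≤ (1 + A) * γ ^ 2 := by
  have h := integrable_norm_pow_of_memLp_four hX (le_refl 4)
  have hpt : ∀ a, ‖X a‖ ^ 2 ≤ γ ^ 2 + (γ ^ 2)⁻¹ * ‖X a‖ ^ 4 := by
    intro a
    have hg : 0 < γ ^ 2 := by positivity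
    -- complete the square in `‖X a‖ ^ 2`
    rw [← sub_nonneg]
    have : γ ^ 2 + (γ ^ 2)⁻¹ * ‖X a‖ ^ 4 - ‖X a‖ ^ 2
        = (γ ^ 2)⁻¹ * ((γ ^ 2 - ‖X a‖ ^ 2 / 2) ^ 2 + 3 / 4 * (‖X a‖ ^ 2) ^ 2) := by
      field_simp; ring
    rw [this]; positivity
  calc ∫ a, ‖X a‖ ^ 2 ∂P ≤ ∫ a, (γ ^ 2 + (γ ^ 2)⁻¹ * ‖X a‖ ^ 4) ∂P :=
        integral_mono (integrable_norm_pow_of_memLp_four hX (by norm_num))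
          ((integrable_const _).add (h.const_mul _)) hpt
    _ = γ ^ 2 + (γ ^ 2)⁻¹ * ∫ a, ‖X a‖ ^ 4 ∂P := by
        rw [integral_add (integrable_const _) (h.const_mul _), integral_const_mul]; simp
    _ ≤ γ ^ 2 + (γ ^ 2)⁻¹ * (A * γ ^ 4) := by gcongr
    _ = (1 + A) * γ ^ 2 := by field_simp

theorem norm_integral_sub_le {A C γ : ℝ} {ζ Y : Ω → E} (hC : 0 ≤ C) (hX : MemLp X 4 P)
    (h4 : ∫ a, ‖X a‖ ^ 4 ∂P ≤ A * γ ^ 4) (hζ : Integrable ζ P) (hY : Integrable Y P)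
    (h : ∀ᵐ a ∂P, ‖ζ a - Y a‖ ≤ C * (γ ^ 4 + ‖X a‖ ^ 4)) :
    ‖∫ a, ζ a ∂P - ∫ a, Y a ∂P‖ ≤ C * (1 + A) * γ ^ 4 := by
  have hi := integrable_norm_pow_of_memLp_four hX (le_refl 4)
  rw [← integral_sub hζ hY]
  calc _ ≤ ∫ a, C * (γ ^ 4 + ‖X a‖ ^ 4) ∂P :=
        norm_integral_le_of_norm_le (((integrable_const _).add hi).const_mul _) h
    _ = C * (γ ^ 4 + ∫ a, ‖X a‖ ^ 4 ∂P) := by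
        rw [integral_const_mul, integral_add (integrable_const _) hi]; simp
    _ ≤ C * (γ ^ 4 + A * γ ^ 4) := by gcongr
    _ = _ := by ring

theorem integrable_apply₂ (S : E →L[ℝ] E →L[ℝ] E) (hX : MemLp X 4 P) :
    Integrable (fun a => S (X a) (X a)) P := by
  refine ((integrable_norm_pow_of_memLp_four hX (j := 2) (by norm_num)).const_mul ‖S‖).mono'
    ((S.continuous₂.comp (continuous_id.prodMk continuous_id)).comp_aestronglyMeasurable
      hX.aestronglyMeasurable) (Eventually.of_forall fun a => ?_)
  calc _ ≤ ‖S‖ * ‖X a‖ * ‖X a‖ := S.le_opNorm₂ _ _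
    _ = _ := by ring

theorem integrable_apply₃ (T : E →L[ℝ] E →L[ℝ] E →L[ℝ] E) (hX : MemLp X 4 P) :
    Integrable (fun a => T (X a) (X a) (X a)) P := by
  have hc : Continuous fun x : E => T x x x := by fun_prop
  refine ((integrable_norm_pow_of_memLp_four hX (j := 3) (by norm_num)).const_mul ‖T‖).mono'
    (hc.comp_aestronglyMeasurable hX.aestronglyMeasurable) (Eventually.of_forall fun a => ?_)
  calc _ ≤ ‖T‖ * ‖X a‖ * ‖X a‖ * ‖X a‖ := norm_apply₃_le _ _ _ _
    _ = _ := by ring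

variable {A C γ : ℝ} {η ζ : Ω → E} {m v : E}

theorem norm_integral_apply_covariance_le (R : E →L[ℝ] E →L[ℝ] E →L[ℝ] E) (hX : MemLp X 4 P)
    (hγ : 0 < γ) (hA : 0 ≤ A) (hm : ‖m‖ ≤ A * γ) (h4 : ∫ a, ‖X a‖ ^ 4 ∂P ≤ A * γ ^ 4) :
    ‖∫ a, R m (X a) (X a) ∂P‖ ≤ (A + ‖R‖ * A * (1 + A)) * γ ^ 3 := by
  have h2 := integral_norm_sq_le hX hγ h4
  calc _ ≤ ∫ a, ‖R‖ * ‖m‖ * ‖X a‖ ^ 2 ∂P := by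
        refine norm_integral_le_of_norm_le ((integrable_norm_pow_of_memLp_four hX
          (by norm_num)).const_mul _) (Eventually.of_forall fun a => ?_)
        exact (norm_apply₃_le _ _ _ _).trans (by rw [pow_two, mul_assoc])
    _ = ‖R‖ * ‖m‖ * ∫ a, ‖X a‖ ^ 2 ∂P := integral_const_mul _ _
    _ ≤ ‖R‖ * (A * γ) * ((1 + A) * γ ^ 2) := by gcongr
    _ = ‖R‖ * A * (1 + A) * γ ^ 3 := by ring
    _ ≤ _ := by
        have : 0 ≤ A * γ ^ 3 := by positivity
        linarith

/-- The corrected mean `v = m - R(m, Σ) / 3` annihilates the expectation of the expansion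
`(η - v) + L (η - v) - R(v, η - v)(η - v) / 3` up to fourth order. -/
theorem norm_integral_le_of_expansion [CompleteSpace E] (R : E →L[ℝ] E →L[ℝ] E →L[ℝ] E)
    {L : E →L[ℝ] E}
    (hA : 1 ≤ A) (hC : 0 ≤ C) (hγ : 0 < γ) (hγ1 : γ ≤ 1) (hη : MemLp η 4 P)
    (hm : m = ∫ a, η a ∂P) (hmA : ‖m‖ ≤ A * γ) (h4 : ∫ a, ‖η a - m‖ ^ 4 ∂P ≤ A * γ ^ 4)
    (hv : v = m - (1 / 3 : ℝ) • ∫ a, R m (η a - m) (η a - m) ∂P)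
    (hL : ‖L‖ ≤ C * ‖v‖) (hζi : Integrable ζ P)
    (hζ : ∀ᵐ a ∂P, ‖ζ a - ((η a - v) + L (η a - v) - (1 / 3 : ℝ) • R v (η a - v) (η a - v))‖
      ≤ C * (‖v‖ * ‖η a - v‖ ^ 3 + ‖v‖ ^ 2 * ‖η a - v‖ ^ 2 + ‖η a‖ ^ 4)) :
    ‖∫ a, ζ a ∂P‖ ≤ (48 * C * (A + ‖R‖ * A * (1 + A)) ^ 4 + C * (A + ‖R‖ * A * (1 + A)) ^ 2
      + 7 * ‖R‖ * (A + ‖R‖ * A * (1 + A)) ^ 3) * (1 + A) * γ ^ 4 := by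
  have hX : MemLp (fun a => η a - m) 4 P := hη.sub (memLp_const m)
  have hA0 : 0 ≤ A := zero_le_one.trans hA
  have hRA : 0 ≤ ‖R‖ * A * (1 + A) := by positivity
  have hA' : 1 ≤ A + ‖R‖ * A * (1 + A) := by linarith
  set r := ∫ a, R m (η a - m) (η a - m) ∂P with hr
  have hrA : ‖r‖ ≤ (A + ‖R‖ * A * (1 + A)) * γ ^ 3 :=
    norm_integral_apply_covariance_le R hX hγ hA0 hmA h4
  have hXi : Integrable (fun a => η a - m) P := hX.integrable (by norm_num)
  have hX0 : ∫ a, (η a - m) ∂P = 0 := by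
    rw [integral_sub (hη.integrable (by norm_num)) (integrable_const _), ← hm]; simp
  have hRi : Integrable (fun a => R m (η a - m) (η a - m)) P := integrable_apply₂ (R m) hX
  have hLi : Integrable (fun a => L (η a - m)) P := L.integrable_comp hXi
  have hXL : Integrable (fun a => (η a - m) + L (η a - m)) P := hXi.add hLi
  have hXLr : Integrable (fun a => (η a - m) + L (η a - m) + (1 / 3 : ℝ) • r) P :=
    hXL.add (integrable_const _)
  have hRs : Integrable (fun a => (1 / 3 : ℝ) • R m (η a - m) (η a - m)) P := hRi.smul (1 / 3 : ℝ)
  have hYi : Integrable (fun a => (η a - m) + L (η a - m) + (1 / 3 : ℝ) • r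
      - (1 / 3 : ℝ) • R m (η a - m) (η a - m)) P :=
    hXLr.sub hRs
  have hY0 : ∫ a, ((η a - m) + L (η a - m) + (1 / 3 : ℝ) • r
      - (1 / 3 : ℝ) • R m (η a - m) (η a - m)) ∂P = 0 := by
    rw [integral_sub hXLr hRs, integral_add hXL (integrable_const _), integral_add hXi hLi,
      L.integral_comp_comm hXi, hX0, integral_const, integral_smul, ← hr]
    simp
  have key := norm_integral_sub_le (ζ := ζ) (Y := fun a => (η a - m) + L (η a - m)
      + (1 / 3 : ℝ) • r - (1 / 3 : ℝ) • R m (η a - m) (η a - m)) (A := A) (γ := γ)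
    (C := 48 * C * (A + ‖R‖ * A * (1 + A)) ^ 4 + C * (A + ‖R‖ * A * (1 + A)) ^ 2
      + 7 * ‖R‖ * (A + ‖R‖ * A * (1 + A)) ^ 3) (by positivity) hX h4 hζi hYi ?_
  · rwa [hY0, sub_zero] at key
  · filter_upwards [hζ] with a ha
    refine norm_sub_centred_expansion_le hA' hC R hγ hγ1 (v := v) (e := η a - v)
      (hmA.trans ?_) hrA hv ?_ hL ?_
    · gcongr; linarith
    · rw [hv]; abel
    · rwa [add_sub_cancel]

/-- For the corrected mean `v = m - R(m, Σ) / 3`, the expectation of a quantity which is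
`T(η - v, η - v, η - v)` to leading order is that of `T(η - m, η - m, η - m)`, up to fourth
order. -/
theorem norm_integral_le_of_cubic (R T : E →L[ℝ] E →L[ℝ] E →L[ℝ] E)
    (hA : 1 ≤ A) (hC : 0 ≤ C) (hγ : 0 < γ) (hγ1 : γ ≤ 1) (hη : MemLp η 4 P)
    (hmA : ‖m‖ ≤ A * γ) (h4 : ∫ a, ‖η a - m‖ ^ 4 ∂P ≤ A * γ ^ 4)
    (hv : v = m - (1 / 3 : ℝ) • ∫ a, R m (η a - m) (η a - m) ∂P)
    (hζi : Integrable ζ P)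
    (hζ : ∀ᵐ a ∂P, ‖ζ a - T (η a - v) (η a - v) (η a - v)‖
      ≤ C * (‖v‖ * ‖η a - v‖ ^ 3 + ‖η a‖ ^ 4)) :
    ‖∫ a, ζ a ∂P‖ ≤ ‖∫ a, T (η a - m) (η a - m) (η a - m) ∂P‖
      + (32 * C * (A + ‖R‖ * A * (1 + A)) ^ 4 + 7 * ‖T‖ * (A + ‖R‖ * A * (1 + A)) ^ 3)
        * (1 + A) * γ ^ 4 := by
  have hX : MemLp (fun a => η a - m) 4 P := hη.sub (memLp_const m)
  have hA0 : 0 ≤ A := zero_le_one.trans hA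
  have hRA : 0 ≤ ‖R‖ * A * (1 + A) := by positivity
  have hA' : 1 ≤ A + ‖R‖ * A * (1 + A) := by linarith
  set r := ∫ a, R m (η a - m) (η a - m) ∂P with hr
  have hrA : ‖r‖ ≤ (A + ‖R‖ * A * (1 + A)) * γ ^ 3 :=
    norm_integral_apply_covariance_le R hX hγ hA0 hmA h4
  have key := norm_integral_sub_le (ζ := ζ) (Y := fun a => T (η a - m) (η a - m) (η a - m))
    (A := A) (γ := γ)
    (C := 32 * C * (A + ‖R‖ * A * (1 + A)) ^ 4 + 7 * ‖T‖ * (A + ‖R‖ * A * (1 + A)) ^ 3)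
    (by positivity) hX h4 hζi (integrable_apply₃ T hX) ?_
  · have := norm_sub_norm_le (∫ a, ζ a ∂P) (∫ a, T (η a - m) (η a - m) (η a - m) ∂P)
    linarith
  · filter_upwards [hζ] with a ha
    refine norm_sub_cubic_le hA' hC T hγ hγ1 (m := m) (r := r) (v := v) (e := η a - v)
      (hmA.trans ?_) hrA hv ?_ ?_
    · gcongr; linarith
    · rw [hv]; abel
    · rwa [add_sub_cancel]

end Integrals

end Moments

/-! ### Tangent vectors and connections in a chart -/

section Coordinates

variable {n : ℕ} {N : Type*} [TopologicalSpace N] [ChartedSpace (EuclideanSpace ℝ (Fin n)) N]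
  [IsManifold (𝓡 n) ∞ N]

/-- The coordinates of a tangent vector at `y` in the chart at `x₀`. They are meaningful for `y` in
the domain of that chart. -/
def coordVec (x₀ y : N) (v : TangentSpace (𝓡 n) y) : EuclideanSpace ℝ (Fin n) :=
  (trivializationAt (EuclideanSpace ℝ (Fin n)) (TangentSpace (𝓡 n) : N → Type _) x₀ ⟨y, v⟩).2

variable {x₀ y : N}

theorem coordVec_coordField (hy : y ∈ (chartAt (EuclideanSpace ℝ (Fin n)) x₀).source)
    (w : EuclideanSpace ℝ (Fin n)) : coordVec x₀ y (coordField x₀ w y) = w := by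
  rw [coordVec, coordField, Trivialization.apply_mk_symm _ hy]

theorem coordField_coordVec (hy : y ∈ (chartAt (EuclideanSpace ℝ (Fin n)) x₀).source)
    (v : TangentSpace (𝓡 n) y) : coordField x₀ (coordVec x₀ y v) y = v :=
  Trivialization.symm_apply_apply_mk _ hy v

theorem coordVec_eq_continuousLinearMapAt
    (hy : y ∈ (chartAt (EuclideanSpace ℝ (Fin n)) x₀).source) (v : TangentSpace (𝓡 n) y) :
    coordVec x₀ y v = (trivializationAt (EuclideanSpace ℝ (Fin n))
      (TangentSpace (𝓡 n) : N → Type _) x₀).continuousLinearMapAt ℝ y v := by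
  rw [Trivialization.continuousLinearMapAt_apply, Trivialization.coe_linearMapAt_of_mem _ hy]
  rfl

theorem coordVec_add (hy : y ∈ (chartAt (EuclideanSpace ℝ (Fin n)) x₀).source)
    (v w : TangentSpace (𝓡 n) y) : coordVec x₀ y (v + w) = coordVec x₀ y v + coordVec x₀ y w := by
  simp only [coordVec_eq_continuousLinearMapAt hy, map_add]

theorem coordVec_sub (hy : y ∈ (chartAt (EuclideanSpace ℝ (Fin n)) x₀).source)
    (v w : TangentSpace (𝓡 n) y) : coordVec x₀ y (v - w) = coordVec x₀ y v - coordVec x₀ y w := by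
  simp only [coordVec_eq_continuousLinearMapAt hy, map_sub]

theorem coordVec_smul (hy : y ∈ (chartAt (EuclideanSpace ℝ (Fin n)) x₀).source) (r : ℝ)
    (v : TangentSpace (𝓡 n) y) : coordVec x₀ y (r • v) = r • coordVec x₀ y v := by
  simp only [coordVec_eq_continuousLinearMapAt hy, map_smul]

theorem coordVec_injective (hy : y ∈ (chartAt (EuclideanSpace ℝ (Fin n)) x₀).source) :
    Function.Injective (coordVec x₀ y : TangentSpace (𝓡 n) y → _) :=
  (show Function.LeftInverse (fun w => coordField x₀ w y) _ from coordField_coordVec hy).injective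

theorem coordField_add (hy : y ∈ (chartAt (EuclideanSpace ℝ (Fin n)) x₀).source)
    (v w : EuclideanSpace ℝ (Fin n)) :
    coordField x₀ (v + w) y = coordField x₀ v y + coordField x₀ w y := by
  apply coordVec_injective hy
  simp only [coordVec_add hy, coordVec_coordField hy]

theorem coordField_smul (hy : y ∈ (chartAt (EuclideanSpace ℝ (Fin n)) x₀).source) (r : ℝ)
    (v : EuclideanSpace ℝ (Fin n)) :
    coordField x₀ (r • v) y = r • coordField x₀ v y := by
  apply coordVec_injective hy
  simp only [coordVec_smul hy, coordVec_coordField hy]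

theorem extend_eq_coordField (x : N) (v : TangentSpace (𝓡 n) x) :
    FiberBundle.extend (EuclideanSpace ℝ (Fin n)) v = coordField x (coordVec x x v) :=
  rfl

/-- A vector field is smooth at a point if and only if its coordinates are. -/
theorem contMDiffAt_section_iff
    (hy : y ∈ (chartAt (EuclideanSpace ℝ (Fin n)) x₀).source)
    {X : (y : N) → TangentSpace (𝓡 n) y} :
    ContMDiffAt (𝓡 n) (𝓡 n).tangent ∞ (fun q => (⟨q, X q⟩ : TangentBundle (𝓡 n) N)) y ↔
      ContMDiffAt (𝓡 n) 𝓘(ℝ, EuclideanSpace ℝ (Fin n)) ∞ (fun q => coordVec x₀ q (X q)) y :=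
  Trivialization.contMDiffAt_section_iff (trivializationAt (EuclideanSpace ℝ (Fin n))
    (TangentSpace (𝓡 n) : N → Type _) x₀) hy

theorem coordVec_eq_mfderiv (hy : y ∈ (chartAt (EuclideanSpace ℝ (Fin n)) x₀).source)
    (v : TangentSpace (𝓡 n) y) :
    coordVec x₀ y v = mfderiv (𝓡 n) 𝓘(ℝ, EuclideanSpace ℝ (Fin n)) (extChartAt (𝓡 n) x₀) y v := by
  have : IsManifold (𝓡 n) 1 N := IsManifold.of_le (m := 1) (n := ∞) (by simp)
  rw [coordVec_eq_continuousLinearMapAt hy, TangentBundle.continuousLinearMapAt_trivializationAt hy]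
  rfl

theorem contMDiffAt_coordField (hy : y ∈ (chartAt (EuclideanSpace ℝ (Fin n)) x₀).source)
    (w : EuclideanSpace ℝ (Fin n)) :
    ContMDiffAt (𝓡 n) (𝓡 n).tangent ∞
      (fun q => (⟨q, coordField x₀ w q⟩ : TangentBundle (𝓡 n) N)) y := by
  rw [contMDiffAt_section_iff hy]
  refine (contMDiffAt_const (c := w)).congr_of_eventuallyEq ?_
  filter_upwards [(chartAt (EuclideanSpace ℝ (Fin n)) x₀).open_source.mem_nhds hy] with q hq
  exact coordVec_coordField hq w

theorem mdifferentiableAt_coordField (hy : y ∈ (chartAt (EuclideanSpace ℝ (Fin n)) x₀).source)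
    (w : EuclideanSpace ℝ (Fin n)) :
    MDifferentiableAt (𝓡 n) (𝓡 n).tangent
      (fun q => (⟨q, coordField x₀ w q⟩ : TangentBundle (𝓡 n) N)) y :=
  (contMDiffAt_coordField hy w).mdifferentiableAt (by simp)

/-- The coordinate fields of a chart commute. -/
theorem mlieBracket_coordField (hy : y ∈ (chartAt (EuclideanSpace ℝ (Fin n)) x₀).source)
    (v w : EuclideanSpace ℝ (Fin n)) :
    VectorField.mlieBracket (𝓡 n) (coordField x₀ v) (coordField x₀ w) y = 0 := by
  have : IsManifold (𝓡 n) 1 N := IsManifold.of_le (m := 1) (n := ∞) (by simp)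
  have h (v : EuclideanSpace ℝ (Fin n)) : coordField x₀ v =ᶠ[𝓝 y]
      VectorField.mpullback (𝓡 n) 𝓘(ℝ, EuclideanSpace ℝ (Fin n)) (extChartAt (𝓡 n) x₀)
        (fun _ => v) := by
    filter_upwards [(chartAt (EuclideanSpace ℝ (Fin n)) x₀).open_source.mem_nhds hy] with q hq
    have h1 := isInvertible_mfderiv_extChartAt (I := 𝓡 n) (x := x₀) (y := q) (by simpa using hq)
    apply coordVec_injective hq
    rw [coordVec_coordField hq, coordVec_eq_mfderiv hq]
    exact (h1.self_apply_inverse v).symm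
  rw [(h v).mlieBracket_vectorField_eq (h w)]
  have hc (v : EuclideanSpace ℝ (Fin n)) (p : EuclideanSpace ℝ (Fin n)) :
      MDifferentiableAt 𝓘(ℝ, EuclideanSpace ℝ (Fin n)) (𝓡 n).tangent
        (fun q => (⟨q, v⟩ : TangentBundle 𝓘(ℝ, EuclideanSpace ℝ (Fin n))
          (EuclideanSpace ℝ (Fin n)))) p :=
    ((contMDiffAt_vectorSpace_iff_contDiffAt (n := 1)).2 contDiffAt_const).mdifferentiableAt
      one_ne_zero
  have : IsManifold (𝓡 n) (minSmoothness ℝ 2) N :=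
    IsManifold.of_le (m := minSmoothness ℝ 2) (n := ∞) (by simpa using two_le_infty)
  rw [← VectorField.mpullback_mlieBracket (n := ∞) (hc v _) (hc w _)
    (contMDiffAt_extChartAt' hy) (by simpa using two_le_infty)]
  have h0 : VectorField.mlieBracket 𝓘(ℝ, EuclideanSpace ℝ (Fin n))
      (fun _ : EuclideanSpace ℝ (Fin n) => v) (fun _ => w) = 0 := by
    refine VectorField.mlieBracketWithin_univ.symm.trans
      (VectorField.mlieBracketWithin_eq_lieBracketWithin.trans ?_)
    ext1 q
    simp [VectorField.lieBracketWithin]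
    rfl
  rw [h0, VectorField.mpullback_zero]
  rfl

variable (D : CovariantDerivative (𝓡 n) (EuclideanSpace ℝ (Fin n))
  (TangentSpace (𝓡 n) : N → Type _))

theorem covariantDerivative_congr_of_eventuallyEq {X Y : (y : N) → TangentSpace (𝓡 n) y}
    (hX : MDifferentiableAt (𝓡 n) (𝓡 n).tangent
      (fun q => (⟨q, X q⟩ : TangentBundle (𝓡 n) N)) y) (h : X =ᶠ[𝓝 y] Y) : D X y = D Y y :=
  D.isCovariantDerivativeOn.congr_of_eventuallyEq hX
    (hX.congr_of_eventuallyEq (h.symm.mono fun q hq =>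
      congrArg (TotalSpace.mk q) hq)) univ_mem h

theorem connector_add_left (hy : y ∈ (chartAt (EuclideanSpace ℝ (Fin n)) x₀).source)
    (v v' w : EuclideanSpace ℝ (Fin n)) :
    connector D x₀ y (v + v') w = connector D x₀ y v w + connector D x₀ y v' w := by
  rw [connector, coordField_add hy, map_add]
  exact coordVec_add hy _ _

theorem connector_smul_left (hy : y ∈ (chartAt (EuclideanSpace ℝ (Fin n)) x₀).source) (r : ℝ)
    (v w : EuclideanSpace ℝ (Fin n)) :
    connector D x₀ y (r • v) w = r • connector D x₀ y v w := by
  rw [connector, coordField_smul hy, map_smul]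
  exact coordVec_smul hy _ _

theorem connector_add_right (hy : y ∈ (chartAt (EuclideanSpace ℝ (Fin n)) x₀).source)
    (v w w' : EuclideanSpace ℝ (Fin n)) :
    connector D x₀ y v (w + w') = connector D x₀ y v w + connector D x₀ y v w' := by
  have h : coordField x₀ (w + w') =ᶠ[𝓝 y] coordField x₀ w + coordField x₀ w' := by
    filter_upwards [(chartAt (EuclideanSpace ℝ (Fin n)) x₀).open_source.mem_nhds hy] with q hq
    exact coordField_add hq w w'
  rw [connector, covariantDerivative_congr_of_eventuallyEq D (mdifferentiableAt_coordField hy _) h,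
    D.isCovariantDerivativeOn.add (mdifferentiableAt_coordField hy w)
    (mdifferentiableAt_coordField hy w') (mem_univ y)]
  exact coordVec_add hy _ _

theorem connector_smul_right (hy : y ∈ (chartAt (EuclideanSpace ℝ (Fin n)) x₀).source) (r : ℝ)
    (v w : EuclideanSpace ℝ (Fin n)) :
    connector D x₀ y v (r • w) = r • connector D x₀ y v w := by
  have h : coordField x₀ (r • w) =ᶠ[𝓝 y] r • coordField x₀ w := by
    filter_upwards [(chartAt (EuclideanSpace ℝ (Fin n)) x₀).open_source.mem_nhds hy] with q hq
    exact coordField_smul hq r w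
  rw [connector, covariantDerivative_congr_of_eventuallyEq D (mdifferentiableAt_coordField hy _) h,
    D.isCovariantDerivativeOn.smul_const r (mdifferentiableAt_coordField hy w) (mem_univ y)]
  exact coordVec_smul hy _ _

/-- The connector of a torsion-free connection is symmetric, since coordinate fields commute. -/
theorem connector_symm (hD : D.torsion = 0)
    (hy : y ∈ (chartAt (EuclideanSpace ℝ (Fin n)) x₀).source) (v w : EuclideanSpace ℝ (Fin n)) :
    connector D x₀ y v w = connector D x₀ y w v := by
  have h := D.torsion_eq_zero_iff.1 hD (mdifferentiableAt_coordField hy v)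
    (mdifferentiableAt_coordField hy w)
  rw [mlieBracket_coordField hy, sub_eq_zero] at h
  rw [connector, connector, h]

/-- The connector of a smooth connection is smooth. Smoothness of a connection is a statement about
global vector fields, so that the coordinate fields are first multiplied by a bump function. -/
theorem contMDiffAt_connector [T2Space N] [D.ContMDiffCovariantDerivative ∞]
    (hy : y ∈ (chartAt (EuclideanSpace ℝ (Fin n)) x₀).source) (v w : EuclideanSpace ℝ (Fin n)) :
    ContMDiffAt (𝓡 n) 𝓘(ℝ, EuclideanSpace ℝ (Fin n)) ∞ (fun q => connector D x₀ q v w) y := by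
  have hO := (chartAt (EuclideanSpace ℝ (Fin n)) x₀).open_source
  obtain ⟨ψ, -, hψ⟩ :=
    (SmoothBumpFunction.nhds_basis_tsupport (I := 𝓡 n) y).mem_iff.1 (hO.mem_nhds hy)
  have h1 : ContMDiff (𝓡 n) (𝓡 n).tangent ∞
      (fun q => (⟨q, ((ψ : N → ℝ) • coordField x₀ w) q⟩ : TangentBundle (𝓡 n) N)) :=
    ContMDiffOn.smul_section_of_tsupport ψ.contMDiff.contMDiffOn hO hψ fun q hq =>
      (contMDiffAt_coordField hq w).contMDiffWithinAt
  have hD := (CovariantDerivative.ContMDiffCovariantDerivative.contMDiff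
    (cov := D) (k := ∞)).contMDiff (σ := (ψ : N → ℝ) • coordField x₀ w) h1.contMDiffOn
  have h2 := (contMDiffAt_section_iff hy).1 (((contMDiffOn_univ.1 hD) y).clm_bundle_apply
    (contMDiffAt_coordField hy v))
  refine h2.congr_of_eventuallyEq ?_
  filter_upwards [ψ.eventuallyEq_one.eventually_nhds, hO.mem_nhds hy] with q hq hqO
  have h3 : coordField x₀ w =ᶠ[𝓝 q] (ψ : N → ℝ) • coordField x₀ w := by
    filter_upwards [hq] with r hr
    have : (ψ r) • coordField x₀ w r = coordField x₀ w r := by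
      rw [hr]
      exact one_smul ℝ _
    exact this.symm
  rw [connector, covariantDerivative_congr_of_eventuallyEq D
    (mdifferentiableAt_coordField hqO w) h3]
  rfl

theorem euclidean_sum_single (v : EuclideanSpace ℝ (Fin n)) :
    ∑ i, v i • EuclideanSpace.single i (1 : ℝ) = v := by
  ext j
  simp [Finset.sum_apply, Pi.single_apply]

theorem coordVec_sum (hy : y ∈ (chartAt (EuclideanSpace ℝ (Fin n)) x₀).source) {ι : Type*}
    (s : Finset ι) (v : ι → TangentSpace (𝓡 n) y) :
    coordVec x₀ y (∑ i ∈ s, v i) = ∑ i ∈ s, coordVec x₀ y (v i) := by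
  simp only [coordVec_eq_continuousLinearMapAt hy, map_sum]

theorem covariantDerivative_sum {ι : Type*} (s : Finset ι)
    {X : ι → (y : N) → TangentSpace (𝓡 n) y}
    (hX : ∀ i, MDifferentiableAt (𝓡 n) (𝓡 n).tangent
      (fun q => (⟨q, X i q⟩ : TangentBundle (𝓡 n) N)) y) :
    D (∑ i ∈ s, X i) y = ∑ i ∈ s, D (X i) y := by
  classical
  induction s using Finset.induction_on with
  | empty => simp
  | insert i s hi h =>
    rw [Finset.sum_insert hi, Finset.sum_insert hi, ← h]
    refine D.isCovariantDerivativeOn.add (hX i) ?_ (mem_univ y)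
    have := MDifferentiableAt.sum_section (s := s) fun i _ => hX i
    simpa only [Finset.sum_apply] using this

/-- The covariant derivative in coordinates: `∇_u X = dX(u) + Γ(u ⊗ X)`. -/
theorem coordVec_covariantDerivative (hy : y ∈ (chartAt (EuclideanSpace ℝ (Fin n)) x₀).source)
    {X : (y : N) → TangentSpace (𝓡 n) y}
    {g : EuclideanSpace ℝ (Fin n) → EuclideanSpace ℝ (Fin n)}
    (hg : DifferentiableAt ℝ g (extChartAt (𝓡 n) x₀ y))
    (hX : X =ᶠ[𝓝 y] fun q => coordField x₀ (g (extChartAt (𝓡 n) x₀ q)) q)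
    (u : TangentSpace (𝓡 n) y) :
    coordVec x₀ y (D X y u) = fderiv ℝ g (extChartAt (𝓡 n) x₀ y) (coordVec x₀ y u)
      + connector D x₀ y (coordVec x₀ y u) (g (extChartAt (𝓡 n) x₀ y)) := by
  set p := extChartAt (𝓡 n) x₀ y with hp
  have hM : IsManifold (𝓡 n) 1 N := IsManifold.of_le (m := 1) (n := ∞) (by simp)
  -- write `X` as a combination of coordinate fields with variable coefficients, and use the
  -- Leibniz rule
  set f : Fin n → N → ℝ := fun i q => g (extChartAt (𝓡 n) x₀ q) i with hf
  set e : Fin n → EuclideanSpace ℝ (Fin n) := fun i => EuclideanSpace.single i 1 with he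
  have hφ := (mdifferentiableAt_extChartAt (I := 𝓡 n) hy).hasMFDerivAt
  have hfd (i : Fin n) : HasMFDerivAt (𝓡 n) 𝓘(ℝ, ℝ) (f i) y
      (((EuclideanSpace.proj i : EuclideanSpace ℝ (Fin n) →L[ℝ] ℝ).comp (fderiv ℝ g p)).comp
        (mfderiv (𝓡 n) 𝓘(ℝ, EuclideanSpace ℝ (Fin n)) (extChartAt (𝓡 n) x₀) y)) :=
    HasMFDerivAt.comp y (((EuclideanSpace.proj i :
      EuclideanSpace ℝ (Fin n) →L[ℝ] ℝ).hasFDerivAt.comp p hg.hasFDerivAt).hasMFDerivAt) hφ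
  have hfd' (i : Fin n) (u : TangentSpace (𝓡 n) y) : mvfderiv (𝓡 n) (f i) y u =
      fderiv ℝ g p (coordVec x₀ y u) i := by
    rw [coordVec_eq_mfderiv hy]
    exact congrArg (fun L => L u) (hfd i).mfderiv
  set S : Fin n → (q : N) → TangentSpace (𝓡 n) q := fun i => f i • coordField x₀ (e i) with hS
  have hs (i : Fin n) : MDifferentiableAt (𝓡 n) (𝓡 n).tangent
      (fun q => (⟨q, S i q⟩ : TangentBundle (𝓡 n) N)) y :=
    (hfd i).mdifferentiableAt.smul_section (mdifferentiableAt_coordField hy _)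
  have hX' : (∑ i, S i) =ᶠ[𝓝 y] X := by
    filter_upwards [hX, (chartAt (EuclideanSpace ℝ (Fin n)) x₀).open_source.mem_nhds hy]
      with q hq hqO
    rw [hq]
    apply coordVec_injective hqO
    have hq' : (∑ i, S i : (q : N) → TangentSpace (𝓡 n) q) q = ∑ i, S i q :=
      Finset.sum_apply q _ S
    refine (congrArg (coordVec x₀ q) hq').trans ?_
    rw [coordVec_sum hqO, coordVec_coordField hqO,
      ← euclidean_sum_single (g (extChartAt (𝓡 n) x₀ q))]
    refine Finset.sum_congr rfl fun i _ => ?_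
    refine (coordVec_smul hqO _ _).trans ?_
    rw [coordVec_coordField hqO]
  have hs' : MDifferentiableAt (𝓡 n) (𝓡 n).tangent
      (fun q => (⟨q, (∑ i, S i) q⟩ : TangentBundle (𝓡 n) N)) y := by
    have := MDifferentiableAt.sum_section (s := Finset.univ) fun i _ => hs i
    simpa only [Finset.sum_apply] using this
  have hD : D X y u = ∑ i, (f i y • D (coordField x₀ (e i)) y u
      + (fderiv ℝ g p (coordVec x₀ y u) i) • coordField x₀ (e i) y) := by
    rw [← covariantDerivative_congr_of_eventuallyEq D hs' hX', covariantDerivative_sum D _ hs,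
      sum_apply]
    refine Finset.sum_congr rfl fun i _ => ?_
    rw [D.isCovariantDerivativeOn.leibniz (mdifferentiableAt_coordField hy _)
      (hfd i).mdifferentiableAt (mem_univ y), ← hfd']
    rfl
  have hc (i : Fin n) : coordVec x₀ y (D (coordField x₀ (e i)) y u)
      = connector D x₀ y (coordVec x₀ y u) (e i) := by
    rw [connector, coordField_coordVec hy, coordVec]
  set B : EuclideanSpace ℝ (Fin n) →ₗ[ℝ] EuclideanSpace ℝ (Fin n) :=
    { toFun := connector D x₀ y (coordVec x₀ y u)
      map_add' := connector_add_right D hy _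
      map_smul' := fun r w => connector_smul_right D hy r _ w } with hB
  have hsum : connector D x₀ y (coordVec x₀ y u) (g p) = ∑ i, g p i • B (e i) := by
    change B (g p) = _
    conv_lhs => rw [← euclidean_sum_single (g p)]
    simp only [map_sum, map_smul, he]
  rw [hD, hsum, coordVec_sum hy]
  simp only [coordVec_add hy, coordVec_smul hy, hc, coordVec_coordField hy, Finset.sum_add_distrib]
  rw [euclidean_sum_single, add_comm]
  rfl

/-- The local connector in the chart at `x₀`, as a function of the coordinates of the base point
with values in the bilinear maps. -/
def coordConnector (x₀ : N) (q : EuclideanSpace ℝ (Fin n)) :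
    EuclideanSpace ℝ (Fin n) →L[ℝ] EuclideanSpace ℝ (Fin n) →L[ℝ] EuclideanSpace ℝ (Fin n) :=
  ∑ i, ∑ j, (EuclideanSpace.proj i : EuclideanSpace ℝ (Fin n) →L[ℝ] ℝ).smulRight
    ((EuclideanSpace.proj j : EuclideanSpace ℝ (Fin n) →L[ℝ] ℝ).smulRight
      (connector D x₀ ((extChartAt (𝓡 n) x₀).symm q)
        (EuclideanSpace.single i 1) (EuclideanSpace.single j 1)))

theorem coordConnector_apply {q : EuclideanSpace ℝ (Fin n)}
    (hq : q ∈ (extChartAt (𝓡 n) x₀).target) (v w : EuclideanSpace ℝ (Fin n)) :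
    coordConnector D x₀ q v w = connector D x₀ ((extChartAt (𝓡 n) x₀).symm q) v w := by
  have hy : (extChartAt (𝓡 n) x₀).symm q ∈ (chartAt (EuclideanSpace ℝ (Fin n)) x₀).source := by
    simpa using (extChartAt (𝓡 n) x₀).map_target hq
  set B : EuclideanSpace ℝ (Fin n) →ₗ[ℝ] EuclideanSpace ℝ (Fin n) →ₗ[ℝ] EuclideanSpace ℝ (Fin n) :=
    LinearMap.mk₂ ℝ (connector D x₀ ((extChartAt (𝓡 n) x₀).symm q))
      (connector_add_left D hy) (connector_smul_left D hy) (connector_add_right D hy)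
      (connector_smul_right D hy) with hB
  have h : B v w = ∑ i, ∑ j, v i • w j • B (EuclideanSpace.single i 1)
      (EuclideanSpace.single j 1) := by
    conv_lhs => rw [← euclidean_sum_single v, ← euclidean_sum_single w]
    simp only [map_sum, map_smul, LinearMap.sum_apply, LinearMap.smul_apply, Finset.smul_sum]
    rw [Finset.sum_comm]
    exact Finset.sum_congr rfl fun i _ => Finset.sum_congr rfl fun j _ => smul_comm _ _ _
  simpa [coordConnector, sum_apply, hB] using h.symm

theorem contDiffAt_coordConnector [T2Space N] [D.ContMDiffCovariantDerivative ∞]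
    {q : EuclideanSpace ℝ (Fin n)} (hq : q ∈ (extChartAt (𝓡 n) x₀).target) :
    ContDiffAt ℝ ∞ (coordConnector D x₀) q := by
  have hy : (extChartAt (𝓡 n) x₀).symm q ∈ (chartAt (EuclideanSpace ℝ (Fin n)) x₀).source := by
    simpa using (extChartAt (𝓡 n) x₀).map_target hq
  have h (v w : EuclideanSpace ℝ (Fin n)) : ContDiffAt ℝ ∞
      (fun q => connector D x₀ ((extChartAt (𝓡 n) x₀).symm q) v w) q :=
    contMDiffAt_iff_contDiffAt.1 ((contMDiffAt_connector D hy v w).comp q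
      ((contMDiffOn_extChartAt_symm (I := 𝓡 n) (n := ∞) x₀).contMDiffAt
        ((isOpen_extChartAt_target x₀).mem_nhds hq)))
  refine ContDiffAt.sum fun i _ => ContDiffAt.sum fun j _ => ?_
  exact (ContinuousLinearMap.smulRightL ℝ (EuclideanSpace ℝ (Fin n)) _ _).contDiff.contDiffAt.comp q
    ((ContinuousLinearMap.smulRightL ℝ (EuclideanSpace ℝ (Fin n)) _ _).contDiff.contDiffAt.comp q
      (h _ _))

theorem coordConnector_symm (hD : D.torsion = 0) {q : EuclideanSpace ℝ (Fin n)}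
    (hq : q ∈ (extChartAt (𝓡 n) x₀).target) (v w : EuclideanSpace ℝ (Fin n)) :
    coordConnector D x₀ q v w = coordConnector D x₀ q w v := by
  have hy : (extChartAt (𝓡 n) x₀).symm q ∈ (chartAt (EuclideanSpace ℝ (Fin n)) x₀).source := by
    simpa using (extChartAt (𝓡 n) x₀).map_target hq
  rw [coordConnector_apply D hq, coordConnector_apply D hq, connector_symm D hD hy]

end Coordinates

/-! ### Curvature and geodesics in a chart -/

section Geodesics

variable {n : ℕ} {N : Type*} [TopologicalSpace N] [ChartedSpace (EuclideanSpace ℝ (Fin n)) N]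
  [IsManifold (𝓡 n) ∞ N]
  (D : CovariantDerivative (𝓡 n) (EuclideanSpace ℝ (Fin n)) (TangentSpace (𝓡 n) : N → Type _))
  {x₀ y : N}

/-- In the chart at `x`, the curvature at `x` is the classical expression in the connector. -/
theorem coordVec_curvature [T2Space N] [D.ContMDiffCovariantDerivative ∞] (x : N)
    (u v w : TangentSpace (𝓡 n) x) :
    coordVec x x (curvature D x u v w) = localCurvature (coordConnector D x)
      (extChartAt (𝓡 n) x x) (coordVec x x u) (coordVec x x v) (coordVec x x w) := by
  have hx := mem_chart_source (EuclideanSpace ℝ (Fin n)) x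
  set p := extChartAt (𝓡 n) x x with hp
  have hpt : p ∈ (extChartAt (𝓡 n) x).target := mem_extChartAt_target x
  have hΓ : DifferentiableAt ℝ (coordConnector D x) p :=
    (contDiffAt_coordConnector D hpt).differentiableAt (by simp)
  have hd (a b : EuclideanSpace ℝ (Fin n)) : HasFDerivAt (fun q => coordConnector D x q a b)
      (((fderiv ℝ (coordConnector D x) p).flip a).flip b) p := by
    simpa using (hΓ.hasFDerivAt.clm_apply (hasFDerivAt_const a p)).clm_apply (hasFDerivAt_const b p)
  have key (a b : EuclideanSpace ℝ (Fin n)) (v : TangentSpace (𝓡 n) x) :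
      coordVec x x (D (fun q => D (coordField x b) q (coordField x a q)) x v)
        = fderiv ℝ (coordConnector D x) p (coordVec x x v) a b
          + coordConnector D x p (coordVec x x v) (coordConnector D x p a b) := by
    rw [coordVec_covariantDerivative D (g := fun q => coordConnector D x q a b) hx
      (hd a b).differentiableAt ?_ v, (hd a b).fderiv, coordConnector_apply D hpt _
      (coordConnector D x p a b), hp, extChartAt_to_inv]
    · rfl
    · filter_upwards [(chartAt (EuclideanSpace ℝ (Fin n)) x).open_source.mem_nhds hx] with q hq
      rw [coordConnector_apply D ((extChartAt (𝓡 n) x).map_source (by simpa using hq)),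
        (extChartAt (𝓡 n) x).left_inv (by simpa using hq)]
      exact (coordField_coordVec hq _).symm
  rw [curvature, curvatureField]
  simp only [extend_eq_coordField]
  rw [mlieBracket_coordField hx, map_zero, add_zero, coordVec_sub hx, key, key,
    coordField_coordVec hx, coordField_coordVec hx, localCurvature]
  abel

/-- The coordinates of the velocity of a curve are the derivative of its coordinates. -/
theorem coordVec_velocity {c : ℝ → N} {t : ℝ} (hc : MDifferentiableAt 𝓘(ℝ, ℝ) (𝓡 n) c t)
    (ht : c t ∈ (chartAt (EuclideanSpace ℝ (Fin n)) x₀).source) :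
    coordVec x₀ (c t) (mfderiv 𝓘(ℝ, ℝ) (𝓡 n) c t (1 : ℝ))
      = deriv (fun r => extChartAt (𝓡 n) x₀ (c r)) t := by
  have hM : IsManifold (𝓡 n) 1 N := IsManifold.of_le (m := 1) (n := ∞) (by simp)
  have h := (mdifferentiableAt_extChartAt (I := 𝓡 n) ht).hasMFDerivAt.comp t hc.hasMFDerivAt
  rw [coordVec_eq_mfderiv ht]
  set L : ℝ →L[ℝ] EuclideanSpace ℝ (Fin n) :=
    (mfderiv (𝓡 n) 𝓘(ℝ, EuclideanSpace ℝ (Fin n)) (extChartAt (𝓡 n) x₀) (c t)).comp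
      (mfderiv 𝓘(ℝ, ℝ) (𝓡 n) c t)
  have h' : HasFDerivAt (fun r => extChartAt (𝓡 n) x₀ (c r)) L t := hasMFDerivAt_iff_hasFDerivAt.1 h
  exact h'.hasDerivAt.deriv.symm

/-- A tangent vector, as a point of the tangent bundle, is given by its base point and its
coordinates. -/
theorem totalSpace_eq_iff (hy : y ∈ (chartAt (EuclideanSpace ℝ (Fin n)) x₀).source) {q : N}
    {v : TangentSpace (𝓡 n) y} {w : TangentSpace (𝓡 n) q} :
    (⟨q, w⟩ : TangentBundle (𝓡 n) N) = ⟨y, v⟩ ↔ q = y ∧ coordVec x₀ q w = coordVec x₀ y v := by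
  constructor
  · intro h
    exact ⟨congrArg TotalSpace.proj h, congrArg (fun p : TangentBundle (𝓡 n) N =>
      (trivializationAt (EuclideanSpace ℝ (Fin n)) (TangentSpace (𝓡 n) : N → Type _) x₀ p).2) h⟩
  · rintro ⟨rfl, h⟩
    rw [coordVec_injective hy h]

theorem IsGeodesicOn.comp_affine {c : ℝ → N} {s : Set ℝ} (hc : IsGeodesicOn D c s) (a b : ℝ)
    {s' : Set ℝ} (hs : MapsTo (fun r => a + b * r) s' s) :
    IsGeodesicOn D (fun r => c (a + b * r)) s' where
  contMDiffAt t ht := by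
    refine (hc.contMDiffAt _ (hs ht)).comp t ?_
    have : ContDiff ℝ 2 fun r : ℝ => a + b * r := by fun_prop
    exact this.contDiffAt.contMDiffAt
  equation t ht x₀ hx₀ := by
    have h (f : ℝ → EuclideanSpace ℝ (Fin n)) :
        deriv (fun r => f (a + b * r)) = fun r => b • deriv f (a + b * r) := by
      funext r
      rw [deriv_comp_mul_left b (fun r => f (a + r)), deriv_comp_const_add]
    have h1 := hc.equation _ (hs ht) x₀ hx₀
    rw [h (fun r => extChartAt (𝓡 n) x₀ (c r)), deriv_fun_const_smul_field,
      h (deriv fun r => extChartAt (𝓡 n) x₀ (c r))]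
    dsimp only
    rw [connector_smul_left D hx₀, connector_smul_right D hx₀, ← smul_add, ← smul_add, h1,
      smul_zero, smul_zero]

/-- The piece of a geodesic between two of its times, run in time `1`. -/
theorem IsGeodesicOn.geodesicArc {c : ℝ → N} (hc : IsGeodesicOn D c (Icc 0 1)) {U : Set N}
    (hU : MapsTo c (Icc 0 1) U) {s₀ s₁ : ℝ} (h₀ : s₀ ∈ Icc (0 : ℝ) 1) (h₁ : s₁ ∈ Icc (0 : ℝ) 1) :
    GeodesicArc D U (c s₀) ((s₁ - s₀) • mfderiv 𝓘(ℝ, ℝ) (𝓡 n) c s₀ (1 : ℝ)) (c s₁) := by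
  have hm : MapsTo (fun r : ℝ => s₀ + (s₁ - s₀) * r) (Icc 0 1) (Icc 0 1) := by
    intro r hr
    obtain ⟨h1, h2⟩ := hr
    obtain ⟨h3, h4⟩ := h₀
    obtain ⟨h5, h6⟩ := h₁
    constructor <;> nlinarith
  have hg := hc.comp_affine D s₀ (s₁ - s₀) hm
  refine ⟨_, hg, hU.comp hm, ?_, by simp⟩
  have hy := mem_chart_source (EuclideanSpace ℝ (Fin n)) (c s₀)
  rw [totalSpace_eq_iff hy, coordVec_smul hy]
  refine ⟨by simp, ?_⟩
  rw [coordVec_velocity ((hg.contMDiffAt 0 (by simp)).mdifferentiableAt (by simp)) (by simp),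
    coordVec_velocity ((hc.contMDiffAt s₀ h₀).mdifferentiableAt (by simp)) hy,
    deriv_comp_mul_left (s₁ - s₀) (fun r => extChartAt (𝓡 n) (c s₀) (c (s₀ + r))),
    deriv_comp_const_add (f := fun r => extChartAt (𝓡 n) (c s₀) (c r))]
  simp

end Geodesics

/-! ### Uniqueness of geodesics -/

section ODE

variable {E : Type*} [NormedAddCommGroup E] [NormedSpace ℝ E]

theorem contDiffAt_deriv_of_two {f : ℝ → E} {t : ℝ} (hf : ContDiffAt ℝ 2 f t) :
    ContDiffAt ℝ 1 (deriv f) t :=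
  (hf.fderiv_right (m := 1) (by norm_num)).clm_apply contDiffAt_const

/-- Local uniqueness for the geodesic equation `f'' = -Γ(f)(f', f')` in a vector space. -/
theorem eventually_eq_of_geodesic_equation {Γ : E → E →L[ℝ] E →L[ℝ] E} {f g : ℝ → E} {t : ℝ}
    (hΓ : ContDiffAt ℝ 1 Γ (f t)) (hf : ContDiffAt ℝ 2 f t) (hg : ContDiffAt ℝ 2 g t)
    (hfe : ∀ᶠ s in 𝓝[≥] t, deriv (deriv f) s = -Γ (f s) (deriv f s) (deriv f s))
    (hge : ∀ᶠ s in 𝓝[≥] t, deriv (deriv g) s = -Γ (g s) (deriv g s) (deriv g s))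
    (h₀ : f t = g t) (h₁ : deriv f t = deriv g t) :
    ∀ᶠ s in 𝓝[≥] t, f s = g s ∧ deriv f s = deriv g s := by
  set V : E × E → E × E := fun w => (w.2, -Γ w.1 w.2 w.2) with hV
  have hVd : ContDiffAt ℝ 1 V (f t, deriv f t) := by
    have h1 : ContDiffAt ℝ 1 (fun w : E × E => Γ w.1) (f t, deriv f t) :=
      ContDiffAt.comp (f t, deriv f t) (g := Γ) hΓ contDiffAt_fst
    exact contDiffAt_snd.prodMk ((h1.clm_apply contDiffAt_snd).clm_apply contDiffAt_snd).neg
  obtain ⟨K, S, hS, hK⟩ := hVd.exists_lipschitzOnWith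
  have key {f : ℝ → E} (hf : ContDiffAt ℝ 2 f t) (hS : S ∈ 𝓝 (f t, deriv f t))
      (hfe : ∀ᶠ s in 𝓝[≥] t, deriv (deriv f) s = -Γ (f s) (deriv f s) (deriv f s)) :
      ∀ᶠ s in 𝓝[≥] t, HasDerivAt (fun s => (f s, deriv f s)) (V (f s, deriv f s)) s
        ∧ (f s, deriv f s) ∈ S := by
    have hcont : ContinuousAt (fun s => (f s, deriv f s)) t :=
      hf.continuousAt.prodMk (contDiffAt_deriv_of_two hf).continuousAt
    filter_upwards [hfe, nhdsWithin_le_nhds (hf.eventually (by simp)),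
      nhdsWithin_le_nhds (hcont hS)] with s h1 h2 h3
    refine ⟨?_, h3⟩
    rw [show V (f s, deriv f s) = (deriv f s, deriv (deriv f) s) by rw [h1]]
    exact (h2.differentiableAt (by simp)).hasDerivAt.prodMk
      ((contDiffAt_deriv_of_two h2).differentiableAt (by simp)).hasDerivAt
  obtain ⟨u, hu, hsub⟩ := mem_nhdsGE_iff_exists_Icc_subset.1
    ((key hf hS hfe).and (key hg (h₀ ▸ h₁ ▸ hS) hge))
  have heq := ODE_solution_unique_of_mem_Icc_right (v := fun _ => V) (s := fun _ => S)
    (K := K) (a := t) (b := u) (f := fun s => (f s, deriv f s)) (g := fun s => (g s, deriv g s))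
    (fun _ _ => hK)
    (fun s hs => (hsub hs).1.1.continuousAt.continuousWithinAt)
    (fun s hs => (hsub (Ico_subset_Icc_self hs)).1.1.hasDerivWithinAt)
    (fun s hs => (hsub (Ico_subset_Icc_self hs)).1.2)
    (fun s hs => (hsub hs).2.1.continuousAt.continuousWithinAt)
    (fun s hs => (hsub (Ico_subset_Icc_self hs)).2.1.hasDerivWithinAt)
    (fun s hs => (hsub (Ico_subset_Icc_self hs)).2.2) (by simp [h₀, h₁])
  filter_upwards [Icc_mem_nhdsGE hu] with s hs
  exact Prod.ext_iff.1 (heq hs)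

end ODE

section Geodesics

variable {n : ℕ} {N : Type*} [TopologicalSpace N] [ChartedSpace (EuclideanSpace ℝ (Fin n)) N]
  [IsManifold (𝓡 n) ∞ N]
  {D : CovariantDerivative (𝓡 n) (EuclideanSpace ℝ (Fin n)) (TangentSpace (𝓡 n) : N → Type _)}
  {x₀ y : N} {c c' : ℝ → N} {s : Set ℝ}

theorem IsGeodesicOn.contDiffAt_coord (hc : IsGeodesicOn D c s) {t : ℝ} (ht : t ∈ s)
    (hx : c t ∈ (chartAt (EuclideanSpace ℝ (Fin n)) x₀).source) :
    ContDiffAt ℝ 2 (fun r => extChartAt (𝓡 n) x₀ (c r)) t := by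
  have : IsManifold (𝓡 n) 2 N := IsManifold.of_le (m := 2) (n := ∞) two_le_infty
  exact contMDiffAt_iff_contDiffAt.1 ((contMDiffAt_extChartAt' hx).comp t (hc.contMDiffAt t ht))

theorem IsGeodesicOn.equation_coordConnector (hc : IsGeodesicOn D c s) {t : ℝ} (ht : t ∈ s)
    (hx : c t ∈ (chartAt (EuclideanSpace ℝ (Fin n)) x₀).source) :
    deriv (deriv fun r => extChartAt (𝓡 n) x₀ (c r)) t =
      -coordConnector D x₀ (extChartAt (𝓡 n) x₀ (c t))
        (deriv (fun r => extChartAt (𝓡 n) x₀ (c r)) t)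
        (deriv (fun r => extChartAt (𝓡 n) x₀ (c r)) t) := by
  have hx' : c t ∈ (extChartAt (𝓡 n) x₀).source := by simpa using hx
  rw [coordConnector_apply D ((extChartAt (𝓡 n) x₀).map_source hx'),
    (extChartAt (𝓡 n) x₀).left_inv hx', eq_neg_iff_add_eq_zero]
  exact hc.equation t ht x₀ hx

theorem IsGeodesicOn.velocity_eq_iff (hc : IsGeodesicOn D c s) (hc' : IsGeodesicOn D c' s) {t : ℝ}
    (ht : t ∈ s) (hx : c' t ∈ (chartAt (EuclideanSpace ℝ (Fin n)) x₀).source) :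
    (⟨c t, mfderiv 𝓘(ℝ, ℝ) (𝓡 n) c t (1 : ℝ)⟩ : TangentBundle (𝓡 n) N)
      = ⟨c' t, mfderiv 𝓘(ℝ, ℝ) (𝓡 n) c' t (1 : ℝ)⟩ ↔ c t = c' t ∧
      deriv (fun r => extChartAt (𝓡 n) x₀ (c r)) t
        = deriv (fun r => extChartAt (𝓡 n) x₀ (c' r)) t := by
  rw [totalSpace_eq_iff hx]
  refine and_congr_right fun h => ?_
  rw [coordVec_velocity ((hc.contMDiffAt t ht).mdifferentiableAt (by simp)) (h ▸ hx),
    coordVec_velocity ((hc'.contMDiffAt t ht).mdifferentiableAt (by simp)) hx]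

/-- Geodesics with the same initial velocity coincide. -/
theorem IsGeodesicOn.eq_of_velocity_eq [T2Space N] [D.ContMDiffCovariantDerivative ∞]
    (hc : IsGeodesicOn D c (Icc 0 1)) (hc' : IsGeodesicOn D c' (Icc 0 1))
    (h : (⟨c 0, mfderiv 𝓘(ℝ, ℝ) (𝓡 n) c 0 (1 : ℝ)⟩ : TangentBundle (𝓡 n) N)
      = ⟨c' 0, mfderiv 𝓘(ℝ, ℝ) (𝓡 n) c' 0 (1 : ℝ)⟩) {t : ℝ} (ht : t ∈ Icc (0 : ℝ) 1) :
    c t = c' t := by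
  set A : Set ℝ := {t | (⟨c t, mfderiv 𝓘(ℝ, ℝ) (𝓡 n) c t (1 : ℝ)⟩ : TangentBundle (𝓡 n) N)
    = ⟨c' t, mfderiv 𝓘(ℝ, ℝ) (𝓡 n) c' t (1 : ℝ)⟩} with hA
  -- the set of times at which the velocities agree is closed, and open to the right by the
  -- uniqueness theorem for the geodesic equation
  have hsub : Icc (0 : ℝ) 1 ⊆ A := by
    refine IsClosed.Icc_subset_of_forall_exists_gt ?_ h ?_
    · rw [← closure_subset_iff_isClosed]
      intro t ht
      have htI : t ∈ Icc (0 : ℝ) 1 :=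
        closure_minimal inter_subset_right isClosed_Icc ht
      have hne : (𝓝[A ∩ Icc 0 1] t).NeBot := mem_closure_iff_nhdsWithin_neBot.1 ht
      have hx := mem_chart_source (EuclideanSpace ℝ (Fin n)) (c' t)
      have hO := (chartAt (EuclideanSpace ℝ (Fin n)) (c' t)).open_source.mem_nhds hx
      have hct : c t = c' t := by
        refine tendsto_nhds_unique_of_eventuallyEq (l := 𝓝[A ∩ Icc 0 1] t)
          ((hc.contMDiffAt t htI).continuousAt.tendsto.mono_left nhdsWithin_le_nhds)
          ((hc'.contMDiffAt t htI).continuousAt.tendsto.mono_left nhdsWithin_le_nhds) ?_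
        filter_upwards [self_mem_nhdsWithin] with r hr
        exact congrArg TotalSpace.proj hr.1
      refine ⟨(hc.velocity_eq_iff hc' htI hx).2 ⟨hct, ?_⟩, htI⟩
      refine tendsto_nhds_unique_of_eventuallyEq (l := 𝓝[A ∩ Icc 0 1] t)
        ((contDiffAt_deriv_of_two (hc.contDiffAt_coord htI
          (hct ▸ hx))).continuousAt.tendsto.mono_left nhdsWithin_le_nhds)
        ((contDiffAt_deriv_of_two (hc'.contDiffAt_coord htI
          hx)).continuousAt.tendsto.mono_left nhdsWithin_le_nhds) ?_
      filter_upwards [self_mem_nhdsWithin,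
        nhdsWithin_le_nhds ((hc'.contMDiffAt t htI).continuousAt hO)] with r hr hrO
      exact ((hc.velocity_eq_iff hc' hr.2 hrO).1 hr.1).2
    · rintro t ⟨htA, ht0, ht1⟩ u hu
      have htI : t ∈ Icc (0 : ℝ) 1 := ⟨ht0, ht1.le⟩
      have hx := mem_chart_source (EuclideanSpace ℝ (Fin n)) (c' t)
      have hO := (chartAt (EuclideanSpace ℝ (Fin n)) (c' t)).open_source.mem_nhds hx
      obtain ⟨hct, hdt⟩ := (hc.velocity_eq_iff hc' htI hx).1 htA
      have hev {c : ℝ → N} (hc : IsGeodesicOn D c (Icc 0 1)) (hct : c t = c' t) :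
          ∀ᶠ r in 𝓝[≥] t, r ∈ Icc (0 : ℝ) 1 ∧
            c r ∈ (chartAt (EuclideanSpace ℝ (Fin n)) (c' t)).source := by
        filter_upwards [Icc_mem_nhdsGE ht1,
          nhdsWithin_le_nhds ((hc.contMDiffAt t htI).continuousAt (by rw [hct]; exact hO))]
          with r hr hrO
        exact ⟨⟨ht0.trans hr.1, hr.2⟩, hrO⟩
      have hu' := eventually_eq_of_geodesic_equation (Γ := coordConnector D (c' t))
        (f := fun r => extChartAt (𝓡 n) (c' t) (c r))
        (g := fun r => extChartAt (𝓡 n) (c' t) (c' r)) (t := t)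
        ((contDiffAt_coordConnector D (by rw [hct]; exact mem_extChartAt_target _)).of_le (by simp))
        (hc.contDiffAt_coord htI (hct ▸ hx)) (hc'.contDiffAt_coord htI hx)
        ((hev hc hct).mono fun r hr => hc.equation_coordConnector hr.1 hr.2)
        ((hev hc' rfl).mono fun r hr => hc'.equation_coordConnector hr.1 hr.2)
        (by rw [hct]) hdt
      have hlt : ∀ᶠ r in 𝓝[>] t, r ∈ Ioc t u := Ioc_mem_nhdsGT hu
      have hall := (hu'.and ((hev hc hct).and (hev hc' rfl))).filter_mono
        (nhdsWithin_mono t Ioi_subset_Ici_self)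
      obtain ⟨r, ⟨⟨hr1, hr2⟩, hr3, hr4⟩, hr5⟩ := (hall.and hlt).exists
      refine ⟨r, (hc.velocity_eq_iff hc' hr3.1 hr4.2).2 ⟨?_, hr2⟩, hr5⟩
      exact (extChartAt (𝓡 n) (c' t)).injOn (by simpa using hr3.2) (by simpa using hr4.2) hr1
  exact congrArg TotalSpace.proj (hsub ht)

variable {U : Set N} {v : TangentSpace (𝓡 n) y} {p q : N}

theorem GeodesicArc.mono {V : Set N} (h : GeodesicArc D U y v p) (hUV : U ⊆ V) :
    GeodesicArc D V y v p := by
  obtain ⟨c, hc, hm, h0, h1⟩ := h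
  exact ⟨c, hc, hm.mono_right hUV, h0, h1⟩

theorem GeodesicArc.endpoint_unique [T2Space N] [D.ContMDiffCovariantDerivative ∞] {V : Set N}
    (h : GeodesicArc D U y v p) (h' : GeodesicArc D V y v q) : p = q := by
  obtain ⟨c, hc, -, h0, rfl⟩ := h
  obtain ⟨c', hc', -, h0', rfl⟩ := h'
  exact hc.eq_of_velocity_eq hc' (h0.trans h0'.symm) (by simp)

theorem GeodesicArc.left_mem (h : GeodesicArc D U y v p) : y ∈ U := by
  obtain ⟨c, hc, hm, h0, -⟩ := h
  rw [← show c 0 = y from congrArg TotalSpace.proj h0]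
  exact hm (by simp)

theorem GeodesicArc.right_mem (h : GeodesicArc D U y v p) : p ∈ U := by
  obtain ⟨c, hc, hm, -, rfl⟩ := h
  exact hm (by simp)

theorem expMap_eq [T2Space N] [D.ContMDiffCovariantDerivative ∞] (h : GeodesicArc D univ y v p) :
    expMap D y v = p := by
  have h' : ∃ p, GeodesicArc D univ y v p := ⟨p, h⟩
  rw [expMap, dif_pos h']
  exact h'.choose_spec.endpoint_unique h

theorem IsGeodesicallyConvex.geodesicArc_expInv (hU : IsGeodesicallyConvex D U) (hy : y ∈ U)
    (hp : p ∈ U) : GeodesicArc D U y (expInv D U y p) p := by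
  have h' : ∃ v, GeodesicArc D U y v p := (hU.existsUnique y hy p hp).exists
  rw [expInv, dif_pos h']
  exact h'.choose_spec

theorem IsGeodesicallyConvex.expInv_eq (hU : IsGeodesicallyConvex D U)
    (h : GeodesicArc D U y v p) : expInv D U y p = v :=
  (hU.existsUnique y h.left_mem p h.right_mem).unique
    (hU.geodesicArc_expInv h.left_mem h.right_mem) h

theorem IsGeodesicallyConvex.expInv_injOn [T2Space N] [D.ContMDiffCovariantDerivative ∞]
    (hU : IsGeodesicallyConvex D U) (hy : y ∈ U) :
    InjOn (fun p => expInv D U y p) U := by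
  intro p hp q hq h
  have h1 := hU.geodesicArc_expInv hy hp
  rw [show expInv D U y p = expInv D U y q from h] at h1
  exact h1.endpoint_unique (hU.geodesicArc_expInv hy hq)

end Geodesics

/-! ### The inverse exponential map of a geodesically convex set -/

section Geodesics

variable {n : ℕ} {N : Type*} [TopologicalSpace N] [ChartedSpace (EuclideanSpace ℝ (Fin n)) N]

/-- The coordinates, in the chart at `x`, of the points of `U` in the domain of that chart. -/
def chartDomain (x : N) (U : Set N) : Set (EuclideanSpace ℝ (Fin n)) :=
  (extChartAt (𝓡 n) x).target ∩ (extChartAt (𝓡 n) x).symm ⁻¹' U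

variable {U : Set N} {x : N}

theorem symm_mem_source_of_mem_chartDomain {q : EuclideanSpace ℝ (Fin n)}
    (hq : q ∈ chartDomain x U) :
    (extChartAt (𝓡 n) x).symm q ∈ (chartAt (EuclideanSpace ℝ (Fin n)) x).source := by
  simpa using (extChartAt (𝓡 n) x).map_target hq.1

theorem extChartAt_mem_chartDomain {y : N}
    (hy : y ∈ (chartAt (EuclideanSpace ℝ (Fin n)) x).source) (hyU : y ∈ U) :
    extChartAt (𝓡 n) x y ∈ chartDomain x U := by
  have hy' : y ∈ (extChartAt (𝓡 n) x).source := by simpa using hy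
  refine ⟨(extChartAt (𝓡 n) x).map_source hy', ?_⟩
  rw [mem_preimage, (extChartAt (𝓡 n) x).left_inv hy']
  exact hyU

theorem isOpen_chartDomain (hU : IsOpen U) : IsOpen (chartDomain (n := n) x U) :=
  (continuousOn_extChartAt_symm x).isOpen_inter_preimage (isOpen_extChartAt_target x) hU

variable [IsManifold (𝓡 n) ∞ N]

/-- The inverse exponential map in the coordinates of the chart at `x`. -/
def coordExpInv
    (D : CovariantDerivative (𝓡 n) (EuclideanSpace ℝ (Fin n)) (TangentSpace (𝓡 n) : N → Type _))
    (U : Set N) (x : N) (q p : EuclideanSpace ℝ (Fin n)) : EuclideanSpace ℝ (Fin n) :=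
  coordVec x ((extChartAt (𝓡 n) x).symm q)
    (expInv D U ((extChartAt (𝓡 n) x).symm q) ((extChartAt (𝓡 n) x).symm p))

variable
  {D : CovariantDerivative (𝓡 n) (EuclideanSpace ℝ (Fin n)) (TangentSpace (𝓡 n) : N → Type _)}

theorem coordExpInv_self (p : EuclideanSpace ℝ (Fin n)) :
    coordExpInv D U x (extChartAt (𝓡 n) x x) p
      = coordVec x x (expInv D U x ((extChartAt (𝓡 n) x).symm p)) := by
  rw [coordExpInv, extChartAt_to_inv]

theorem IsGeodesicallyConvex.contDiffOn_coordExpInv (hU : IsGeodesicallyConvex D U) :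
    ContDiffOn ℝ ∞ (fun q : EuclideanSpace ℝ (Fin n) × EuclideanSpace ℝ (Fin n) =>
      coordExpInv D U x q.1 q.2) (chartDomain x U ×ˢ chartDomain x U) := by
  rintro ⟨q, p⟩ ⟨hq, hp⟩
  refine ContDiffAt.contDiffWithinAt ?_
  have hs {r : EuclideanSpace ℝ (Fin n)} (hr : r ∈ chartDomain x U) :=
    (contMDiffOn_extChartAt_symm (I := 𝓡 n) (n := ∞) x).contMDiffAt
      ((isOpen_extChartAt_target x).mem_nhds hr.1)
  have h1 : ContMDiffAt 𝓘(ℝ, EuclideanSpace ℝ (Fin n) × EuclideanSpace ℝ (Fin n))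
      ((𝓡 n).prod (𝓡 n)) ∞ (fun r : EuclideanSpace ℝ (Fin n) × EuclideanSpace ℝ (Fin n) =>
        ((extChartAt (𝓡 n) x).symm r.1, (extChartAt (𝓡 n) x).symm r.2)) (q, p) :=
    (ContMDiffAt.comp (q, p) (hs hq) contDiff_fst.contDiffAt.contMDiffAt).prodMk
      (ContMDiffAt.comp (q, p) (hs hp) contDiff_snd.contDiffAt.contMDiffAt)
  have h2 := ContMDiffAt.comp (q, p)
    (g := fun r : N × N => (⟨r.1, expInv D U r.1 r.2⟩ : TangentBundle (𝓡 n) N))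
    (f := fun r : EuclideanSpace ℝ (Fin n) × EuclideanSpace ℝ (Fin n) =>
        ((extChartAt (𝓡 n) x).symm r.1, (extChartAt (𝓡 n) x).symm r.2))
    (hU.smooth.contMDiffAt ((hU.isOpen.prod hU.isOpen).mem_nhds ⟨hq.2, hp.2⟩)) h1
  have hsrc := symm_mem_source_of_mem_chartDomain hq
  exact contMDiffAt_iff_contDiffAt.1 ((Trivialization.contMDiffAt_iff
    (e := trivializationAt (EuclideanSpace ℝ (Fin n)) (TangentSpace (𝓡 n) : N → Type _) x)
    (f := fun r : EuclideanSpace ℝ (Fin n) × EuclideanSpace ℝ (Fin n) =>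
      (⟨(extChartAt (𝓡 n) x).symm r.1, expInv D U ((extChartAt (𝓡 n) x).symm r.1)
        ((extChartAt (𝓡 n) x).symm r.2)⟩ : TangentBundle (𝓡 n) N))
    (x₀ := (q, p)) ((Trivialization.mem_source _).2 hsrc)).1 h2).2

/-- In a chart, the inverse exponential map of a geodesically convex set has the properties from
which its Taylor expansion follows. -/
theorem IsGeodesicallyConvex.isLocalExpInv [T2Space N] [D.ContMDiffCovariantDerivative ∞]
    (hU : IsGeodesicallyConvex D U) (hD : D.torsion = 0) (hx : x ∈ U) :
    IsLocalExpInv (chartDomain x U) (extChartAt (𝓡 n) x x) (coordExpInv D U x)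
      (coordConnector D x) where
  isOpen := isOpen_chartDomain hU.isOpen
  mem := extChartAt_mem_chartDomain (mem_chart_source _ x) hx
  smooth := hU.contDiffOn_coordExpInv
  differentiableAt := (contDiffAt_coordConnector D (mem_extChartAt_target x)).differentiableAt
    (by simp)
  symm q hq := coordConnector_symm D hD hq.1
  geodesic q hq p hp := by
    have hsrc := symm_mem_source_of_mem_chartDomain hq
    obtain ⟨c, hc, hm, h0, h1⟩ := hU.geodesicArc_expInv hq.2 hp.2
    have h0I : (0 : ℝ) ∈ Icc (0 : ℝ) 1 := by simp
    have hc0 : c 0 = (extChartAt (𝓡 n) x).symm q := congrArg TotalSpace.proj h0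
    have hcs : c 0 ∈ (chartAt (EuclideanSpace ℝ (Fin n)) x).source := hc0 ▸ hsrc
    have hcq : extChartAt (𝓡 n) x (c 0) = q := by rw [hc0, (extChartAt (𝓡 n) x).right_inv hq.1]
    have hcv : coordVec x (c 0) (mfderiv 𝓘(ℝ, ℝ) (𝓡 n) c 0 (1 : ℝ)) = coordExpInv D U x q p :=
      ((totalSpace_eq_iff hsrc).1 h0).2
    have hd : deriv (fun r => extChartAt (𝓡 n) x (c r)) 0 = coordExpInv D U x q p := by
      rw [← coordVec_velocity ((hc.contMDiffAt 0 h0I).mdifferentiableAt (by simp)) hcs, hcv]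
    refine ⟨fun r => extChartAt (𝓡 n) x (c r), hc.contDiffAt_coord h0I hcs, hcq, hd, ?_, ?_⟩
    · rw [hc.equation_coordConnector h0I hcs, hd, hcq]
    · filter_upwards [Icc_mem_nhdsGE (zero_lt_one (α := ℝ)),
        nhdsWithin_le_nhds ((hc.contMDiffAt 0 h0I).continuousAt
          ((chartAt (EuclideanSpace ℝ (Fin n)) x).open_source.mem_nhds hcs))] with s hs hsO
      rw [coordExpInv, (extChartAt (𝓡 n) x).left_inv (by simpa using hsO), ← hc0,
        hU.expInv_eq (hc.geodesicArc D hm h0I hs), coordVec_smul hcs, hcv, sub_zero]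
  injOn q hq := by
    intro p hp p' hp' h
    have h1 := hU.expInv_injOn hq.2 hp.2 hp'.2
      (coordVec_injective (symm_mem_source_of_mem_chartDomain hq) h)
    exact (extChartAt (𝓡 n) x).symm.injOn hp.1 hp'.1 h1
  radial p₁ hp₁ p₀ hp₀ s₀ hs₀ h := by
    obtain ⟨c, hc, hm, h0, h1⟩ := hU.geodesicArc_expInv hx hp₁.2
    have h0I : (0 : ℝ) ∈ Icc (0 : ℝ) 1 := by simp
    have hxs := mem_chart_source (EuclideanSpace ℝ (Fin n)) x
    have hc0 : c 0 = x := congrArg TotalSpace.proj h0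
    have key {s : ℝ} (hs : s ∈ Icc (0 : ℝ) 1) {q : EuclideanSpace ℝ (Fin n)}
        (hq : q ∈ chartDomain x U)
        (hqs : coordExpInv D U x (extChartAt (𝓡 n) x x) q
          = s • coordExpInv D U x (extChartAt (𝓡 n) x x) p₁) :
        (extChartAt (𝓡 n) x).symm q = c s := by
      have h2 : coordVec x (c 0) (expInv D U (c 0) (c s))
          = coordVec x (c 0) (expInv D U (c 0) ((extChartAt (𝓡 n) x).symm q)) := by
        rw [hU.expInv_eq (hc.geodesicArc D hm h0I hs), coordVec_smul (hc0 ▸ hxs), sub_zero,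
          ((totalSpace_eq_iff hxs).1 h0).2, hc0]
        rw [coordExpInv_self, coordExpInv_self] at hqs
        exact hqs.symm
      exact (hU.expInv_injOn (hm h0I) (hm hs) hq.2
        (coordVec_injective (hc0 ▸ hxs) h2)).symm
    have hp₀c := key hs₀ hp₀ h
    -- `w` is the velocity at time `s₀` of the geodesic to `p₁`, whose point at time `s` is `q`
    refine ⟨coordVec x (c s₀) (mfderiv 𝓘(ℝ, ℝ) (𝓡 n) c s₀ (1 : ℝ)), fun s hs q hq hqs => ?_⟩
    have hsI : s ∈ Icc (0 : ℝ) 1 := ⟨hs₀.1.trans hs.1, hs.2⟩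
    rw [coordExpInv, hp₀c, key hsI hq hqs, hU.expInv_eq (hc.geodesicArc D hm hs₀ hsI),
      coordVec_smul (hp₀c ▸ symm_mem_source_of_mem_chartDomain hp₀)]

end Geodesics

/-! ### Estimates near and far from the base point -/

section LocalExpInv

variable {E : Type*} [NormedAddCommGroup E] [NormedSpace ℝ E]

/-- The curvature expression `localCurvature Γ q` as a continuous trilinear map. -/
def localCurvatureMap (Γ : E → E →L[ℝ] E →L[ℝ] E) (q : E) : E →L[ℝ] E →L[ℝ] E →L[ℝ] E :=
  (fderiv ℝ Γ q + (ContinuousLinearMap.compL ℝ E E E).bilinearComp (Γ q) (Γ q)).flip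
    - (fderiv ℝ Γ q + (ContinuousLinearMap.compL ℝ E E E).bilinearComp (Γ q) (Γ q))

theorem localCurvatureMap_apply (Γ : E → E →L[ℝ] E →L[ℝ] E) (q u a b : E) :
    localCurvatureMap Γ q u a b = localCurvature Γ q u a b := by
  simp only [localCurvatureMap, localCurvature, sub_apply,
    ContinuousLinearMap.flip_apply, add_apply,
    ContinuousLinearMap.bilinearComp_apply, ContinuousLinearMap.compL_apply,
    ContinuousLinearMap.comp_apply]
  abel

/-- Away from the origin, a power of `1 + t` of degree at most four is bounded by a multiple of
`t ^ 4`. -/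
theorem one_add_pow_le_of_le {ε t : ℝ} (hε : 0 < ε) (ht : ε ≤ t) {j : ℕ} (hj : j ≤ 4) :
    (1 + t) ^ j ≤ (1 + ε⁻¹) ^ 4 * t ^ 4 := by
  have ht0 : 0 < t := hε.trans_le ht
  calc (1 + t) ^ j ≤ (1 + t) ^ 4 := pow_le_pow_right₀ (by linarith) hj
    _ ≤ ((1 + ε⁻¹) * t) ^ 4 := by
        have : 1 ≤ ε⁻¹ * t := by
          rw [inv_mul_eq_div, one_le_div hε]; exact ht
        have : 1 + t ≤ (1 + ε⁻¹) * t := by linarith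
        gcongr
    _ = _ := mul_pow _ _ _

/-- Away from the origin, a vector of linear growth and its expansion are both dominated by
`‖w‖⁴`. -/
theorem norm_sub_expansion_le_far {C C₀ ε : ℝ} (hC : 0 ≤ C) (hC₀ : 0 ≤ C₀) (hε : 0 < ε)
    (R : E →L[ℝ] E →L[ℝ] E →L[ℝ] E) {L : E →L[ℝ] E} {ζ v w : E} (hv : ‖v‖ ≤ 1)
    (hL : ‖L‖ ≤ C * ‖v‖) (hw : ε ≤ ‖w‖) (hζ : ‖ζ‖ ≤ C₀ * (1 + ‖w‖)) :
    ‖ζ - ((w - v) + L (w - v) - (1 / 3 : ℝ) • R v (w - v) (w - v))‖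
      ≤ (C₀ + 1 + C + ‖R‖) * (1 + ε⁻¹) ^ 4 * ‖w‖ ^ 4 := by
  have h1 := one_add_pow_le_of_le hε hw (j := 1) (by norm_num)
  have h2 := one_add_pow_le_of_le hε hw (j := 2) (by norm_num)
  rw [pow_one] at h1
  have he : ‖w - v‖ ≤ 1 + ‖w‖ := (norm_sub_le _ _).trans (by linarith)
  have hLe : ‖L (w - v)‖ ≤ C * (1 + ‖w‖) := by
    refine (L.le_opNorm _).trans ?_
    have : ‖L‖ ≤ C := hL.trans (by nlinarith)
    gcongr
  have hRe : ‖(1 / 3 : ℝ) • R v (w - v) (w - v)‖ ≤ ‖R‖ * (1 + ‖w‖) ^ 2 := by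
    rw [norm_smul]
    have h3 : ‖R v (w - v) (w - v)‖ ≤ ‖R‖ * 1 * (1 + ‖w‖) * (1 + ‖w‖) :=
      (norm_apply₃_le _ _ _ _).trans (by gcongr)
    have : ‖(1 / 3 : ℝ)‖ = 1 / 3 := by norm_num
    rw [this]
    nlinarith [norm_nonneg (R v (w - v) (w - v))]
  calc _ ≤ ‖ζ‖ + ((‖w - v‖ + ‖L (w - v)‖) + ‖(1 / 3 : ℝ) • R v (w - v) (w - v)‖) :=
        (norm_sub_le _ _).trans (add_le_add_right ((norm_sub_le _ _).trans
          (add_le_add_left (norm_add_le _ _) _)) _)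
    _ ≤ C₀ * (1 + ‖w‖) + (((1 + ‖w‖) + C * (1 + ‖w‖)) + ‖R‖ * (1 + ‖w‖) ^ 2) := by gcongr
    _ = (C₀ + 1 + C) * (1 + ‖w‖) + ‖R‖ * (1 + ‖w‖) ^ 2 := by ring
    _ ≤ (C₀ + 1 + C) * ((1 + ε⁻¹) ^ 4 * ‖w‖ ^ 4) + ‖R‖ * ((1 + ε⁻¹) ^ 4 * ‖w‖ ^ 4) := by gcongr
    _ = _ := by ring

/-- Away from the origin, the cubic expression in a vector of linear growth and its leading term are
both dominated by `‖w‖⁴`. -/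
theorem norm_sub_cubic_le_far {C₀ C₁ ε : ℝ} (hC₀ : 0 ≤ C₀) (hC₁ : 0 ≤ C₁) (hε : 0 < ε)
    (T T' : E →L[ℝ] E →L[ℝ] E →L[ℝ] E) {ζ v w : E} (hv : ‖v‖ ≤ 1) (hT' : ‖T'‖ ≤ C₁)
    (hw : ε ≤ ‖w‖) (hζ : ‖ζ‖ ≤ C₀ * (1 + ‖w‖)) :
    ‖T' ζ ζ ζ - T (w - v) (w - v) (w - v)‖
      ≤ (C₁ * C₀ ^ 3 + ‖T‖) * (1 + ε⁻¹) ^ 4 * ‖w‖ ^ 4 := by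
  have h3 := one_add_pow_le_of_le hε hw (j := 3) (by norm_num)
  have he : ‖w - v‖ ≤ 1 + ‖w‖ := (norm_sub_le _ _).trans (by linarith)
  calc _ ≤ ‖T'‖ * ‖ζ‖ * ‖ζ‖ * ‖ζ‖ + ‖T‖ * ‖w - v‖ * ‖w - v‖ * ‖w - v‖ :=
        (norm_sub_le _ _).trans (add_le_add (norm_apply₃_le _ _ _ _) (norm_apply₃_le _ _ _ _))
    _ ≤ C₁ * (C₀ * (1 + ‖w‖)) * (C₀ * (1 + ‖w‖)) * (C₀ * (1 + ‖w‖))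
        + ‖T‖ * (1 + ‖w‖) * (1 + ‖w‖) * (1 + ‖w‖) := by gcongr
    _ = (C₁ * C₀ ^ 3 + ‖T‖) * (1 + ‖w‖) ^ 3 := by ring
    _ ≤ (C₁ * C₀ ^ 3 + ‖T‖) * ((1 + ε⁻¹) ^ 4 * ‖w‖ ^ 4) := by gcongr
    _ = _ := by ring

theorem norm_apply₃_sub_le (T : E →L[ℝ] E →L[ℝ] E →L[ℝ] E) (a b : E) :
    ‖T a a a - T b b b‖ ≤ 3 * ‖T‖ * max ‖a‖ ‖b‖ ^ 2 * ‖a - b‖ := by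
  have h : T a a a - T b b b = T (a - b) a a + T b (a - b) a + T b b (a - b) := by
    simp only [map_sub, sub_apply]
    abel
  have ha := le_max_left ‖a‖ ‖b‖
  have hb := le_max_right ‖a‖ ‖b‖
  rw [h]
  calc _ ≤ (‖T‖ * ‖a - b‖ * ‖a‖ * ‖a‖ + ‖T‖ * ‖b‖ * ‖a - b‖ * ‖a‖)
        + ‖T‖ * ‖b‖ * ‖b‖ * ‖a - b‖ :=
        (norm_add₃_le).trans (add_le_add (add_le_add (norm_apply₃_le _ _ _ _)
          (norm_apply₃_le _ _ _ _)) (norm_apply₃_le _ _ _ _))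
    _ ≤ (‖T‖ * ‖a - b‖ * max ‖a‖ ‖b‖ * max ‖a‖ ‖b‖ + ‖T‖ * max ‖a‖ ‖b‖ * ‖a - b‖ * max ‖a‖ ‖b‖)
        + ‖T‖ * max ‖a‖ ‖b‖ * max ‖a‖ ‖b‖ * ‖a - b‖ := by gcongr
    _ = _ := by ring

/-- Near the origin, replacing `ζ` by its leading term and `T'` by the nearby tensor `T` changes
`T'(ζ, ζ, ζ)` by a term which is small of fourth order. -/
theorem norm_sub_cubic_le_near {C : ℝ} (hC : 0 ≤ C)
    (R T T' : E →L[ℝ] E →L[ℝ] E →L[ℝ] E) {L : E →L[ℝ] E} {ζ v e : E} (hv : ‖v‖ ≤ 1)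
    (he : ‖e‖ ≤ 2) (hL : ‖L‖ ≤ C * ‖v‖) (hT : ‖T' - T‖ ≤ C * ‖v‖)
    (hζ : ‖ζ - (e + L e - (1 / 3 : ℝ) • R v e e)‖ ≤ C * (‖v‖ * ‖e‖ ^ 3 + ‖v‖ ^ 2 * ‖e‖ ^ 2)) :
    ‖T' ζ ζ ζ - T e e e‖ ≤ (C + 3 * (C + ‖T‖) * (1 + (7 * C + ‖R‖)) ^ 2 * (7 * C + ‖R‖))
      * (‖v‖ * ‖e‖ ^ 3) := by
  set K := 7 * C + ‖R‖ with hK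
  have hv0 := norm_nonneg v
  have he0 := norm_nonneg e
  have hR0 := norm_nonneg R
  have hK0 : 0 ≤ K := by positivity
  have hd : ‖ζ - e‖ ≤ K * (‖v‖ * ‖e‖) := by
    have h1 : ζ - e = (ζ - (e + L e - (1 / 3 : ℝ) • R v e e)) + (L e - (1 / 3 : ℝ) • R v e e) := by
      abel
    have h2 : ‖L e‖ ≤ C * ‖v‖ * ‖e‖ := (L.le_opNorm _).trans (by gcongr)
    have h3 : ‖(1 / 3 : ℝ) • R v e e‖ ≤ 1 / 3 * (‖R‖ * ‖v‖ * ‖e‖ * 2) := by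
      rw [norm_smul, show ‖(1 / 3 : ℝ)‖ = 1 / 3 by norm_num]
      have := (norm_apply₃_le R v e e).trans (mul_le_mul_of_nonneg_left he (by positivity))
      gcongr
    have h4 : C * (‖v‖ * ‖e‖ ^ 3 + ‖v‖ ^ 2 * ‖e‖ ^ 2) ≤ C * (‖v‖ * (2 ^ 2 * ‖e‖)
        + (1 * ‖v‖) * (2 * ‖e‖)) := by
      have h5 : ‖e‖ ^ 3 ≤ 2 ^ 2 * ‖e‖ := by
        rw [pow_succ]; gcongr
      have h6 : ‖v‖ ^ 2 ≤ 1 * ‖v‖ := by rw [pow_two]; gcongr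
      have h7 : ‖e‖ ^ 2 ≤ 2 * ‖e‖ := by rw [pow_two]; gcongr
      gcongr
    have h8 : 0 ≤ ‖R‖ * ‖v‖ * ‖e‖ := by positivity
    rw [h1]
    refine (norm_add_le _ _).trans ?_
    have h9 := norm_sub_le (L e) ((1 / 3 : ℝ) • R v e e)
    rw [hK]
    nlinarith
  have hm : max ‖ζ‖ ‖e‖ ≤ (1 + K) * ‖e‖ := by
    refine max_le ?_ (by nlinarith)
    have h1 : ‖ζ‖ ≤ ‖e‖ + ‖ζ - e‖ := norm_le_norm_add_norm_sub' _ _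
    have h2 : K * (‖v‖ * ‖e‖) ≤ K * (1 * ‖e‖) := by gcongr
    linarith
  have hT' : ‖T'‖ ≤ C + ‖T‖ := by
    have h1 : ‖T'‖ ≤ ‖T‖ + ‖T' - T‖ := norm_le_norm_add_norm_sub' _ _
    have h2 : C * ‖v‖ ≤ C * 1 := by gcongr
    linarith
  have h1 : T' ζ ζ ζ - T e e e = (T' - T) e e e + (T' ζ ζ ζ - T' e e e) := by
    simp only [sub_apply]
    abel
  rw [h1]
  calc _ ≤ ‖T' - T‖ * ‖e‖ * ‖e‖ * ‖e‖ + 3 * ‖T'‖ * max ‖ζ‖ ‖e‖ ^ 2 * ‖ζ - e‖ :=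
        (norm_add_le _ _).trans (add_le_add (norm_apply₃_le _ _ _ _) (norm_apply₃_sub_le _ _ _))
    _ ≤ C * ‖v‖ * ‖e‖ * ‖e‖ * ‖e‖
        + 3 * (C + ‖T‖) * ((1 + K) * ‖e‖) ^ 2 * (K * (‖v‖ * ‖e‖)) := by
        have : 0 ≤ max ‖ζ‖ ‖e‖ := le_max_of_le_left (norm_nonneg _)
        gcongr
    _ = _ := by ring

end LocalExpInv

/-! ### The expansion on a geodesically convex set -/

theorem clm_apply_sum {V : Type*} [AddCommGroup V] [Module ℝ V] [TopologicalSpace V]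
    [IsTopologicalAddGroup V] [ContinuousSMul ℝ V] (T : V →L[ℝ] V →L[ℝ] V →L[ℝ] V)
    {ι : Type*} [Fintype ι] (α β δ : ι → ℝ) (f : ι → V) :
    T (∑ i, α i • f i) (∑ i, β i • f i) (∑ i, δ i • f i)
      = ∑ i, ∑ j, ∑ l, α i • β j • δ l • T (f i) (f j) (f l) := by
  have h1 (a b : V) : T a b (∑ i, δ i • f i) = ∑ l, δ l • T a b (f l) := by
    simp only [map_sum, map_smul]
  have h2 (a c : V) : T a (∑ i, β i • f i) c = ∑ j, β j • T a (f j) c := by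
    simp only [map_sum, map_smul, sum_apply, smul_apply]
  have h3 (b c : V) : T (∑ i, α i • f i) b c = ∑ i, α i • T (f i) b c := by
    simp only [map_sum, map_smul, sum_apply, smul_apply]
  simp only [h3, h2, h1, Finset.smul_sum]

section Pointwise

variable {n : ℕ} {N : Type*} [TopologicalSpace N] [ChartedSpace (EuclideanSpace ℝ (Fin n)) N]
  [IsManifold (𝓡 n) ∞ N]
  {D : CovariantDerivative (𝓡 n) (EuclideanSpace ℝ (Fin n)) (TangentSpace (𝓡 n) : N → Type _)}
  {U : Set N} {x : N}

theorem IsGeodesicallyConvex.expMap_expInv [T2Space N] [D.ContMDiffCovariantDerivative ∞]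
    (hU : IsGeodesicallyConvex D U) {y p : N} (hy : y ∈ U) (hp : p ∈ U) :
    expMap D y (expInv D U y p) = p :=
  expMap_eq ((hU.geodesicArc_expInv hy hp).mono (subset_univ U))

variable (D x) in
/-- The exponential map at `x` as a function of the coordinates of the tangent vector. -/
def expCoord (v : EuclideanSpace ℝ (Fin n)) : N := expMap D x (coordField x v x)

theorem expCoord_coordVec (v : TangentSpace (𝓡 n) x) :
    expCoord D x (coordVec x x v) = expMap D x v := by
  rw [expCoord, coordField_coordVec (mem_chart_source _ x)]

theorem eq_sum_smul_coordField {y : N} (hy : y ∈ (chartAt (EuclideanSpace ℝ (Fin n)) x).source)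
    (a : TangentSpace (𝓡 n) y) :
    a = ∑ i, coordVec x y a i • coordField x (EuclideanSpace.single i 1) y := by
  apply coordVec_injective hy
  rw [coordVec_sum hy]
  simp only [coordVec_smul hy, coordVec_coordField hy, euclidean_sum_single]

variable (x) in
/-- The coordinates, in the chart at `x`, of a tensor field of type `(1, 3)`, as a function of the
coordinates of the base point. -/
def coordTensor (T : TensorField13 n N) (q : EuclideanSpace ℝ (Fin n)) :
    EuclideanSpace ℝ (Fin n) →L[ℝ] EuclideanSpace ℝ (Fin n) →L[ℝ]
      EuclideanSpace ℝ (Fin n) →L[ℝ] EuclideanSpace ℝ (Fin n) :=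
  ∑ i, ∑ j, ∑ l, (EuclideanSpace.proj i : EuclideanSpace ℝ (Fin n) →L[ℝ] ℝ).smulRight
    ((EuclideanSpace.proj j : EuclideanSpace ℝ (Fin n) →L[ℝ] ℝ).smulRight
      ((EuclideanSpace.proj l : EuclideanSpace ℝ (Fin n) →L[ℝ] ℝ).smulRight
        (coordVec x ((extChartAt (𝓡 n) x).symm q) (T.toFun ((extChartAt (𝓡 n) x).symm q)
          (coordField x (EuclideanSpace.single i 1) _) (coordField x (EuclideanSpace.single j 1) _)
          (coordField x (EuclideanSpace.single l 1) _)))))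

theorem coordTensor_apply (T : TensorField13 n N) {y : N}
    (hy : y ∈ (chartAt (EuclideanSpace ℝ (Fin n)) x).source) (a b c : TangentSpace (𝓡 n) y) :
    coordTensor x T (extChartAt (𝓡 n) x y) (coordVec x y a) (coordVec x y b) (coordVec x y c)
      = coordVec x y (T.toFun y a b c) := by
  have h := clm_apply_sum (T.toFun y) (coordVec x y a) (coordVec x y b) (coordVec x y c)
    (fun i => coordField x (EuclideanSpace.single i 1) y)
  rw [← eq_sum_smul_coordField hy, ← eq_sum_smul_coordField hy,
    ← eq_sum_smul_coordField hy] at h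
  have h' (u v w : EuclideanSpace ℝ (Fin n)) :
      coordVec x ((extChartAt (𝓡 n) x).symm (extChartAt (𝓡 n) x y))
        (T.toFun ((extChartAt (𝓡 n) x).symm (extChartAt (𝓡 n) x y))
          (coordField x u _) (coordField x v _) (coordField x w _))
        = coordVec x y (T.toFun y (coordField x u y) (coordField x v y) (coordField x w y)) := by
    rw [(extChartAt (𝓡 n) x).left_inv (show y ∈ (extChartAt (𝓡 n) x).source by simpa using hy)]
  rw [h]
  simp only [coordVec_sum hy, coordVec_smul hy, coordTensor, sum_apply, h',
    ContinuousLinearMap.smulRight_apply, smul_apply]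
  rfl

variable [T2Space N] [D.ContMDiffCovariantDerivative ∞]

/-- The expansion of `exp_z⁻¹ p` for `z = exp_x v` and `p = exp_x w`, in the chart at `x`. -/
theorem IsGeodesicallyConvex.exists_expCoord_expansion (hU : IsGeodesicallyConvex D U)
    (hD : D.torsion = 0) (hx : x ∈ U) :
    ∃ k : EuclideanSpace ℝ (Fin n) → EuclideanSpace ℝ (Fin n), ContDiffAt ℝ ∞ k 0 ∧
      k 0 = extChartAt (𝓡 n) x x ∧
      (∀ᶠ v in 𝓝 0, GeodesicArc D univ x (coordField x v x) (expCoord D x v) ∧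
        expCoord D x v ∈ U ∧ expCoord D x v ∈ (chartAt (EuclideanSpace ℝ (Fin n)) x).source ∧
        extChartAt (𝓡 n) x (expCoord D x v) = k v) ∧
      ∃ (L : EuclideanSpace ℝ (Fin n) → EuclideanSpace ℝ (Fin n) →L[ℝ] EuclideanSpace ℝ (Fin n))
        (C : ℝ), 0 ≤ C ∧ (∀ᶠ v in 𝓝 0, ‖L v‖ ≤ C * ‖v‖) ∧
        ∀ᶠ q in 𝓝 ((0, 0) : EuclideanSpace ℝ (Fin n) × EuclideanSpace ℝ (Fin n)),
          ‖coordVec x (expCoord D x q.1) (expInv D U (expCoord D x q.1) (expCoord D x q.2))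
            - ((q.2 - q.1) + L q.1 (q.2 - q.1) - (1 / 3 : ℝ) •
              localCurvatureMap (coordConnector D x) (extChartAt (𝓡 n) x x) q.1
                (q.2 - q.1) (q.2 - q.1))‖
            ≤ C * (‖q.1‖ * ‖q.2 - q.1‖ ^ 3 + ‖q.1‖ ^ 2 * ‖q.2 - q.1‖ ^ 2) := by
  obtain ⟨k, hk, hk0, hkF, L, C, hC, hL, hLC⟩ := (hU.isLocalExpInv hD hx).exists_expansion
  have hev : ∀ᶠ v in 𝓝 0, GeodesicArc D univ x (coordField x v x) (expCoord D x v) ∧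
        expCoord D x v ∈ U ∧ expCoord D x v ∈ (chartAt (EuclideanSpace ℝ (Fin n)) x).source ∧
        extChartAt (𝓡 n) x (expCoord D x v) = k v := by
    filter_upwards [hkF] with v hv
    have hz := symm_mem_source_of_mem_chartDomain hv.1
    have harc := hU.geodesicArc_expInv hx hv.1.2
    have he : expInv D U x ((extChartAt (𝓡 n) x).symm (k v)) = coordField x v x := by
      have h := hv.2
      rw [coordExpInv_self] at h
      rw [← coordField_coordVec (mem_chart_source _ x)
        (expInv D U x ((extChartAt (𝓡 n) x).symm (k v))), h]
    rw [he] at harc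
    have hz' : expCoord D x v = (extChartAt (𝓡 n) x).symm (k v) :=
      expMap_eq (harc.mono (subset_univ U))
    rw [hz']
    exact ⟨harc.mono (subset_univ U), hv.1.2, hz, (extChartAt (𝓡 n) x).right_inv hv.1.1⟩
  refine ⟨k, hk, hk0, hev, L, C, hC, hL, ?_⟩
  have h1 : ∀ᶠ q in 𝓝 ((0, 0) : EuclideanSpace ℝ (Fin n) × EuclideanSpace ℝ (Fin n)), _ :=
    (continuous_fst.tendsto _).eventually hev
  have h2 : ∀ᶠ q in 𝓝 ((0, 0) : EuclideanSpace ℝ (Fin n) × EuclideanSpace ℝ (Fin n)), _ :=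
    (continuous_snd.tendsto _).eventually hev
  filter_upwards [hLC, h1, h2] with q hq hq1 hq2
  have hF : coordExpInv D U x (k q.1) (k q.2) =
      coordVec x (expCoord D x q.1) (expInv D U (expCoord D x q.1) (expCoord D x q.2)) := by
    rw [coordExpInv, ← hq1.2.2.2, ← hq2.2.2.2,
      (extChartAt (𝓡 n) x).left_inv (by simpa using hq1.2.2.1),
      (extChartAt (𝓡 n) x).left_inv (by simpa using hq2.2.2.1)]
  rw [localCurvatureMap_apply, ← hF]
  refine le_of_eq_of_le (congrArg _ ?_) hq
  abel

theorem IsGeodesicallyConvex.tendsto_expCoord (hU : IsGeodesicallyConvex D U)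
    (hD : D.torsion = 0) (hx : x ∈ U) : Tendsto (expCoord D x) (𝓝 0) (𝓝 x) := by
  obtain ⟨k, hk, hk0, hev, -⟩ := hU.exists_expCoord_expansion hD hx
  have h : Tendsto (fun v => (extChartAt (𝓡 n) x).symm (k v)) (𝓝 0) (𝓝 x) := by
    have h1 : Tendsto k (𝓝 0) (𝓝 (extChartAt (𝓡 n) x x)) := hk0 ▸ hk.continuousAt.tendsto
    have h2 := (continuousAt_extChartAt_symm (I := 𝓡 n) x).tendsto.comp h1
    rwa [extChartAt_to_inv] at h2
  refine h.congr' ?_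
  filter_upwards [hev] with v hv
  rw [← hv.2.2.2, (extChartAt (𝓡 n) x).left_inv (by simpa using hv.2.2.1)]

/-- The expansion of `exp_z⁻¹ p` holds for all `p ∈ U`, at the price of a remainder `‖exp_x⁻¹ p‖⁴`,
if `exp_z⁻¹ p` grows at most linearly. -/
theorem IsGeodesicallyConvex.exists_norm_sub_expansion_le (hU : IsGeodesicallyConvex D U)
    (hD : D.torsion = 0) (hx : x ∈ U) {C₀ : ℝ} (hC₀ : 0 ≤ C₀) :
    ∃ (L : EuclideanSpace ℝ (Fin n) → EuclideanSpace ℝ (Fin n) →L[ℝ] EuclideanSpace ℝ (Fin n))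
      (C : ℝ), 0 ≤ C ∧ ∀ᶠ v in 𝓝 0, ‖L v‖ ≤ C * ‖v‖ ∧ ∀ p ∈ U, ∀ w ζ,
        w = coordVec x x (expInv D U x p) →
        ζ = coordVec x (expCoord D x v) (expInv D U (expCoord D x v) p) →
        ‖ζ‖ ≤ C₀ * (1 + ‖w‖) →
        ‖ζ - ((w - v) + L v (w - v) - (1 / 3 : ℝ) •
          localCurvatureMap (coordConnector D x) (extChartAt (𝓡 n) x x) v (w - v) (w - v))‖
          ≤ C * (‖v‖ * ‖w - v‖ ^ 3 + ‖v‖ ^ 2 * ‖w - v‖ ^ 2 + ‖w‖ ^ 4) := by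
  obtain ⟨k, hk, hk0, hev, L, C, hC, hL, hLC⟩ := hU.exists_expCoord_expansion hD hx
  set R := localCurvatureMap (coordConnector D x) (extChartAt (𝓡 n) x x)
  obtain ⟨ε, hε, hball⟩ := Metric.eventually_nhds_iff_ball.1 hLC
  set C' := (C₀ + 1 + C + ‖R‖) * (1 + ε⁻¹) ^ 4 with hC'
  have hC'0 : 0 ≤ C' := by positivity
  refine ⟨L, C + C', by positivity, ?_⟩
  filter_upwards [hL, Metric.ball_mem_nhds 0 hε, Metric.ball_mem_nhds 0 one_pos]
    with v hLv hvε hv1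
  rw [mem_ball_zero_iff] at hvε hv1
  refine ⟨hLv.trans (by gcongr; linarith), fun p hp w ζ hw hζ hgr => ?_⟩
  rcases lt_or_ge ‖w‖ ε with hwε | hwε
  · have hq := hball (v, w) (by
      rw [mem_ball_iff_norm, Prod.norm_def]; simpa using ⟨hvε, hwε⟩)
    have hpw : expCoord D x w = p := by
      rw [hw, expCoord_coordVec, hU.expMap_expInv hx hp]
    simp only [hpw, ← hζ] at hq
    exact hq.trans (mul_le_mul (by linarith) (le_add_of_nonneg_right (by positivity))
      (by positivity) (by positivity))
  · refine (norm_sub_expansion_le_far hC hC₀ hε R hv1.le hLv hwε hgr).trans ?_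
    exact mul_le_mul (by linarith) (le_add_of_nonneg_left (by positivity))
      (by positivity) (by positivity)

/-- As smoothness of a tensor field is a statement about global vector fields, the coordinate fields
are first multiplied by a bump function. -/
theorem differentiableAt_coordTensor (T : TensorField13 n N) :
    DifferentiableAt ℝ (coordTensor x T) (extChartAt (𝓡 n) x x) := by
  have hO := (chartAt (EuclideanSpace ℝ (Fin n)) x).open_source
  have hx := mem_chart_source (EuclideanSpace ℝ (Fin n)) x
  obtain ⟨ψ, -, hψ⟩ :=
    (SmoothBumpFunction.nhds_basis_tsupport (I := 𝓡 n) x).mem_iff.1 (hO.mem_nhds hx)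
  have h1 (w : EuclideanSpace ℝ (Fin n)) : ContMDiff (𝓡 n) (𝓡 n).tangent ∞
      (fun q => (⟨q, ((ψ : N → ℝ) • coordField x w) q⟩ : TangentBundle (𝓡 n) N)) :=
    ContMDiffOn.smul_section_of_tsupport ψ.contMDiff.contMDiffOn hO hψ fun q hq =>
      (contMDiffAt_coordField hq w).contMDiffWithinAt
  have h2 (u v w : EuclideanSpace ℝ (Fin n)) : ContMDiffAt (𝓡 n) 𝓘(ℝ, EuclideanSpace ℝ (Fin n)) ∞
      (fun y => coordVec x y (T.toFun y (coordField x u y) (coordField x v y)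
        (coordField x w y))) x := by
    refine ((contMDiffAt_section_iff hx).1 (T.smooth _ _ _ (h1 u) (h1 v) (h1 w)
      x)).congr_of_eventuallyEq ?_
    filter_upwards [ψ.eventuallyEq_one] with y hy
    have h3 (w : EuclideanSpace ℝ (Fin n)) :
        ((ψ : N → ℝ) • coordField x w) y = coordField x w y := by
      have : (ψ y) • coordField x w y = coordField x w y := by
        rw [hy]
        exact one_smul ℝ _
      exact this
    rw [h3, h3, h3]
  have h4 (u v w : EuclideanSpace ℝ (Fin n)) : DifferentiableAt ℝ
      (fun q => coordVec x ((extChartAt (𝓡 n) x).symm q) (T.toFun ((extChartAt (𝓡 n) x).symm q)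
          (coordField x u _) (coordField x v _) (coordField x w _))) (extChartAt (𝓡 n) x x) := by
    have h5 := (contMDiffOn_extChartAt_symm (I := 𝓡 n) (n := ∞) x).contMDiffAt
      ((isOpen_extChartAt_target x).mem_nhds (mem_extChartAt_target x))
    have h6 : ContMDiffAt (𝓡 n) 𝓘(ℝ, EuclideanSpace ℝ (Fin n)) ∞
        (fun y => coordVec x y (T.toFun y (coordField x u y) (coordField x v y)
          (coordField x w y))) ((extChartAt (𝓡 n) x).symm (extChartAt (𝓡 n) x x)) := by
      rw [extChartAt_to_inv]
      exact h2 u v w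
    exact (contMDiffAt_iff_contDiffAt.1 (ContMDiffAt.comp (extChartAt (𝓡 n) x x) h6
      h5)).differentiableAt (by simp)
  refine DifferentiableAt.fun_sum fun i _ => DifferentiableAt.fun_sum fun j _ =>
    DifferentiableAt.fun_sum fun l _ => ?_
  exact ((ContinuousLinearMap.smulRightL ℝ (EuclideanSpace ℝ (Fin n)) _ _).differentiableAt).comp _
    (((ContinuousLinearMap.smulRightL ℝ (EuclideanSpace ℝ (Fin n)) _ _).differentiableAt).comp _
    (((ContinuousLinearMap.smulRightL ℝ (EuclideanSpace ℝ (Fin n)) _ _).differentiableAt).comp _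
      (h4 _ _ _)))

/-- For a tensor field `T` of type `(1, 3)`, replacing `exp_z⁻¹ p` by its leading term and `z` by
`x` changes `T(exp_z⁻¹ p, exp_z⁻¹ p, exp_z⁻¹ p)` by a term which is small of fourth order. -/
theorem IsGeodesicallyConvex.exists_norm_sub_cubic_le (hU : IsGeodesicallyConvex D U)
    (hD : D.torsion = 0) (hx : x ∈ U) {C₀ : ℝ} (hC₀ : 0 ≤ C₀) (T : TensorField13 n N) :
    ∃ C : ℝ, 0 ≤ C ∧ ∀ᶠ v in 𝓝 0, ∀ p ∈ U, ∀ w ζ,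
        w = coordVec x x (expInv D U x p) →
        ζ = coordVec x (expCoord D x v) (expInv D U (expCoord D x v) p) →
        ‖ζ‖ ≤ C₀ * (1 + ‖w‖) →
        ‖coordTensor x T (extChartAt (𝓡 n) x (expCoord D x v)) ζ ζ ζ
          - coordTensor x T (extChartAt (𝓡 n) x x) (w - v) (w - v) (w - v)‖
          ≤ C * (‖v‖ * ‖w - v‖ ^ 3 + ‖w‖ ^ 4) := by
  obtain ⟨k, hk, hk0, hev, L, C, hC, hL, hLC⟩ := hU.exists_expCoord_expansion hD hx
  set R := localCurvatureMap (coordConnector D x) (extChartAt (𝓡 n) x x)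
  set T₀ := coordTensor x T (extChartAt (𝓡 n) x x)
  obtain ⟨C₁, hC₁, hT⟩ : ∃ C₁, 0 ≤ C₁ ∧ ∀ᶠ v in 𝓝 0, ‖coordTensor x T (k v) - T₀‖ ≤ C₁ * ‖v‖ := by
    have h1 : DifferentiableAt ℝ (fun v => coordTensor x T (k v)) 0 :=
      DifferentiableAt.comp 0 (g := coordTensor x T)
        (by rw [hk0]; exact differentiableAt_coordTensor T) (hk.differentiableAt (by simp))
    obtain ⟨c, hc0, hc⟩ := h1.isBigO_sub.exists_nonneg
    refine ⟨c, hc0, hc.bound.mono fun v hv => ?_⟩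
    rwa [hk0, sub_zero] at hv
  obtain ⟨ε, hε, hball⟩ := Metric.eventually_nhds_iff_ball.1 hLC
  set ε' := min ε 1 with hε'
  have hε'0 : 0 < ε' := lt_min hε one_pos
  set C₂ := C + C₁ with hC₂
  have hC₂0 : 0 ≤ C₂ := by positivity
  set K₁ := C₂ + 3 * (C₂ + ‖T₀‖) * (1 + (7 * C₂ + ‖R‖)) ^ 2 * (7 * C₂ + ‖R‖) with hK₁
  set K₂ := ((C₂ + ‖T₀‖) * C₀ ^ 3 + ‖T₀‖) * (1 + ε'⁻¹) ^ 4 with hK₂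
  have hK₁0 : 0 ≤ K₁ := by positivity
  have hK₂0 : 0 ≤ K₂ := by positivity
  refine ⟨K₁ + K₂, by positivity, ?_⟩
  filter_upwards [hL, hT, hev, Metric.ball_mem_nhds 0 hε'0] with v hLv hTv hkv hv
  rw [mem_ball_zero_iff] at hv
  have hvε : ‖v‖ < ε := hv.trans_le (min_le_left _ _)
  have hv1 : ‖v‖ ≤ 1 := (hv.trans_le (min_le_right _ _)).le
  intro p hp w ζ hw hζ hgr
  rw [hkv.2.2.2]
  rcases lt_or_ge ‖w‖ ε' with hwε | hwε
  · have hq := hball (v, w) (by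
      rw [mem_ball_iff_norm, Prod.norm_def]
      simpa using ⟨hvε, hwε.trans_le (min_le_left _ _)⟩)
    have hpw : expCoord D x w = p := by
      rw [hw, expCoord_coordVec, hU.expMap_expInv hx hp]
    simp only [hpw, ← hζ] at hq
    have he : ‖w - v‖ ≤ 2 := (norm_sub_le _ _).trans (by
      linarith [hwε.trans_le (min_le_right ε 1)])
    refine (norm_sub_cubic_le_near hC₂0 R T₀ (coordTensor x T (k v)) hv1 he
      (hLv.trans (by gcongr; linarith)) (hTv.trans (by gcongr; linarith))
      (hq.trans (by gcongr; linarith))).trans ?_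
    exact mul_le_mul (by linarith) (le_add_of_nonneg_right (by positivity))
      (by positivity) (by positivity)
  · have hT' : ‖coordTensor x T (k v)‖ ≤ C₂ + ‖T₀‖ := by
      have h1 : ‖coordTensor x T (k v)‖ ≤ ‖T₀‖ + ‖coordTensor x T (k v) - T₀‖ :=
        norm_le_norm_add_norm_sub' _ _
      have h2 : C₁ * ‖v‖ ≤ C₁ * 1 := by gcongr
      linarith
    refine (norm_sub_cubic_le_far hC₀ (by positivity) hε'0 T₀ (coordTensor x T (k v)) hv1 hT' hwε
      hgr).trans ?_
    exact mul_le_mul (by linarith) (le_add_of_nonneg_left (by positivity))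
      (by positivity) (by positivity)

end Pointwise

/-! ### Comparison of norms, and random vectors in coordinates -/

section Norm

variable {n : ℕ} {N : Type*} [TopologicalSpace N] [ChartedSpace (EuclideanSpace ℝ (Fin n)) N]
  [IsManifold (𝓡 n) ∞ N] [RiemannianBundle (fun y : N => TangentSpace (𝓡 n) y)]
  [IsContinuousRiemannianBundle (EuclideanSpace ℝ (Fin n)) (fun y : N => TangentSpace (𝓡 n) y)]

/-- Near `x`, the Riemannian norms are uniformly equivalent to the norms of the coordinates. -/
theorem exists_norm_coordVec_le (x : N) : ∃ C > 0, ∀ᶠ y in 𝓝 x,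
    y ∈ (chartAt (EuclideanSpace ℝ (Fin n)) x).source ∧ ∀ w : TangentSpace (𝓡 n) y,
      ‖coordVec x y w‖ ≤ C * ‖w‖ ∧ ‖w‖ ≤ C * ‖coordVec x y w‖ := by
  obtain ⟨C₁, hC₁, h₁⟩ := eventually_norm_trivializationAt_lt (EuclideanSpace ℝ (Fin n))
    (fun y : N => TangentSpace (𝓡 n) y) x
  obtain ⟨C₂, hC₂, h₂⟩ := eventually_norm_symmL_trivializationAt_lt (EuclideanSpace ℝ (Fin n))
    (fun y : N => TangentSpace (𝓡 n) y) x
  have hO := (chartAt (EuclideanSpace ℝ (Fin n)) x).open_source.mem_nhds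
    (mem_chart_source (EuclideanSpace ℝ (Fin n)) x)
  refine ⟨max C₁ C₂, lt_max_of_lt_left hC₁, ?_⟩
  filter_upwards [h₁, h₂, hO] with y hy₁ hy₂ hy
  refine ⟨hy, fun w => ⟨?_, ?_⟩⟩
  · rw [coordVec_eq_continuousLinearMapAt hy]
    refine (ContinuousLinearMap.le_opNorm _ _).trans ?_
    gcongr
    exact hy₁.le.trans (le_max_left _ _)
  · have h := ContinuousLinearMap.le_opNorm ((trivializationAt (EuclideanSpace ℝ (Fin n))
      (TangentSpace (𝓡 n) : N → Type _) x).symmL ℝ y) (coordVec x y w)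
    rw [Trivialization.symmL_apply _ hy] at h
    have h' : ‖w‖ ≤ _ := (congrArg norm (coordField_coordVec hy w)).symm.trans_le h
    refine h'.trans ?_
    gcongr
    exact hy₂.le.trans (le_max_right _ _)

end Norm

section Covariance

variable {Ω V G : Type*} [MeasurableSpace Ω] {P : Measure Ω}
  [NormedAddCommGroup V] [InnerProductSpace ℝ V]
  [NormedAddCommGroup G] [NormedSpace ℝ G]

theorem integrable_tmul_self {X : Ω → V} (hX : MemLp X 2 P) :
    Integrable (fun a => X a ⊗ₜ[ℝ] X a) P := by
  have hc : Continuous fun v : V => v ⊗ₜ[ℝ] v :=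
    (TensorProduct.continuous_tmul (𝕜 := ℝ) (E := V) (F := V)).comp
      (continuous_id.prodMk continuous_id)
  refine (hX.integrable_norm_pow (by norm_num)).mono' (hc.comp_aestronglyMeasurable hX.1)
    (Eventually.of_forall fun a => ?_)
  rw [TensorProduct.norm_tmul, ← pow_two]

/-- A linear map on the tensor square commutes with the expectation in the covariance tensor. -/
theorem map_covTensor [IsProbabilityMeasure P] [FiniteDimensional ℝ V] [FiniteDimensional ℝ G]
    {η : Ω → V} (hη : MemLp η 2 P) (Λ : V ⊗[ℝ] V →ₗ[ℝ] G) :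
    Λ (covTensor P η)
      = ∫ a, Λ ((η a - ∫ a', η a' ∂P) ⊗ₜ[ℝ] (η a - ∫ a', η a' ∂P)) ∂P := by
  have h := integrable_tmul_self (hη.sub (memLp_const (∫ a', η a' ∂P)))
  exact (ContinuousLinearMap.integral_comp_comm (LinearMap.toContinuousLinearMap Λ) h).symm

end Covariance

section Transfer

variable {n : ℕ} {N : Type*} [TopologicalSpace N] [ChartedSpace (EuclideanSpace ℝ (Fin n)) N]
  [IsManifold (𝓡 n) ∞ N]

/-- The coordinates of the tangent vectors at a point of the domain of the chart at `x₀`, as a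
continuous linear equivalence. -/
def coordEquiv {x₀ y : N} (hy : y ∈ (chartAt (EuclideanSpace ℝ (Fin n)) x₀).source) :
    TangentSpace (𝓡 n) y ≃L[ℝ] EuclideanSpace ℝ (Fin n) :=
  (trivializationAt (EuclideanSpace ℝ (Fin n))
    (TangentSpace (𝓡 n) : N → Type _) x₀).continuousLinearEquivAt ℝ y hy

variable
  {D : CovariantDerivative (𝓡 n) (EuclideanSpace ℝ (Fin n)) (TangentSpace (𝓡 n) : N → Type _)}
  {U : Set N} {x y z : N} {Ω : Type*} [MeasurableSpace Ω] {P : Measure Ω}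

theorem IsGeodesicallyConvex.aestronglyMeasurable_coordVec_expInv [MeasurableSpace N]
    [BorelSpace N] (hU : IsGeodesicallyConvex D U) (hz : z ∈ U)
    (hzx : z ∈ (chartAt (EuclideanSpace ℝ (Fin n)) x).source) {Z : Ω → N} (hZ : Measurable Z)
    (hZU : ∀ᵐ a ∂P, Z a ∈ U) :
    AEStronglyMeasurable (fun a => coordVec x z (expInv D U z (Z a))) P := by
  have hc : ContinuousOn (fun p => expInv D U z p) U := by
    have h1 := hU.smooth.continuousOn.comp (f := fun p => (z, p)) (s := U) (by fun_prop)
      fun p hp => ⟨hz, hp⟩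
    exact (FiberBundle.totalSpaceMk_isInducing (EuclideanSpace ℝ (Fin n))
      (TangentSpace (𝓡 n) : N → Type _) z).continuousOn_iff.2 h1
  have hc' : ContinuousOn (fun p => coordVec x z (expInv D U z p)) U :=
    (coordEquiv hzx).continuous.comp_continuousOn hc
  have h2 : (P.map Z).restrict U = P.map Z :=
    Measure.restrict_eq_self_of_ae_mem ((ae_map_iff hZ.aemeasurable hU.isOpen.measurableSet).2 hZU)
  have h3 : AEStronglyMeasurable (fun p => coordVec x z (expInv D U z p)) (P.map Z) := by
    rw [← h2]
    exact hc'.aestronglyMeasurable hU.isOpen.measurableSet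
  exact h3.comp_measurable hZ

variable [RiemannianBundle (fun y : N => TangentSpace (𝓡 n) y)]

theorem coordVec_integral (hy : y ∈ (chartAt (EuclideanSpace ℝ (Fin n)) x).source)
    (f : Ω → TangentSpace (𝓡 n) y) :
    coordVec x y (∫ a, f a ∂P) = ∫ a, coordVec x y (f a) ∂P :=
  ((coordEquiv hy).integral_comp_comm f).symm

theorem integrable_coordVec_iff (hy : y ∈ (chartAt (EuclideanSpace ℝ (Fin n)) x).source)
    {f : Ω → TangentSpace (𝓡 n) y} :
    Integrable (fun a => coordVec x y (f a)) P ↔ Integrable f P :=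
  (coordEquiv hy).integrable_comp_iff

theorem memLp_coordVec (hy : y ∈ (chartAt (EuclideanSpace ℝ (Fin n)) x).source)
    {f : Ω → TangentSpace (𝓡 n) y} {p : ENNReal} (hf : MemLp f p P) :
    MemLp (fun a => coordVec x y (f a)) p P :=
  (coordEquiv hy).toContinuousLinearMap.comp_memLp' hf

/-- The vector `∑ R_{ijk} μⁱ Σʲᵏ` is the expectation of `R(μ, η - μ)(η - μ)`. -/
theorem coordVec_curvatureSum [T2Space N] [D.ContMDiffCovariantDerivative ∞]
    [IsProbabilityMeasure P] (b : Module.Basis (Fin n) ℝ (TangentSpace (𝓡 n) x))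
    (m : TangentSpace (𝓡 n) x) {η : Ω → TangentSpace (𝓡 n) x} (hη : MemLp η 2 P) :
    coordVec x x (curvatureSum D x b m (covTensor P η)) =
      ∫ a, localCurvatureMap (coordConnector D x) (extChartAt (𝓡 n) x x) (coordVec x x m)
        (coordVec x x (η a - ∫ a', η a' ∂P)) (coordVec x x (η a - ∫ a', η a' ∂P)) ∂P := by
  set R := localCurvatureMap (coordConnector D x) (extChartAt (𝓡 n) x x) with hR
  have hxs := mem_chart_source (EuclideanSpace ℝ (Fin n)) x
  let e : TangentSpace (𝓡 n) x →ₗ[ℝ] EuclideanSpace ℝ (Fin n) :=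
    (coordEquiv hxs).toLinearEquiv.toLinearMap
  -- the trilinear expression `R(m, ·, ·)` as a linear map on the tensor square
  let Λ : TangentSpace (𝓡 n) x ⊗[ℝ] TangentSpace (𝓡 n) x →ₗ[ℝ] EuclideanSpace ℝ (Fin n) :=
    TensorProduct.lift (((R (coordVec x x m)).toLinearMap₁₂).compl₁₂ e e)
  have hΛ : ∀ a c, Λ (a ⊗ₜ c) = R (coordVec x x m) (coordVec x x a) (coordVec x x c) :=
    fun a c => TensorProduct.lift.tmul _ _
  have key : ∀ S, coordVec x x (curvatureSum D x b m S) = Λ S := by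
    intro S
    conv_rhs => rw [← (b.tensorProduct b).sum_repr S]
    have hm : coordVec x x m = ∑ i, b.repr m i • coordVec x x (b i) := by
      refine (congrArg (coordVec x x) (b.sum_repr m).symm).trans ?_
      refine (map_sum e _ _).trans (Finset.sum_congr rfl fun i _ => map_smul e _ _)
    rw [map_sum, Fintype.sum_prod_type]
    have h1 : coordVec x x (curvatureSum D x b m S) = ∑ i, ∑ j, ∑ k,
        (b.repr m i * (b.tensorProduct b).repr S (j, k)) •
          R (coordVec x x (b i)) (coordVec x x (b j)) (coordVec x x (b k)) := by
      refine (map_sum e _ _).trans (Finset.sum_congr rfl fun i _ => ?_)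
      refine (map_sum e _ _).trans (Finset.sum_congr rfl fun j _ => ?_)
      refine (map_sum e _ _).trans (Finset.sum_congr rfl fun k _ => ?_)
      refine (map_smul e _ _).trans (congrArg _ ?_)
      rw [hR, localCurvatureMap_apply]
      exact coordVec_curvature D x _ _ _
    rw [h1, Finset.sum_comm]
    refine Finset.sum_congr rfl fun j _ => ?_
    rw [Finset.sum_comm]
    refine Finset.sum_congr rfl fun k _ => ?_
    rw [map_smul, Module.Basis.tensorProduct_apply, hΛ, hm]
    simp only [map_sum, map_smul, sum_apply, smul_apply, Finset.smul_sum, smul_smul]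
    exact Finset.sum_congr rfl fun i _ => by rw [mul_comm]
  have : FiniteDimensional ℝ (TangentSpace (𝓡 n) x) :=
    (coordEquiv hxs).symm.toLinearEquiv.finiteDimensional
  rw [key, map_covTensor hη]
  exact integral_congr_ae (Eventually.of_forall fun a => hΛ _ _)

end Transfer

/-! ### Asymptotics of the moments -/

section Asymptotics

theorem integrable_of_growth {E Ω : Type*} [NormedAddCommGroup E]
    [MeasurableSpace Ω] {P : Measure Ω} [IsProbabilityMeasure P] {C : ℝ} {X ζ : Ω → E}
    (hX : MemLp X 4 P) (hζ : AEStronglyMeasurable ζ P) (h : ∀ᵐ a ∂P, ‖ζ a‖ ≤ C * (1 + ‖X a‖)) :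
    Integrable ζ P := by
  have h3 := integrable_norm_pow_of_memLp_four hX (j := 1) (by norm_num)
  simp only [pow_one] at h3
  exact (((integrable_const 1).add h3).const_mul C).mono' hζ h

variable {E : Type*} [NormedAddCommGroup E] [NormedSpace ℝ E]

/-- A vector of at most linear growth has an integrable third moment under the fourth moment
condition. -/
theorem integrable_apply_self_of_growth {Ω : Type*} [MeasurableSpace Ω] {P : Measure Ω}
    [IsProbabilityMeasure P] (T : E →L[ℝ] E →L[ℝ] E →L[ℝ] E) {C : ℝ} (hC : 0 ≤ C) {X ζ : Ω → E}
    (hX : MemLp X 4 P) (hζ : AEStronglyMeasurable ζ P) (h : ∀ᵐ a ∂P, ‖ζ a‖ ≤ C * (1 + ‖X a‖)) :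
    Integrable (fun a => T (ζ a) (ζ a) (ζ a)) P := by
  have hi := ((memLp_const (1 : ℝ)).add hX.norm : MemLp _ 4 P)
  have hi3 := (integrable_norm_pow_of_memLp_four hi (j := 3) (by norm_num)).const_mul (‖T‖ * C ^ 3)
  have hT : Continuous fun w => T w w w := by fun_prop
  refine hi3.mono' (hT.comp_aestronglyMeasurable hζ) ?_
  filter_upwards [h] with a ha
  refine (norm_apply₃_le T _ _ _).trans ?_
  have : ‖(1 : ℝ) + ‖X a‖‖ = 1 + ‖X a‖ := Real.norm_of_nonneg (by positivity)
  change _ ≤ ‖T‖ * C ^ 3 * ‖(1 : ℝ) + ‖X a‖‖ ^ 3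
  rw [this]
  calc _ ≤ ‖T‖ * (C * (1 + ‖X a‖)) * (C * (1 + ‖X a‖)) * (C * (1 + ‖X a‖)) := by gcongr
    _ = _ := by ring

/-- The orders of magnitude, with the constant `A` and for one value of the parameter `γ`, of the
mean `m` of a random vector `η` and of its centred fourth moment, together with the corrected mean
`v = m - (1/3) E[R(m, η - m)(η - m)]`. -/
structure MomentBounds (R : E →L[ℝ] E →L[ℝ] E →L[ℝ] E) (A γ : ℝ) {Ω : Type*} [MeasurableSpace Ω]
    (P : Measure Ω) (η : Ω → E) (m v : E) : Prop where
  pos : 0 < γ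
  le_one : γ ≤ 1
  memLp : MemLp η 4 P
  mean_eq : m = ∫ a, η a ∂P
  norm_mean_le : ‖m‖ ≤ A * γ
  fourth_moment_le : ∫ a, ‖η a - m‖ ^ 4 ∂P ≤ A * γ ^ 4
  corrected_eq : v = m - (1 / 3 : ℝ) • ∫ a, R m (η a - m) (η a - m) ∂P

variable {Ω : ℝ → Type*} [∀ γ, MeasurableSpace (Ω γ)] {P : (γ : ℝ) → Measure (Ω γ)}
  [∀ γ, IsProbabilityMeasure (P γ)] {R : E →L[ℝ] E →L[ℝ] E →L[ℝ] E} {A C : ℝ}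
  {η ζ : (γ : ℝ) → Ω γ → E} {m v : ℝ → E}

theorem tendsto_corrected_mean (hA : 1 ≤ A)
    (h : ∀ᶠ γ in 𝓝[>] (0 : ℝ), MomentBounds R A γ (P γ) (η γ) (m γ) (v γ)) :
    Tendsto v (𝓝[>] 0) (𝓝 0) := by
  have hlim : Tendsto (fun γ : ℝ => A * γ + 1 / 3 * ((A + ‖R‖ * A * (1 + A)) * γ ^ 3))
      (𝓝[>] 0) (𝓝 0) := by
    have : Tendsto (fun γ : ℝ => A * γ + 1 / 3 * ((A + ‖R‖ * A * (1 + A)) * γ ^ 3))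
      (𝓝 0) (𝓝 (A * 0 + 1 / 3 * ((A + ‖R‖ * A * (1 + A)) * 0 ^ 3))) :=
        Continuous.tendsto (by fun_prop) 0
    simp only [mul_zero, ne_eq, OfNat.ofNat_ne_zero, not_false_eq_true, zero_pow, add_zero] at this
    exact this.mono_left nhdsWithin_le_nhds
  refine squeeze_zero_norm' ?_ hlim
  filter_upwards [h] with γ h
  rw [h.corrected_eq]
  refine (norm_sub_le _ _).trans (add_le_add h.norm_mean_le ?_)
  rw [norm_smul, Real.norm_of_nonneg (by norm_num)]
  gcongr
  exact norm_integral_apply_covariance_le R (h.memLp.sub (memLp_const _)) h.pos (by linarith)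
    h.norm_mean_le h.fourth_moment_le

/-- The asymptotic form of `norm_integral_le_of_expansion`. -/
theorem isBigO_integral_of_expansion [CompleteSpace E] {L : E → E →L[ℝ] E} (hA : 1 ≤ A)
    (hC : 0 ≤ C) (h : ∀ᶠ γ in 𝓝[>] (0 : ℝ), MomentBounds R A γ (P γ) (η γ) (m γ) (v γ))
    (hL : ∀ᶠ γ in 𝓝[>] (0 : ℝ), ‖L (v γ)‖ ≤ C * ‖v γ‖)
    (hi : ∀ᶠ γ in 𝓝[>] (0 : ℝ), Integrable (ζ γ) (P γ))
    (hζ : ∀ᶠ γ in 𝓝[>] (0 : ℝ), ∀ᵐ a ∂(P γ),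
      ‖ζ γ a - (η γ a - v γ + L (v γ) (η γ a - v γ)
        - (1 / 3 : ℝ) • R (v γ) (η γ a - v γ) (η γ a - v γ))‖
        ≤ C * (‖v γ‖ * ‖η γ a - v γ‖ ^ 3 + ‖v γ‖ ^ 2 * ‖η γ a - v γ‖ ^ 2 + ‖η γ a‖ ^ 4)) :
    (fun γ => ∫ a, ζ γ a ∂(P γ)) =O[𝓝[>] (0 : ℝ)] fun γ => γ ^ 4 := by
  refine IsBigO.of_bound ((48 * C * (A + ‖R‖ * A * (1 + A)) ^ 4
    + C * (A + ‖R‖ * A * (1 + A)) ^ 2 + 7 * ‖R‖ * (A + ‖R‖ * A * (1 + A)) ^ 3) * (1 + A)) ?_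
  filter_upwards [h, hL, hi, hζ] with γ h hL hi hζ
  rw [Real.norm_of_nonneg (pow_nonneg h.pos.le 4)]
  exact norm_integral_le_of_expansion R hA hC h.pos h.le_one h.memLp h.mean_eq h.norm_mean_le
    h.fourth_moment_le h.corrected_eq hL hi hζ

/-- The asymptotic form of `norm_integral_le_of_cubic`. -/
theorem isBigO_integral_of_cubic (T : E →L[ℝ] E →L[ℝ] E →L[ℝ] E) (hA : 1 ≤ A)
    (hC : 0 ≤ C) (h : ∀ᶠ γ in 𝓝[>] (0 : ℝ), MomentBounds R A γ (P γ) (η γ) (m γ) (v γ))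
    (hT : (fun γ => ∫ a, T (η γ a - m γ) (η γ a - m γ) (η γ a - m γ) ∂(P γ))
      =O[𝓝[>] (0 : ℝ)] fun γ => γ ^ 4)
    (hi : ∀ᶠ γ in 𝓝[>] (0 : ℝ), Integrable (ζ γ) (P γ))
    (hζ : ∀ᶠ γ in 𝓝[>] (0 : ℝ), ∀ᵐ a ∂(P γ),
      ‖ζ γ a - T (η γ a - v γ) (η γ a - v γ) (η γ a - v γ)‖
        ≤ C * (‖v γ‖ * ‖η γ a - v γ‖ ^ 3 + ‖η γ a‖ ^ 4)) :
    (fun γ => ∫ a, ζ γ a ∂(P γ)) =O[𝓝[>] (0 : ℝ)] fun γ => γ ^ 4 := by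
  obtain ⟨c, hc⟩ := hT.bound
  refine IsBigO.of_bound (c + (32 * C * (A + ‖R‖ * A * (1 + A)) ^ 4
    + 7 * ‖T‖ * (A + ‖R‖ * A * (1 + A)) ^ 3) * (1 + A)) ?_
  filter_upwards [h, hc, hi, hζ] with γ h hc hi hζ
  rw [Real.norm_of_nonneg (pow_nonneg h.pos.le 4)] at hc ⊢
  rw [add_mul]
  exact (norm_integral_le_of_cubic R T hA hC h.pos h.le_one h.memLp h.norm_mean_le
    h.fourth_moment_le h.corrected_eq hi hζ).trans (by gcongr)

end Asymptotics

/-! ### Transfer of the asymptotics to the manifold -/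

section Barycentre

variable {n : ℕ} {N : Type*} [TopologicalSpace N]
  [ChartedSpace (EuclideanSpace ℝ (Fin n)) N] [IsManifold (𝓡 n) ∞ N]
  [RiemannianBundle (fun y : N => TangentSpace (𝓡 n) y)] {x : N}

/-- Linear growth in the norms of the tangent spaces gives linear growth in coordinates. -/
theorem norm_coordVec_le_of_growth {K C : ℝ} (hK : 0 ≤ K) {z : N}
    (hKx : ∀ w : TangentSpace (𝓡 n) x, ‖w‖ ≤ K * ‖coordVec x x w‖)
    (hKz : ∀ w : TangentSpace (𝓡 n) z, ‖coordVec x z w‖ ≤ K * ‖w‖)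
    {e : TangentSpace (𝓡 n) x} {ζ : TangentSpace (𝓡 n) z} (h : ‖ζ‖ ≤ C * (1 + ‖e‖)) :
    ‖coordVec x z ζ‖ ≤ K * max C 0 * (1 + K) * (1 + ‖coordVec x x e‖) := by
  have h1 := hKx e
  have h0 := norm_nonneg (coordVec x x e)
  calc _ ≤ K * ‖ζ‖ := hKz _
    _ ≤ K * (max C 0 * (1 + K * ‖coordVec x x e‖)) := by
      gcongr
      refine h.trans ?_
      gcongr
      exact le_max_left _ _
    _ = K * max C 0 * (1 + K * ‖coordVec x x e‖) := by ring
    _ ≤ K * max C 0 * ((1 + K) * (1 + ‖coordVec x x e‖)) := by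
      gcongr
      nlinarith
    _ = _ := by ring

variable [IsContinuousRiemannianBundle (EuclideanSpace ℝ (Fin n))
    (fun y : N => TangentSpace (𝓡 n) y)]
  {Ω : ℝ → Type*} [∀ γ, MeasurableSpace (Ω γ)] {P : (γ : ℝ) → Measure (Ω γ)}

/-- For base points which tend to `x`, expectations of random tangent vectors may be estimated in
the coordinates of the chart at `x`. -/
theorem isBigO_integral_coordVec_iff {y : ℝ → N} (hy : Tendsto y (𝓝[>] 0) (𝓝 x))
    (f : (γ : ℝ) → Ω γ → TangentSpace (𝓡 n) (y γ)) {g : ℝ → ℝ} :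
    (fun γ => ∫ a, coordVec x (y γ) (f γ a) ∂(P γ)) =O[𝓝[>] (0 : ℝ)] g ↔
      (fun γ => ‖∫ a, f γ a ∂(P γ)‖) =O[𝓝[>] (0 : ℝ)] g := by
  obtain ⟨K, hK0, hK⟩ := exists_norm_coordVec_le (n := n) x
  have hKy := hy.eventually hK
  constructor
  · refine (IsBigO.of_bound K ?_).trans
    filter_upwards [hKy] with γ h
    rw [norm_norm, ← coordVec_integral h.1]
    exact (h.2 _).2
  · refine (IsBigO.of_bound K ?_).trans
    filter_upwards [hKy] with γ h
    rw [norm_norm, ← coordVec_integral h.1]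
    exact (h.2 _).1

/-- In the coordinates of the chart at `x`, the random vectors `exp_x⁻¹ Z` satisfy the moment
bounds, and the initial velocity `v` of the geodesic to the approximate barycentre is the
corrected mean. -/
theorem exists_coordVec_moment_bounds [T2Space N] [∀ γ, IsProbabilityMeasure (P γ)]
    {D : CovariantDerivative (𝓡 n) (EuclideanSpace ℝ (Fin n)) (TangentSpace (𝓡 n) : N → Type _)}
    [D.ContMDiffCovariantDerivative ∞] (b : Module.Basis (Fin n) ℝ (TangentSpace (𝓡 n) x))
    (η : (γ : ℝ) → Ω γ → TangentSpace (𝓡 n) x)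
    (μ : ℝ → TangentSpace (𝓡 n) x) (hμ : ∀ γ, μ γ = ∫ a, η γ a ∂(P γ))
    (hη_memLp : ∀ᶠ γ in 𝓝[>] (0 : ℝ), MemLp (η γ) 4 (P γ))
    (hμ_O : (fun γ => ‖μ γ‖) =O[𝓝[>] (0 : ℝ)] fun γ => γ)
    (hη_O : (fun γ => ∫ a, ‖η γ a - μ γ‖ ^ 4 ∂(P γ)) =O[𝓝[>] (0 : ℝ)] fun γ => γ ^ 4)
    (v : ℝ → TangentSpace (𝓡 n) x)
    (hv : ∀ γ, v γ = μ γ - (1 / 3 : ℝ) • curvatureSum D x b (μ γ) (covTensor (P γ) (η γ))) :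
    ∃ A : ℝ, 1 ≤ A ∧ ∀ᶠ γ in 𝓝[>] (0 : ℝ),
      MomentBounds (localCurvatureMap (coordConnector D x) (extChartAt (𝓡 n) x x)) A γ (P γ)
        (fun a => coordVec x x (η γ a)) (coordVec x x (μ γ)) (coordVec x x (v γ)) := by
  have hxs := mem_chart_source (EuclideanSpace ℝ (Fin n)) x
  obtain ⟨K, hK0, hK⟩ := exists_norm_coordVec_le (n := n) x
  have hKx := hK.self_of_nhds.2
  obtain ⟨c₁, hc₁⟩ := hμ_O.bound
  obtain ⟨c₂, hc₂⟩ := hη_O.bound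
  refine ⟨max 1 (max (K * c₁) (K ^ 4 * c₂)), le_max_left _ _, ?_⟩
  have h1 : ∀ᶠ γ in 𝓝[>] (0 : ℝ), γ ≤ 1 :=
    nhdsWithin_le_nhds (eventually_le_nhds one_pos)
  filter_upwards [hc₁, hc₂, h1, self_mem_nhdsWithin, hη_memLp] with γ hc₁ hc₂ h1 h0 hL
  have h0 : 0 < γ := h0
  rw [norm_norm, Real.norm_of_nonneg h0.le] at hc₁
  rw [Real.norm_of_nonneg (by positivity), Real.norm_of_nonneg (by positivity)] at hc₂
  have hsub : ∀ a, coordVec x x (η γ a) - coordVec x x (μ γ) = coordVec x x (η γ a - μ γ) :=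
    fun a => (coordVec_sub hxs _ _).symm
  refine ⟨h0, h1, memLp_coordVec hxs hL, ?_, ?_, ?_, ?_⟩
  · rw [hμ]; exact coordVec_integral hxs _
  · calc _ ≤ K * ‖μ γ‖ := (hKx _).1
      _ ≤ K * (c₁ * γ) := by gcongr
      _ = (K * c₁) * γ := by ring
      _ ≤ _ := by gcongr; exact (le_max_left _ _).trans (le_max_right _ _)
  · have hi := (integrable_norm_pow_of_memLp_four (hL.sub (memLp_const (μ γ))) le_rfl).const_mul
      (K ^ 4)
    calc _ ≤ ∫ a, K ^ 4 * ‖η γ a - μ γ‖ ^ 4 ∂(P γ) := by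
          refine integral_mono_of_nonneg (Eventually.of_forall fun a => by positivity) hi
            (Eventually.of_forall fun a => ?_)
          change ‖_‖ ^ 4 ≤ K ^ 4 * ‖_‖ ^ 4
          rw [hsub, ← mul_pow]
          exact pow_le_pow_left₀ (norm_nonneg _) (hKx _).1 4
      _ = K ^ 4 * ∫ a, ‖η γ a - μ γ‖ ^ 4 ∂(P γ) := integral_const_mul _ _
      _ ≤ K ^ 4 * (c₂ * γ ^ 4) := by gcongr
      _ = (K ^ 4 * c₂) * γ ^ 4 := by ring
      _ ≤ _ := by gcongr; exact (le_max_right _ _).trans (le_max_right _ _)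
  · rw [hv, coordVec_sub hxs, coordVec_smul hxs,
      coordVec_curvatureSum b _ (hL.mono_exponent (by norm_num)), ← hμ]
    simp only [hsub]

end Barycentre

end ExpBary

end

theorem theorem3p2 {n : ℕ} {N : Type*} [TopologicalSpace N] [T2Space N]
    [ChartedSpace (EuclideanSpace ℝ (Fin n)) N] [IsManifold (𝓡 n) ∞ N]
    [MeasurableSpace N] [BorelSpace N]
    -- the reference metric, which gives the norm on the tangent spaces
    [RiemannianBundle (fun y : N => TangentSpace (𝓡 n) y)]
    [IsContinuousRiemannianBundle (EuclideanSpace ℝ (Fin n))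
      (fun y : N => TangentSpace (𝓡 n) y)]
    -- the smooth torsion-free connection
    (D : CovariantDerivative (𝓡 n) (EuclideanSpace ℝ (Fin n)) (TangentSpace (𝓡 n) : N → Type _))
    [D.ContMDiffCovariantDerivative ∞] (hD : D.torsion = 0)
    (U : Set N) (hU : ExpBary.IsGeodesicallyConvex D U) (x : N) (hx : x ∈ U)
    (b : Module.Basis (Fin n) ℝ (TangentSpace (𝓡 n) x))
    -- the random points `Z γ`, for `γ → 0+`
    {Ω : ℝ → Type*} [∀ γ, MeasurableSpace (Ω γ)]
    (P : (γ : ℝ) → Measure (Ω γ)) [∀ γ, IsProbabilityMeasure (P γ)]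
    (Z : (γ : ℝ) → Ω γ → N) (hZ : ∀ γ, Measurable (Z γ))
    (hZU : ∀ᶠ γ in 𝓝[>] (0 : ℝ), ∀ᵐ a ∂(P γ), Z γ a ∈ U)
    (η : (γ : ℝ) → Ω γ → TangentSpace (𝓡 n) x)
    (hη : ∀ γ a, η γ a = ExpBary.expInv D U x (Z γ a))
    (μ : ℝ → TangentSpace (𝓡 n) x) (hμ : ∀ γ, μ γ = ∫ a, η γ a ∂(P γ))
    (S : ℝ → TangentSpace (𝓡 n) x ⊗[ℝ] TangentSpace (𝓡 n) x)
    (hS : ∀ γ, S γ = ExpBary.covTensor (P γ) (η γ))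
    -- orders of magnitude
    (hη_memLp : ∀ᶠ γ in 𝓝[>] (0 : ℝ), MemLp (η γ) 4 (P γ))
    (hμ_O : (fun γ => ‖μ γ‖) =O[𝓝[>] (0 : ℝ)] fun γ => γ)
    (hS_O : (fun γ => ‖S γ‖) =O[𝓝[>] (0 : ℝ)] fun γ => γ ^ 2)
    (hη_O : (fun γ => ∫ a, ‖η γ a - μ γ‖ ^ 4 ∂(P γ)) =O[𝓝[>] (0 : ℝ)] fun γ => γ ^ 4)
    -- the approximate exponential barycentre
    (v : ℝ → TangentSpace (𝓡 n) x)
    (hv : ∀ γ, v γ = μ γ - (1 / 3 : ℝ) • ExpBary.curvatureSum D x b (μ γ) (S γ))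
    (z : ℝ → N) (hz : ∀ γ, z γ = ExpBary.expMap D x (v γ))
    (ζ : (γ : ℝ) → Ω γ → TangentSpace (𝓡 n) (z γ))
    (hζ : ∀ γ a, ζ γ a = ExpBary.expInv D U (z γ) (Z γ a))
    (hgrowth : ∃ C : ℝ, ∀ᶠ γ in 𝓝[>] (0 : ℝ), ∀ᵐ a ∂(P γ), ‖ζ γ a‖ ≤ C * (1 + ‖η γ a‖)) :
    (∀ᶠ γ in 𝓝[>] (0 : ℝ), ExpBary.GeodesicArc D univ x (v γ) (z γ) ∧ z γ ∈ U) ∧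
    (∀ᶠ γ in 𝓝[>] (0 : ℝ), Integrable (ζ γ) (P γ)) ∧
    ((fun γ => ‖∫ a, ζ γ a ∂(P γ)‖) =O[𝓝[>] (0 : ℝ)] fun γ => γ ^ 4) ∧
    ∀ T : ExpBary.TensorField13 n N,
      ((fun γ => ‖∫ a, T.toFun x (η γ a - μ γ) (η γ a - μ γ) (η γ a - μ γ) ∂(P γ)‖)
        =O[𝓝[>] (0 : ℝ)] fun γ => γ ^ 4) →
      (∀ᶠ γ in 𝓝[>] (0 : ℝ),
        Integrable (fun a => T.toFun (z γ) (ζ γ a) (ζ γ a) (ζ γ a)) (P γ)) ∧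
      ((fun γ => ‖∫ a, T.toFun (z γ) (ζ γ a) (ζ γ a) (ζ γ a) ∂(P γ)‖)
        =O[𝓝[>] (0 : ℝ)] fun γ => γ ^ 4) := by
  have hxs := mem_chart_source (EuclideanSpace ℝ (Fin n)) x
  obtain ⟨A, hA, hmom⟩ := ExpBary.exists_coordVec_moment_bounds b η μ hμ hη_memLp hμ_O hη_O v
    fun γ => by rw [hv, hS]
  have hw := ExpBary.tendsto_corrected_mean hA hmom
  have hzexp : ∀ γ, z γ = ExpBary.expCoord D x (ExpBary.coordVec x x (v γ)) := fun γ => by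
    rw [hz, ExpBary.expCoord_coordVec]
  have hzx : Tendsto z (𝓝[>] 0) (𝓝 x) :=
    ((hU.tendsto_expCoord hD hx).comp hw).congr fun γ => (hzexp γ).symm
  have hzU : ∀ᶠ γ in 𝓝[>] (0 : ℝ), z γ ∈ U := hzx.eventually (hU.isOpen.mem_nhds hx)
  obtain ⟨K, hK0, hK⟩ := ExpBary.exists_norm_coordVec_le (n := n) x
  have hKz := hzx.eventually hK
  obtain ⟨C₁, hC₁⟩ := hgrowth
  obtain ⟨C₀, hC₀0, hgrow⟩ : ∃ C₀ : ℝ, 0 ≤ C₀ ∧ ∀ᶠ γ in 𝓝[>] (0 : ℝ), ∀ᵐ a ∂(P γ),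
      ‖ExpBary.coordVec x (z γ) (ζ γ a)‖ ≤ C₀ * (1 + ‖ExpBary.coordVec x x (η γ a)‖) := by
    refine ⟨K * max C₁ 0 * (1 + K), by positivity, ?_⟩
    filter_upwards [hC₁, hKz] with γ h hKz
    filter_upwards [h] with a ha
    exact ExpBary.norm_coordVec_le_of_growth hK0.le (fun w => (hK.self_of_nhds.2 w).2)
      (fun w => (hKz.2 w).1) ha
  have hmeas : ∀ᶠ γ in 𝓝[>] (0 : ℝ),
      AEStronglyMeasurable (fun a => ExpBary.coordVec x (z γ) (ζ γ a)) (P γ) := by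
    filter_upwards [hzU, hKz, hZU] with γ h1 h2 h3
    simp only [hζ]
    exact hU.aestronglyMeasurable_coordVec_expInv h1 h2.1 (hZ γ) h3
  have hint : ∀ᶠ γ in 𝓝[>] (0 : ℝ),
      Integrable (fun a => ExpBary.coordVec x (z γ) (ζ γ a)) (P γ) := by
    filter_upwards [hmom, hmeas, hgrow] with γ h h1 h2
    exact ExpBary.integrable_of_growth h.memLp h1 h2
  refine ⟨?_, ?_, ?_, fun T hT => ?_⟩
  · obtain ⟨k, _, _, hk, _⟩ := hU.exists_expCoord_expansion hD hx
    filter_upwards [hw.eventually hk, hzU] with γ h1 h2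
    refine ⟨?_, h2⟩
    have h3 := h1.1
    rw [← hzexp, ExpBary.coordField_coordVec hxs] at h3
    exact h3
  · filter_upwards [hint, hKz] with γ h1 h2
    exact (ExpBary.integrable_coordVec_iff h2.1).1 h1
  · obtain ⟨L, C, hC, hLC⟩ := hU.exists_norm_sub_expansion_le hD hx hC₀0
    have hLv := hw.eventually hLC
    refine (ExpBary.isBigO_integral_coordVec_iff hzx ζ).1
      (ExpBary.isBigO_integral_of_expansion (L := L) hA hC hmom (hLv.mono fun _ h => h.1) hint ?_)
    filter_upwards [hgrow, hZU, hLv] with γ hgr hZγ hexp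
    filter_upwards [hgr, hZγ] with a h1 h2
    refine hexp.2 (Z γ a) h2 _ _ (by rw [hη]) ?_ h1
    rw [← hzexp, hζ]
  · obtain ⟨C, hC, hTC⟩ := hU.exists_norm_sub_cubic_le hD hx hC₀0 T
    have hTint : ∀ᶠ γ in 𝓝[>] (0 : ℝ), Integrable
        (fun a => ExpBary.coordVec x (z γ) (T.toFun (z γ) (ζ γ a) (ζ γ a) (ζ γ a))) (P γ) := by
      filter_upwards [hmom, hmeas, hgrow, hKz] with γ h h1 h2 h3
      simp only [← ExpBary.coordTensor_apply T h3.1]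
      exact ExpBary.integrable_apply_self_of_growth _ hC₀0 h.memLp h1 h2
    refine ⟨?_, ?_⟩
    · filter_upwards [hTint, hKz] with γ h1 h2
      exact (ExpBary.integrable_coordVec_iff h2.1).1 h1
    · refine (ExpBary.isBigO_integral_coordVec_iff hzx _).1
        (ExpBary.isBigO_integral_of_cubic (ExpBary.coordTensor x T (extChartAt (𝓡 n) x x)) hA hC
          hmom ?_ hTint ?_)
      · simp only [← ExpBary.coordVec_sub hxs, ExpBary.coordTensor_apply T hxs]
        exact (ExpBary.isBigO_integral_coordVec_iff tendsto_const_nhds _).2 hT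
      · filter_upwards [hgrow, hZU, hw.eventually hTC, hKz] with γ hgr hZγ hexp h3
        filter_upwards [hgr, hZγ] with a h1 h2
        rw [← ExpBary.coordTensor_apply T h3.1]
        have h4 := hexp (Z γ a) h2 (ExpBary.coordVec x x (η γ a))
          (ExpBary.coordVec x (z γ) (ζ γ a)) (by rw [hη]) (by rw [← hzexp, hζ]) h1
        rw [← hzexp] at h4
        exact h4
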